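/- **Setting.** Let $A\in\mathbb R^{d\times n_1}$ and $B\in\mathbb R^{d\times n_2}$ be the matrices whose columns are the points with label $+1$ and $-1$; $d$ is a power of two, $n=n_1+n_2$, and every point has Euclidean norm at most $1$. Let $(\mathcal S_1,\mathcal S_2)$ be either $(\Delta_{n_1},\Delta_{n_2})$, where $\Delta_m$ is the probability simplex (HM-Saddle), or $(\mathcal D_{n_1},\mathcal D_{n_2})$, where $\mathcal D_m=\{u\in\Delta_m: u_i\le\nu\ \forall i\}$ (ν-Saddle); both sets are assumed non-empty. The two (reduced) convex hulls are assumed disjoint: $A\eta\ne B\xi$ for all $\eta\in\mathcal S_1,\ \xi\in\mathcal S_2$. For $H(u)=\sum_i u_i\log u_i$ and $\gamma'\ge 0$ put $$g_{\gamma'}(w)=\min_{\eta\in\mathcal S_1,\ \xi\in\mathcal S_2}\ w^{T}A\eta-w^{T}B\xi+\gamma' H(\eta)+\gamma' H(\xi)-\tfrac12\|w\|^2,\qquad g=g_0,\qquad \mathsf{OPT}=\max_w g(w).$$ Let $\varepsilon\in(0,1)$, $\beta\in(0,1]$ and $\gamma=\varepsilon\beta/(2\log n)$. HM-Saddle and ν-Saddle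 are the problems $\max_w g_\gamma(w)$. **Algorithm (Saddle-SVC).** Let $W$ be the $d\times d$ Walsh–Hadamard matrix, normalized by $1/\sqrt d$, and $D$ a diagonal matrix with independent uniform random signs; put $X^+=WDA$, $X^-=WDB$. For a constant $c$ put $q=c\sqrt{\log n}$, $\tau=\frac1{2q}\sqrt{d/\gamma}$, $\sigma=\frac1{2q}\sqrt{d\gamma}$, $\theta=1-\frac1{d+q\sqrt d/\sqrt\gamma}$. Start with $w[0]=0$, $\eta[-1]=\eta[0]=\mathbf 1/n_1$, $\xi[-1]=\xi[0]=\mathbf 1/n_2$. In iteration $t$ pick $i^*\in\{1,\dots,d\}$ uniformly at random (independently of everything before), let $$\delta^+=\langle X^+_{i^*},\eta[t]+\theta(\eta[t]-\eta[t-1])\rangle,\qquad \delta^-=\langle X^-_{i^*},\xi[t]+\theta(\xi[t]-\xi[t-1])\rangle,$$ where $X^{\pm}_{i^*}$ is row $i^*$; set $w_{i^*}[t+1]=(w_{i^*}[t]+\sigma(\delta^+-\delta^-))/(\sigma+1)$ and leave the other coordinates of $w$ unchanged; then, with $u=w[t]+d(w[t+1]-w[t])$ and $V_x(y)=H(y)-\langle\nabla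 H(x),y-x\rangle-H(x)$, set $$\eta[t+1]=\arg\min_{\eta\in\mathcal S_1}\Big\{\tfrac1d u^TX^+\eta+\tfrac\gamma d H(\eta)+\tfrac1\tau V_{\eta[t]}(\eta)\Big\},\qquad \xi[t+1]=\arg\min_{\xi\in\mathcal S_2}\Big\{-\tfrac1d u^TX^-\xi+\tfrac\gamma d H(\xi)+\tfrac1\tau V_{\xi[t]}(\xi)\Big\}.$$ After $T$ iterations the computed direction is $\hat w_T=(WD)^Tw[T]$, i.e. $w[T]$ in the original coordinates. **Theorem.** 1. *(Convergence.)* For every $a\in\mathbb N$ there is $c_0>0$ such that for every $c\ge c_0$ there is $C>0$ (depending only on $a$ and $c$) such that the following holds for all data as above, in both versions, and all $\varepsilon\in(0,1)$, $\beta\in(0,1]$. The problem $\max_w g_\gamma(w)$ has a unique optimal solution $w^\circ$, and with probability at least $1-d\,n^{-a}$ over the choice of $D$, for every $$T\ \ge\ C\Big(d+\sqrt{\tfrac{d}{\varepsilon\beta}}\,\log n\Big)\log\frac{C}{\varepsilon\,\mathsf{OPT}}\ =\ \tilde O\Big(d+\sqrt{\tfrac d{\varepsilon\beta}}\Big),$$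 the vector $\hat w_T$ is, in expectation over the picked indices, a $(1-\varepsilon)$-approximate solution: $$\mathbb E\big[g(w^\circ)-g(\hat w_T)\big]\le\varepsilon\,\mathsf{OPT}\qquad\text{and}\qquad \mathbb E\big[g_\gamma(w^\circ)-g_\gamma(\hat w_T)\big]\le\varepsilon\,\mathsf{OPT}.$$ (If $\beta\le\mathsf{OPT}$, the last logarithm in the bound is at most $\log\frac{C}{\varepsilon\beta}$.) 2. *(Cost of an iteration.)* On a real RAM (unit cost for additions of natural numbers, real $+,-,\times,/$, $\exp$, $\log$, comparisons and reading or writing one memory cell) there are one program and one constant $K$ such that, for arbitrary $d,n_1,n_2$, matrices $X^{\pm}$, $\gamma,\tau,\sigma>0$, real $\theta$ and indices $i^*$, the program, started in the memory holding the data, the parameters and the initial variables and run once per iteration with the picked index $i^*$ as input, holds after $t$ runs exactly the variables $w[t],\eta[t],\eta[t-1],\xi[t],\xi[t-1]$ of the algorithm, and each run takes at most $2Kn$ steps for HM-Saddle and at most $Kn(1+1/\nu)$ steps for ν-Saddle, i.e. $O(n)$ for constant $\nu$. -/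

import Mathlib

open scoped BigOperators Matrix

noncomputable section

namespace SaddleSVC

/-! ### The saddle point problems -/

/-- The entropy function `H(u) = ∑ᵢ uᵢ log uᵢ` (with `0 log 0 = 0`). -/
def entropyH {m : ℕ} (u : Fin m → ℝ) : ℝ := ∑ i, u i * Real.log (u i)

/-- The Bregman divergence `V_x(y) = H(y) - ⟨∇H(x), y - x⟩ - H(x)`, where
`∇H(x)ᵢ = log xᵢ + 1`. -/
def bregman {m : ℕ} (x y : Fin m → ℝ) : ℝ :=
  entropyH y - ∑ i, (Real.log (x i) + 1) * (y i - x i) - entropyH x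

/-- The two versions of the problem: HM-Saddle, and ν-Saddle with its parameter `ν`. -/
inductive Variant where
  | hardMargin : Variant
  | nu (ν : ℝ) : Variant

/-- The domain of the weight vectors: the probability simplex for HM-Saddle, and the
probability vectors with all entries at most `ν` for ν-Saddle. -/
def Variant.domain : Variant → (m : ℕ) → Set (Fin m → ℝ)
  | .hardMargin, m => stdSimplex ℝ (Fin m)
  | .nu ν, _ => {u | (∀ i, 0 ≤ u i ∧ u i ≤ ν) ∧ ∑ i, u i = 1}

/-- The upper bound imposed on the entries: `ν` for ν-Saddle; for HM-Saddle the entries are at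
most `1` anyway. -/
def Variant.cap : Variant → ℝ
  | .hardMargin => 1
  | .nu ν => ν

/-- `wᵀAη - wᵀBξ + γ H(η) + γ H(ξ) - ‖w‖²/2`; the points with label `+1` (resp. `-1`) are the
columns of `A` (resp. `B`). -/
def saddleObj {d n₁ n₂ : ℕ} (A : Matrix (Fin d) (Fin n₁) ℝ) (B : Matrix (Fin d) (Fin n₂) ℝ)
    (γ : ℝ) (w : Fin d → ℝ) (η : Fin n₁ → ℝ) (ξ : Fin n₂ → ℝ) : ℝ :=
  w ⬝ᵥ (A *ᵥ η) - w ⬝ᵥ (B *ᵥ ξ) + γ * entropyH η + γ * entropyH ξ - (w ⬝ᵥ w) / 2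

/-- The minimum over `(η, ξ)` of the saddle objective (a minimum of a continuous function on a
compact set). For `γ = 0` this is the function `g`. -/
def lowerValue {d n₁ n₂ : ℕ} (v : Variant) (A : Matrix (Fin d) (Fin n₁) ℝ)
    (B : Matrix (Fin d) (Fin n₂) ℝ) (γ : ℝ) (w : Fin d → ℝ) : ℝ :=
  sInf ((fun p : (Fin n₁ → ℝ) × (Fin n₂ → ℝ) => saddleObj A B γ w p.1 p.2) ''
    (v.domain n₁ ×ˢ v.domain n₂))

/-- `OPT`: the value `max_w min_{η, ξ}` of the saddle point problem without regularization. -/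
def OPT {d n₁ n₂ : ℕ} (v : Variant) (A : Matrix (Fin d) (Fin n₁) ℝ)
    (B : Matrix (Fin d) (Fin n₂) ℝ) : ℝ :=
  ⨆ w : Fin d → ℝ, lowerValue v A B 0 w

/-- `w` is an optimal (maximizing) solution of the saddle point problem with weight `γ`. -/
def IsOptimal {d n₁ n₂ : ℕ} (v : Variant) (A : Matrix (Fin d) (Fin n₁) ℝ)
    (B : Matrix (Fin d) (Fin n₂) ℝ) (γ : ℝ) (w : Fin d → ℝ) : Prop :=
  ∀ w' : Fin d → ℝ, lowerValue v A B γ w' ≤ lowerValue v A B γ w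

/-! ### Pre-processing -/

/-- The normalized Walsh-Hadamard matrix (`d` a power of two): the `(i, j)` entry is
`(-1) ^ (number of common binary digits 1 of i and j) / √d`. -/
def walshHadamard (d : ℕ) : Matrix (Fin d) (Fin d) ℝ :=
  Matrix.of fun i j =>
    (∏ l ∈ Finset.range d, if i.val.testBit l && j.val.testBit l then (-1 : ℝ) else 1) / √(d : ℝ)

/-- The transformation `W D` with `D` the diagonal matrix of the signs `s`. -/
def hadamardTransform {d : ℕ} (s : Fin d → ℤˣ) : Matrix (Fin d) (Fin d) ℝ :=
  walshHadamard d * Matrix.diagonal fun i => ((s i : ℤ) : ℝ)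

/-- The parameters of the algorithm. -/
structure Params where
  γ : ℝ
  τ : ℝ
  σ : ℝ
  θ : ℝ

/-- The regularization weight `γ = ε β / (2 log n)`. -/
def gammaOf (n : ℕ) (ε β : ℝ) : ℝ := ε * β / (2 * Real.log n)

/-- The choice of parameters in the pre-processing, where `q = c √(log n)`. -/
def paramsOf (d n : ℕ) (ε β c : ℝ) : Params :=
  let γ := gammaOf n ε β
  let q := c * √(Real.log n)
  { γ := γ
    τ := 1 / (2 * q) * √(d / γ)
    σ := 1 / (2 * q) * √(d * γ)
    θ := 1 - 1 / (d + q * √d / √γ) }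

/-! ### The update rules -/

/-- A minimizer of `f` on `S`. -/
def argmin {α : Type*} [Nonempty α] (S : Set α) (f : α → ℝ) : α :=
  Classical.epsilon fun x => x ∈ S ∧ ∀ y ∈ S, f x ≤ f y

/-- The variables of the algorithm: `w[t], η[t], η[t-1], ξ[t], ξ[t-1]`. -/
structure State (d n₁ n₂ : ℕ) where
  w : Fin d → ℝ
  η : Fin n₁ → ℝ
  ηPrev : Fin n₁ → ℝ
  ξ : Fin n₂ → ℝ
  ξPrev : Fin n₂ → ℝ

def State.start (d n₁ n₂ : ℕ) : State d n₁ n₂ where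
  w := 0
  η := fun _ => 1 / n₁
  ηPrev := fun _ => 1 / n₁
  ξ := fun _ => 1 / n₂
  ξPrev := fun _ => 1 / n₂

/-- One iteration of the update rules on the transformed data `X⁺, X⁻`, when the index `i` has
been picked. -/
def State.next {d n₁ n₂ : ℕ} (v : Variant) (p : Params) (Xp : Matrix (Fin d) (Fin n₁) ℝ)
    (Xm : Matrix (Fin d) (Fin n₂) ℝ) (st : State d n₁ n₂) (i : Fin d) : State d n₁ n₂ :=
  let δp : ℝ := ∑ j, Xp i j * (st.η j + p.θ * (st.η j - st.ηPrev j))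
  let δm : ℝ := ∑ j, Xm i j * (st.ξ j + p.θ * (st.ξ j - st.ξPrev j))
  let w' : Fin d → ℝ := Function.update st.w i ((st.w i + p.σ * (δp - δm)) / (p.σ + 1))
  let u : Fin d → ℝ := st.w + (d : ℝ) • (w' - st.w)
  { w := w'
    η := argmin (v.domain n₁) fun η =>
      1 / d * (u ⬝ᵥ (Xp *ᵥ η)) + p.γ / d * entropyH η + 1 / p.τ * bregman st.η η
    ηPrev := st.η
    ξ := argmin (v.domain n₂) fun ξ =>
      -(1 / d * (u ⬝ᵥ (Xm *ᵥ ξ))) + p.γ / d * entropyH ξ + 1 / p.τ * bregman st.ξ ξ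
    ξPrev := st.ξ }

/-- The state after `T` iterations in which the indices `ι 0, …, ι (T - 1)` are picked. -/
def run {d n₁ n₂ : ℕ} (v : Variant) (p : Params) (Xp : Matrix (Fin d) (Fin n₁) ℝ)
    (Xm : Matrix (Fin d) (Fin n₂) ℝ) : (T : ℕ) → (Fin T → Fin d) → State d n₁ n₂
  | 0, _ => State.start d n₁ n₂
  | T + 1, ι => (run v p Xp Xm T fun t => ι t.castSucc).next v p Xp Xm (ι (Fin.last T))

/-- The direction computed by `T` iterations of the algorithm on the data `A, B`, for the signs
`s` and the picked indices `ι`, in the original coordinates: the transformation `W D` is a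
rotation with a mirroring, and it is undone by its transpose. -/
def output {d n₁ n₂ : ℕ} (v : Variant) (p : Params) (A : Matrix (Fin d) (Fin n₁) ℝ)
    (B : Matrix (Fin d) (Fin n₂) ℝ) (s : Fin d → ℤˣ) (T : ℕ) (ι : Fin T → Fin d) : Fin d → ℝ :=
  (hadamardTransform s)ᵀ *ᵥ
    (run v p (hadamardTransform s * A) (hadamardTransform s * B) T ι).w

/-- The probability of an event under the uniform distribution on a finite type. -/
def uniformProb {α : Type*} [Fintype α] (P : α → Prop) : ℝ :=
  (Nat.card {a // P a} : ℝ) / Fintype.card α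

/-- The expectation of `f` under the uniform distribution on a finite type. -/
def uniformExp {α : Type*} [Fintype α] (f : α → ℝ) : ℝ :=
  (∑ a, f a) / Fintype.card α

/-! ### The cost model: a real RAM

Programs act on finitely many natural-number registers, finitely many real registers and a memory
of real arrays. Every elementary operation and every test costs one step. The operations are
constants, addition of natural numbers, the four real operations, `exp`, `log`, and reading or
writing one memory cell whose array number and index are held in natural-number registers. -/

/-- The contents of a real RAM; `mem a b` is the entry with index `b` of the array number `a`. -/
structure Store where
  nat : ℕ → ℕ
  real : ℕ → ℝ
  mem : ℕ → ℕ → ℝ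

/-- Elementary operations; the first argument is the target register, except for `store`. -/
inductive Op where
  | natConst (r v : ℕ) : Op
  | natAdd (r a b : ℕ) : Op
  | realConst (r : ℕ) (z : ℤ) : Op
  | realAdd (r a b : ℕ) : Op
  | realSub (r a b : ℕ) : Op
  | realMul (r a b : ℕ) : Op
  | realDiv (r a b : ℕ) : Op
  | realExp (r a : ℕ) : Op
  | realLog (r a : ℕ) : Op
  | load (r a b : ℕ) : Op
  | store (a b r : ℕ) : Op

def Op.apply : Op → Store → Store
  | natConst r v, s => { s with nat := Function.update s.nat r v }
  | natAdd r a b, s => { s with nat := Function.update s.nat r (s.nat a + s.nat b) }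
  | realConst r z, s => { s with real := Function.update s.real r (z : ℝ) }
  | realAdd r a b, s => { s with real := Function.update s.real r (s.real a + s.real b) }
  | realSub r a b, s => { s with real := Function.update s.real r (s.real a - s.real b) }
  | realMul r a b, s => { s with real := Function.update s.real r (s.real a * s.real b) }
  | realDiv r a b, s => { s with real := Function.update s.real r (s.real a / s.real b) }
  | realExp r a, s => { s with real := Function.update s.real r (Real.exp (s.real a)) }
  | realLog r a, s => { s with real := Function.update s.real r (Real.log (s.real a)) }
  | load r a b, s => { s with real := Function.update s.real r (s.mem (s.nat a) (s.nat b)) }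
  | store a b r, s =>
    { s with
      mem := Function.update s.mem (s.nat a)
        (Function.update (s.mem (s.nat a)) (s.nat b) (s.real r)) }

/-- Tests compare two natural-number registers or two real registers. -/
inductive Test where
  | natLt (a b : ℕ) : Test
  | realLt (a b : ℕ) : Test

def Test.Holds : Test → Store → Prop
  | natLt a b, s => s.nat a < s.nat b
  | realLt a b, s => s.real a < s.real b

/-- Programs. -/
inductive Program where
  | op (o : Op) : Program
  | seq (P Q : Program) : Program
  | ifThenElse (b : Test) (P Q : Program) : Program
  | while (b : Test) (P : Program) : Program

/-- `Exec P s k s'`: the program `P`, started in `s`, stops in `s'` after exactly `k` steps. -/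
inductive Exec : Program → Store → ℕ → Store → Prop
  | op (o : Op) (s : Store) : Exec (.op o) s 1 (o.apply s)
  | seq {P Q : Program} {s s' s'' : Store} {k l : ℕ} :
      Exec P s k s' → Exec Q s' l s'' → Exec (.seq P Q) s (k + l) s''
  | ifTrue {b : Test} {P Q : Program} {s s' : Store} {k : ℕ} :
      b.Holds s → Exec P s k s' → Exec (.ifThenElse b P Q) s (k + 1) s'
  | ifFalse {b : Test} {P Q : Program} {s s' : Store} {k : ℕ} :
      ¬ b.Holds s → Exec Q s k s' → Exec (.ifThenElse b P Q) s (k + 1) s'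
  | whileTrue {b : Test} {P : Program} {s s' s'' : Store} {k l : ℕ} :
      b.Holds s → Exec P s k s' → Exec (.while b P) s' l s'' →
      Exec (.while b P) s (k + l + 1) s''
  | whileFalse {b : Test} {P : Program} {s : Store} :
      ¬ b.Holds s → Exec (.while b P) s 1 s

/-- The memory after the pre-processing. The natural-number registers `0, 1, 2` hold `n₁, n₂, d`;
array `0` holds `d, γ, τ, σ, θ` and the upper bound on the entries of the weight vectors; array `1`
holds `w`; arrays `2, 3, 4, 5` hold `η[t], η[t-1], ξ[t], ξ[t-1]` at `t = 0`; array `8 + 2 i` holds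
row `i` of `X⁺` and array `9 + 2 i` holds row `i` of `X⁻`. Everything else is zero. -/
def startStore {d n₁ n₂ : ℕ} (v : Variant) (p : Params) (Xp : Matrix (Fin d) (Fin n₁) ℝ)
    (Xm : Matrix (Fin d) (Fin n₂) ℝ) : Store where
  nat := fun r => match r with
    | 0 => n₁
    | 1 => n₂
    | 2 => d
    | _ => 0
  real := fun _ => 0
  mem := fun a b => match a with
    | 0 => match b with
      | 0 => d
      | 1 => p.γ
      | 2 => p.τ
      | 3 => p.σ
      | 4 => p.θ
      | 5 => v.cap
      | _ => 0
    | 2 => if b < n₁ then 1 / n₁ else 0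
    | 3 => if b < n₁ then 1 / n₁ else 0
    | 4 => if b < n₂ then 1 / n₂ else 0
    | 5 => if b < n₂ then 1 / n₂ else 0
    | a' + 8 =>
      if hi : a' / 2 < d then
        if a' % 2 = 0 then
          if hj : b < n₁ then Xp ⟨a' / 2, hi⟩ ⟨b, hj⟩ else 0
        else
          if hj : b < n₂ then Xm ⟨a' / 2, hi⟩ ⟨b, hj⟩ else 0
      else 0
    | _ => 0

/-- The picked index is handed to the program in the natural-number register `3`. -/
def Store.withIndex (s : Store) (i : ℕ) : Store := { s with nat := Function.update s.nat 3 i }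

/-- The memory holds the variables of the algorithm (in the arrays `1` to `5`). -/
def Store.Represents {d n₁ n₂ : ℕ} (s : Store) (st : State d n₁ n₂) : Prop :=
  (∀ i : Fin d, s.mem 1 i = st.w i) ∧
  (∀ j : Fin n₁, s.mem 2 j = st.η j ∧ s.mem 3 j = st.ηPrev j) ∧
  (∀ j : Fin n₂, s.mem 4 j = st.ξ j ∧ s.mem 5 j = st.ξPrev j)

end SaddleSVC

end

/-!
Both parts of the theorem rest on one closed form: on the domain of either variant, a linear
function plus a multiple of the entropy is minimized by Gibbs weights `l exp (-cⱼ / κ)` cut at the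
upper bound, with a scale `l` that makes the total mass `1` (`argmin_eq_cappedGibbs`). The minimum
comes with a surplus of `κ V` (`cappedGibbs_strong_min`), which is the three-point inequality of
the mirror steps.

*Convergence.* A saddle point `w = A η - B ξ` exists by minimizing the convex function
`‖A η - B ξ‖² / 2 + γ H(η) + γ H(ξ)` over a compact set (`exists_isSaddle`); the lower value is
strongly concave with maximum at `w`, hence the optimal solution is unique. The Walsh-Hadamard
transformation is orthogonal, so it transports saddle points, and by Hoeffding's inequality for
random signs and a union bound it makes all entries of the data `O(√(log n / d))` with the stated
probability (`one_sub_le_uniformProb_hadamardTransform`). The bound on the entries is what makes the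
long step sizes admissible (`stepSizes_paramsOf`): a step in one coordinate of `w` sees only single
entries of the data. One iteration then contracts a potential in expectation
(`uniformExp_potential_next_le`). The potential adds to the squared distance in `w` and the
divergences of the weights a cross term between `w` and the last step of the weights, which the
extrapolation with `θ` makes telescope. The divergences dominate squared `ℓ₁` distances by a form of
Pinsker's inequality (`sq_l1_le_bregman`). The contraction factor is `1 - 1 / (2 (d + q √d / √γ))`,
which is slightly weaker than `θ`. Finally the lower values are Lipschitz near the
optimum, so the same bound on `𝔼 ‖w[T] - w‖²` serves `γ = 0` and `γ > 0`.

*Cost.* The program keeps the products `w ᵀ X⁺` and `w ᵀ X⁻` in memory and updates them after the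
change of a single coordinate of `w`, so that the linear terms of the mirror steps cost `O(n)`.
The scale `l` is found exactly: starting from `0`, each round cuts the entries that exceed
the upper bound at the current scale and rescales the others to total mass `1`
(`nextScale`). The scale never overshoots (`IsSubscale.next`), each round between the first and the
last finds a further entry cut, and at most `1 / ν` entries can be cut, so there are
`O(1 + 1 / ν)` rounds.
-/

namespace SaddleSVC

/-! ### The domains, the entropy and the mirror step -/

theorem Variant.mem_domain_iff {v : Variant} {m : ℕ} {u : Fin m → ℝ} :
    u ∈ v.domain m ↔ (∀ i, 0 ≤ u i ∧ u i ≤ v.cap) ∧ ∑ i, u i = 1 := by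
  cases v with
  | nu ν => rfl
  | hardMargin =>
    simp only [Variant.domain, Variant.cap, stdSimplex, Set.mem_ofPred_eq]
    refine ⟨fun h => ⟨fun i => ⟨h.1 i, ?_⟩, h.2⟩, fun h => ⟨fun i => (h.1 i).1, h.2⟩⟩
    rw [← h.2]
    exact Finset.single_le_sum (fun j _ => h.1 j) (Finset.mem_univ i)

theorem Variant.one_le_mul_cap {v : Variant} {m : ℕ} (h : (v.domain m).Nonempty) :
    1 ≤ m * v.cap := by
  obtain ⟨u, hu⟩ := h
  rw [Variant.mem_domain_iff] at hu
  calc (1 : ℝ) = ∑ i, u i := hu.2.symm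
    _ ≤ ∑ _i : Fin m, v.cap := Finset.sum_le_sum fun i _ => (hu.1 i).2
    _ = m * v.cap := by simp

theorem Variant.size_pos {v : Variant} {m : ℕ} (h : (v.domain m).Nonempty) : 0 < m := by
  rcases Nat.eq_zero_or_pos m with rfl | hm
  · have := Variant.one_le_mul_cap h
    norm_num at this
  · exact hm

theorem Variant.cap_pos {v : Variant} {m : ℕ} (h : (v.domain m).Nonempty) : 0 < v.cap := by
  have h1 := Variant.one_le_mul_cap h
  by_contra hc
  have : (m : ℝ) * v.cap ≤ 0 := mul_nonpos_of_nonneg_of_nonpos (by positivity) (not_lt.mp hc)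
  linarith

theorem Variant.uniform_mem_domain {v : Variant} {m : ℕ} (h : (v.domain m).Nonempty) :
    (fun _ => 1 / m : Fin m → ℝ) ∈ v.domain m := by
  have hm : (0 : ℝ) < m := by exact_mod_cast Variant.size_pos h
  rw [Variant.mem_domain_iff]
  refine ⟨fun i => ⟨by positivity, ?_⟩, ?_⟩
  · rw [div_le_iff₀ hm, mul_comm]
    exact Variant.one_le_mul_cap h
  · simp [hm.ne']

theorem Variant.isCompact_domain (v : Variant) (m : ℕ) : IsCompact (v.domain m) := by
  have : v.domain m = Set.Icc (0 : Fin m → ℝ) (fun _ => v.cap) ∩ {u | ∑ i, u i = 1} := by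
    ext u
    simp only [Variant.mem_domain_iff, Set.mem_inter_iff, Set.mem_Icc, Pi.le_def, Pi.zero_apply,
      Set.mem_ofPred_eq, forall_and]
  rw [this]
  exact isCompact_Icc.inter_right (isClosed_eq (by fun_prop) continuous_const)

theorem Variant.segment_mem_domain {v : Variant} {m : ℕ} {x y : Fin m → ℝ}
    (hx : x ∈ v.domain m) (hy : y ∈ v.domain m) {t : ℝ} (ht₀ : 0 ≤ t) (ht₁ : t ≤ 1) :
    (fun j => x j + t * (y j - x j)) ∈ v.domain m := by
  rw [Variant.mem_domain_iff] at *
  refine ⟨fun i => ⟨?_, ?_⟩, ?_⟩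
  · nlinarith [(hx.1 i).1, (hy.1 i).1]
  · nlinarith [(hx.1 i).2, (hy.1 i).2]
  · rw [Finset.sum_add_distrib, ← Finset.mul_sum, Finset.sum_sub_distrib, hx.2, hy.2]
    ring

theorem continuous_entropyH {m : ℕ} : Continuous (entropyH (m := m)) := by
  unfold entropyH
  exact continuous_finsetSum _ fun i _ => Real.continuous_mul_log.comp (continuous_apply i)

theorem entropyH_segment_le {m : ℕ} {x y : Fin m → ℝ} (hx : ∀ j, 0 ≤ x j) (hy : ∀ j, 0 ≤ y j)
    {t : ℝ} (ht₀ : 0 ≤ t) (ht₁ : t ≤ 1) :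
    entropyH (fun j => x j + t * (y j - x j)) ≤ entropyH x + t * (entropyH y - entropyH x) := by
  unfold entropyH
  rw [← Finset.sum_sub_distrib, Finset.mul_sum, ← Finset.sum_add_distrib]
  refine Finset.sum_le_sum fun j _ => ?_
  have h := Real.convexOn_mul_log.2 (Set.mem_Ici.mpr (hx j)) (Set.mem_Ici.mpr (hy j))
    (sub_nonneg.mpr ht₁) ht₀ (by ring)
  simp only [smul_eq_mul] at h
  have e : (1 - t) * x j + t * y j = x j + t * (y j - x j) := by ring
  rw [e] at h
  linarith

theorem entropyH_nonpos {v : Variant} {m : ℕ} {u : Fin m → ℝ} (hu : u ∈ v.domain m) :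
    entropyH u ≤ 0 := by
  rw [Variant.mem_domain_iff] at hu
  refine Finset.sum_nonpos fun j _ => Real.mul_log_nonpos (hu.1 j).1 ?_
  rw [← hu.2]
  exact Finset.single_le_sum (fun j _ => (hu.1 j).1) (Finset.mem_univ j)

theorem bregman_uniform_le {v : Variant} {m : ℕ} {u : Fin m → ℝ} (hu : u ∈ v.domain m) :
    bregman (fun _ => 1 / m) u ≤ Real.log m := by
  have hH := entropyH_nonpos hu
  have hm : (m : ℝ) ≠ 0 := by exact_mod_cast (Variant.size_pos ⟨u, hu⟩).ne'
  rw [Variant.mem_domain_iff] at hu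
  simp only [bregman, ← Finset.mul_sum, Finset.sum_sub_distrib, hu.2]
  simp only [entropyH] at *
  simp [hm]
  simpa using hH

/-- The Hellinger lower bound for one term of the Bregman divergence of the entropy. -/
theorem sq_sqrt_sub_sqrt_le {x y : ℝ} (hx : 0 < x) (hy : 0 ≤ y) :
    (√y - √x) ^ 2 ≤ y * Real.log y - (Real.log x + 1) * (y - x) - x * Real.log x := by
  rcases hy.eq_or_lt with rfl | hy
  · simp [Real.sq_sqrt hx.le]
    linarith
  have sx := Real.sq_sqrt hx.le
  have sy := Real.sq_sqrt hy.le
  have px := Real.sqrt_pos.mpr hx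
  have py := Real.sqrt_pos.mpr hy
  have h := Real.log_le_sub_one_of_pos (div_pos px py)
  rw [Real.log_div px.ne' py.ne', Real.log_sqrt hx.le, Real.log_sqrt hy.le] at h
  have h2 : 2 * y * (Real.log x / 2 - Real.log y / 2) ≤ 2 * (√x * √y) - 2 * y := by
    calc _ ≤ 2 * y * (√x / √y - 1) := by gcongr
      _ = 2 * (√x * √y) - 2 * y := by
        have : y * (√x / √y) = √x * √y := by
          rw [← sy]; field_simp; rw [Real.sqrt_sq py.le]
        linear_combination 2 * this
  nlinarith

theorem bregman_eq_sum {m : ℕ} (x y : Fin m → ℝ) :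
    bregman x y =
      ∑ i, (y i * Real.log (y i) - (Real.log (x i) + 1) * (y i - x i) - x i * Real.log (x i)) := by
  simp only [bregman, entropyH, Finset.sum_sub_distrib]

theorem bregman_nonneg {m : ℕ} {x y : Fin m → ℝ} (hx : ∀ i, 0 < x i) (hy : ∀ i, 0 ≤ y i) :
    0 ≤ bregman x y := by
  rw [bregman_eq_sum]
  exact Finset.sum_nonneg fun i _ => (sq_nonneg _).trans (sq_sqrt_sub_sqrt_le (hx i) (hy i))

/-- Pinsker's inequality up to a factor `2`, through the Hellinger distance. -/
theorem sq_l1_le_bregman {m : ℕ} {x y : Fin m → ℝ} (hx : ∀ i, 0 < x i) (hy : ∀ i, 0 ≤ y i)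
    (hxs : ∑ i, x i = 1) (hys : ∑ i, y i = 1) :
    (∑ i, |y i - x i|) ^ 2 ≤ 4 * bregman x y := by
  have h1 : ∑ i, |y i - x i| = ∑ i, |√(y i) - √(x i)| * (√(y i) + √(x i)) := by
    refine Finset.sum_congr rfl fun i _ => ?_
    have hn : 0 ≤ √(y i) + √(x i) := by positivity
    conv_rhs => rw [← abs_of_nonneg hn, ← abs_mul]
    congr 1
    linear_combination Real.sq_sqrt (hx i).le - Real.sq_sqrt (hy i)
  have h2 : ∑ i, (√(y i) + √(x i)) ^ 2 ≤ 4 := by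
    calc _ ≤ ∑ i, (2 * y i + 2 * x i) := by
          refine Finset.sum_le_sum fun i _ => ?_
          nlinarith [Real.sq_sqrt (hx i).le, Real.sq_sqrt (hy i), sq_nonneg (√(y i) - √(x i))]
      _ = 4 := by
          rw [Finset.sum_add_distrib, ← Finset.mul_sum, ← Finset.mul_sum, hxs, hys]
          norm_num
  have h3 : ∑ i, |√(y i) - √(x i)| ^ 2 ≤ bregman x y := by
    rw [bregman_eq_sum]
    refine Finset.sum_le_sum fun i _ => ?_
    rw [sq_abs]
    exact sq_sqrt_sub_sqrt_le (hx i) (hy i)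
  rw [h1]
  refine (Finset.sum_mul_sq_le_sq_mul_sq _ _ _).trans ?_
  have := bregman_nonneg hx hy
  calc _ ≤ bregman x y * 4 := by gcongr
    _ = _ := by ring

/-- The weights proportional to `exp (-cⱼ / κ)`, cut at the upper bound of the domain. -/
noncomputable def cappedGibbs {m : ℕ} (v : Variant) (κ : ℝ) (c : Fin m → ℝ) (l : ℝ) : Fin m → ℝ :=
  fun j => min v.cap (l * Real.exp (-c j / κ))

theorem exists_scale {v : Variant} {m : ℕ} (h : (v.domain m).Nonempty) (κ : ℝ)
    (c : Fin m → ℝ) : ∃ l, 0 < l ∧ ∑ j, cappedGibbs v κ c l j = 1 := by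
  set e : Fin m → ℝ := fun j => Real.exp (-c j / κ)
  have he : ∀ j, 0 < e j := fun j => Real.exp_pos _
  set Ψ : ℝ → ℝ := fun l => ∑ j, min v.cap (l * e j)
  have hcont : Continuous Ψ := by fun_prop
  have hcap := Variant.cap_pos h
  have h0 : Ψ 0 = 0 := by simp [Ψ, hcap.le]
  -- Beyond `L` every entry is cut.
  set L : ℝ := ∑ j, v.cap / e j
  have hL0 : 0 ≤ L := Finset.sum_nonneg fun j _ => (div_pos hcap (he j)).le
  have hL : 1 ≤ Ψ L := by
    have : Ψ L = m * v.cap := by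
      simp only [Ψ]
      rw [Finset.sum_congr rfl (g := fun _ => v.cap)]
      · simp
      · intro j _
        refine min_eq_left ?_
        rw [← div_le_iff₀ (he j)]
        exact Finset.single_le_sum (f := fun j => v.cap / e j)
          (fun j _ => (div_pos hcap (he j)).le) (Finset.mem_univ j)
    rw [this]
    exact Variant.one_le_mul_cap h
  obtain ⟨l, hl, hl1⟩ := intermediate_value_Icc hL0 hcont.continuousOn
    (show (1 : ℝ) ∈ Set.Icc (Ψ 0) (Ψ L) from ⟨by rw [h0]; norm_num, hL⟩)
  refine ⟨l, lt_of_le_of_ne hl.1 ?_, hl1⟩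
  rintro rfl
  rw [h0] at hl1
  norm_num at hl1

theorem cappedGibbs_pos {v : Variant} {m : ℕ} (h : (v.domain m).Nonempty) {κ l : ℝ}
    (hl : 0 < l) (c : Fin m → ℝ) (j : Fin m) : 0 < cappedGibbs v κ c l j :=
  lt_min (Variant.cap_pos h) (mul_pos hl (Real.exp_pos _))

theorem cappedGibbs_mem {v : Variant} {m : ℕ} (h : (v.domain m).Nonempty) {κ l : ℝ}
    (hl : 0 < l) {c : Fin m → ℝ} (hs : ∑ j, cappedGibbs v κ c l j = 1) :
    cappedGibbs v κ c l ∈ v.domain m :=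
  Variant.mem_domain_iff.mpr
    ⟨fun j => ⟨(cappedGibbs_pos h hl c j).le, min_le_left _ _⟩, hs⟩

/-- The capped Gibbs weights minimize `c · η + κ H(η)`, with a surplus of `κ V`: the
derivative `cⱼ + κ (log ηⱼ + 1)` is constant on the entries that are not cut and
smaller on those that are. -/
theorem cappedGibbs_strong_min {v : Variant} {m : ℕ} (h : (v.domain m).Nonempty) {κ l : ℝ}
    (hκ : 0 < κ) (hl : 0 < l) {c : Fin m → ℝ} (hs : ∑ j, cappedGibbs v κ c l j = 1)
    {y : Fin m → ℝ} (hy : y ∈ v.domain m) :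
    ∑ j, c j * cappedGibbs v κ c l j + κ * entropyH (cappedGibbs v κ c l) +
        κ * bregman (cappedGibbs v κ c l) y ≤
      ∑ j, c j * y j + κ * entropyH y := by
  have hpos := cappedGibbs_pos h (κ := κ) hl c
  set z := cappedGibbs v κ c l with hz
  rw [Variant.mem_domain_iff] at hy
  have key : ∀ j, κ * Real.log l * (y j - z j) ≤ (c j + κ * Real.log (z j)) * (y j - z j) := by
    intro j
    rcases le_total v.cap (l * Real.exp (-c j / κ)) with hc | hc
    · have hzj : z j = v.cap := min_eq_left hc
      have hlog : Real.log (z j) ≤ Real.log l + -c j / κ := by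
        rw [← Real.log_exp (-c j / κ), ← Real.log_mul hl.ne' (Real.exp_pos _).ne', hzj]
        exact Real.log_le_log (Variant.cap_pos h) hc
      have h1 : c j + κ * Real.log (z j) ≤ κ * Real.log l := by
        have := mul_le_mul_of_nonneg_left hlog hκ.le
        rw [mul_add, mul_div_cancel₀ _ hκ.ne'] at this
        linarith
      have h2 : y j - z j ≤ 0 := by rw [hzj]; linarith [(hy.1 j).2]
      exact mul_le_mul_of_nonpos_right h1 h2
    · have hzj : z j = l * Real.exp (-c j / κ) := min_eq_right hc
      have hlog : Real.log (z j) = Real.log l + -c j / κ := by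
        rw [hzj, Real.log_mul hl.ne' (Real.exp_pos _).ne', Real.log_exp]
      rw [hlog, mul_add, mul_div_cancel₀ _ hκ.ne']
      apply le_of_eq
      ring
  have hsum := Finset.sum_le_sum fun j (_ : j ∈ Finset.univ) => key j
  rw [← Finset.mul_sum, Finset.sum_sub_distrib, hy.2, hs, sub_self, mul_zero] at hsum
  have hV : κ * bregman z y = κ * entropyH y - κ * entropyH z -
      ∑ j, κ * Real.log (z j) * (y j - z j) := by
    have : ∑ j, (Real.log (z j) + 1) * (y j - z j) = ∑ j, Real.log (z j) * (y j - z j) := by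
      simp only [add_mul, one_mul, Finset.sum_add_distrib, Finset.sum_sub_distrib, hy.2, hs]
      ring
    rw [bregman, this, show (∑ j, κ * Real.log (z j) * (y j - z j)) =
      κ * ∑ j, Real.log (z j) * (y j - z j) by rw [Finset.mul_sum]; simp only [mul_assoc]]
    ring
  have hsplit : ∑ j, (c j + κ * Real.log (z j)) * (y j - z j) =
      ∑ j, c j * y j - ∑ j, c j * z j + ∑ j, κ * Real.log (z j) * (y j - z j) := by
    rw [← Finset.sum_sub_distrib, ← Finset.sum_add_distrib]
    exact Finset.sum_congr rfl fun j _ => by ring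
  rw [hsplit] at hsum
  linarith

theorem argmin_eq_of_unique {α : Type*} [Nonempty α] {S : Set α} {f : α → ℝ} {z : α}
    (hz : z ∈ S) (hmin : ∀ y ∈ S, f z ≤ f y) (huniq : ∀ y ∈ S, f y ≤ f z → y = z) :
    argmin S f = z := by
  have h : argmin S f ∈ S ∧ ∀ y ∈ S, f (argmin S f) ≤ f y :=
    Classical.epsilon_spec (p := fun x => x ∈ S ∧ ∀ y ∈ S, f x ≤ f y) ⟨z, hz, hmin⟩
  exact huniq _ h.1 (h.2 z hz)

/-- The minimizer of a linear function plus a multiple of the entropy, in closed form. -/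
theorem argmin_eq_cappedGibbs {v : Variant} {m : ℕ} (h : (v.domain m).Nonempty) {κ l : ℝ}
    (hκ : 0 < κ) (hl : 0 < l) {c : Fin m → ℝ} (hs : ∑ j, cappedGibbs v κ c l j = 1)
    {f : (Fin m → ℝ) → ℝ} {K : ℝ} (hf : ∀ y, f y = ∑ j, c j * y j + κ * entropyH y + K) :
    argmin (v.domain m) f = cappedGibbs v κ c l := by
  have hpos := cappedGibbs_pos h (κ := κ) hl c
  have hmem := cappedGibbs_mem h hl hs
  have hstrong := fun y hy => cappedGibbs_strong_min h hκ hl hs (y := y) hy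
  refine argmin_eq_of_unique hmem (fun y hy => ?_) fun y hy hle => ?_
  · have := bregman_nonneg hpos fun i => ((Variant.mem_domain_iff.mp hy).1 i).1
    have := mul_nonneg hκ.le this
    rw [hf, hf]
    linarith [hstrong y hy]
  · have hy' := Variant.mem_domain_iff.mp hy
    rw [hf, hf] at hle
    have h1 : κ * bregman (cappedGibbs v κ c l) y ≤ 0 := by linarith [hstrong y hy]
    have h2 : bregman (cappedGibbs v κ c l) y ≤ 0 := nonpos_of_mul_nonpos_right h1 hκ
    have h3 := sq_l1_le_bregman hpos (fun i => (hy'.1 i).1) hs hy'.2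
    have h4 : ∑ i, |y i - cappedGibbs v κ c l i| = 0 :=
      pow_eq_zero_iff two_ne_zero |>.mp (le_antisymm (by linarith) (sq_nonneg _))
    rw [Finset.sum_eq_zero_iff_of_nonneg fun i _ => abs_nonneg _] at h4
    funext i
    linarith [abs_eq_zero.mp (h4 i (Finset.mem_univ i))]

/-- The coefficients of the linear part of the objective of a mirror step from `x` with the
linear term `b`. -/
noncomputable def mirrorCoeff {m : ℕ} (τ : ℝ) (b x : Fin m → ℝ) : Fin m → ℝ :=
  fun j => b j - 1 / τ * (Real.log (x j) + 1)

theorem mirror_objective {m : ℕ} (τ γ : ℝ) (b x y : Fin m → ℝ) :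
    ∑ j, b j * y j + γ * entropyH y + 1 / τ * bregman x y =
      ∑ j, mirrorCoeff τ b x j * y j + (γ + 1 / τ) * entropyH y +
        1 / τ * (∑ j, (Real.log (x j) + 1) * x j - entropyH x) := by
  have h1 : ∑ j, mirrorCoeff τ b x j * y j =
      ∑ j, b j * y j - 1 / τ * ∑ j, (Real.log (x j) + 1) * y j := by
    rw [Finset.mul_sum, ← Finset.sum_sub_distrib]
    exact Finset.sum_congr rfl fun j _ => by simp only [mirrorCoeff]; ring
  have h2 : ∑ j, (Real.log (x j) + 1) * (y j - x j) =
      ∑ j, (Real.log (x j) + 1) * y j - ∑ j, (Real.log (x j) + 1) * x j := by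
    rw [← Finset.sum_sub_distrib]
    exact Finset.sum_congr rfl fun j _ => by ring
  rw [h1, bregman, h2]
  ring

/-- The mirror step: the new point is positive, and the three-point inequality holds. -/
theorem mirror_step {v : Variant} {m : ℕ} (h : (v.domain m).Nonempty) {τ γ : ℝ} (hτ : 0 < τ)
    (hγ : 0 < γ) (b x : Fin m → ℝ) {f : (Fin m → ℝ) → ℝ}
    (hf : ∀ y, f y = ∑ j, b j * y j + γ * entropyH y + 1 / τ * bregman x y) :
    argmin (v.domain m) f ∈ v.domain m ∧ (∀ j, 0 < argmin (v.domain m) f j) ∧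
      ∀ y ∈ v.domain m,
        f (argmin (v.domain m) f) + (γ + 1 / τ) * bregman (argmin (v.domain m) f) y ≤ f y := by
  have hκ : 0 < γ + 1 / τ := by positivity
  obtain ⟨l, hl, hs⟩ := exists_scale h (γ + 1 / τ) (mirrorCoeff τ b x)
  have hf' := fun y => (hf y).trans (mirror_objective τ γ b x y)
  rw [argmin_eq_cappedGibbs h hκ hl hs hf']
  refine ⟨cappedGibbs_mem h hl hs, cappedGibbs_pos h hl _, fun y hy => ?_⟩
  rw [hf', hf']
  linarith [cappedGibbs_strong_min h hκ hl hs hy]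

/-! ### Saddle points -/

section Saddle

variable {d n₁ n₂ : ℕ} {v : Variant} {A : Matrix (Fin d) (Fin n₁) ℝ}
  {B : Matrix (Fin d) (Fin n₂) ℝ} {γ : ℝ}

theorem dotProduct_sq_le {d : ℕ} (w z : Fin d → ℝ) : (w ⬝ᵥ z) ^ 2 ≤ (w ⬝ᵥ w) * (z ⬝ᵥ z) := by
  simpa only [dotProduct, ← sq] using Finset.sum_mul_sq_le_sq_mul_sq Finset.univ w z

theorem dotProduct_self_nonneg' {d : ℕ} (w : Fin d → ℝ) : 0 ≤ w ⬝ᵥ w :=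
  Finset.sum_nonneg fun i _ => mul_self_nonneg (w i)

theorem abs_dotProduct_le {d : ℕ} (w z : Fin d → ℝ) : |w ⬝ᵥ z| ≤ √(w ⬝ᵥ w) * √(z ⬝ᵥ z) := by
  rw [← Real.sqrt_mul (dotProduct_self_nonneg' w)]
  exact Real.abs_le_sqrt (dotProduct_sq_le w z)

theorem abs_dotProduct_mulVec_le_of_forall {d m : ℕ} {X : Matrix (Fin d) (Fin m) ℝ}
    {w : Fin d → ℝ} {r : ℝ} (h : ∀ j, |∑ i, w i * X i j| ≤ r) (y : Fin m → ℝ) :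
    |w ⬝ᵥ (X *ᵥ y)| ≤ r * ∑ j, |y j| := by
  rw [Matrix.dotProduct_mulVec, Finset.mul_sum]
  refine (Finset.abs_sum_le_sum_abs _ _).trans (Finset.sum_le_sum fun j _ => ?_)
  rw [abs_mul]
  exact mul_le_mul_of_nonneg_right (h j) (abs_nonneg _)

/-- If the columns of `X` have norm at most `1`, then `X` maps the `ℓ₁` norm to the `ℓ₂` norm
with operator norm at most `1`. -/
theorem abs_dotProduct_mulVec_le {d m : ℕ} {X : Matrix (Fin d) (Fin m) ℝ}
    (hX : ∀ j, ∑ i, X i j ^ 2 ≤ 1) (w : Fin d → ℝ) (y : Fin m → ℝ) :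
    |w ⬝ᵥ (X *ᵥ y)| ≤ √(w ⬝ᵥ w) * ∑ j, |y j| := by
  refine abs_dotProduct_mulVec_le_of_forall (fun j => ?_) y
  have h := abs_dotProduct_le w (fun i => X i j)
  have h1 : √((fun i => X i j) ⬝ᵥ fun i => X i j) ≤ 1 := by
    rw [Real.sqrt_le_one]
    simpa only [dotProduct, ← sq] using hX j
  exact h.trans (mul_le_of_le_one_right (Real.sqrt_nonneg _) h1)

theorem sum_abs_of_mem {m : ℕ} {u : Fin m → ℝ} (hu : u ∈ v.domain m) : ∑ j, |u j| = 1 := by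
  rw [Variant.mem_domain_iff] at hu
  rw [← hu.2]
  exact Finset.sum_congr rfl fun j _ => abs_of_nonneg (hu.1 j).1

theorem saddleObj_eq (w : Fin d → ℝ) (η : Fin n₁ → ℝ) (ξ : Fin n₂ → ℝ) :
    saddleObj A B γ w η ξ =
      w ⬝ᵥ (A *ᵥ η - B *ᵥ ξ) + γ * entropyH η + γ * entropyH ξ - (w ⬝ᵥ w) / 2 := by
  rw [saddleObj, dotProduct_sub]

/-- `(w, η, ξ)` is a saddle point of the objective on the domains of the variant `v`; the
maximality in `w` is expressed by its first-order condition `w = A η - B ξ`. -/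
structure IsSaddle (v : Variant) (A : Matrix (Fin d) (Fin n₁) ℝ) (B : Matrix (Fin d) (Fin n₂) ℝ)
    (γ : ℝ) (w : Fin d → ℝ) (η : Fin n₁ → ℝ) (ξ : Fin n₂ → ℝ) : Prop where
  mem_left : η ∈ v.domain n₁
  mem_right : ξ ∈ v.domain n₂
  eq : w = A *ᵥ η - B *ᵥ ξ
  le : ∀ η' ∈ v.domain n₁, ∀ ξ' ∈ v.domain n₂, saddleObj A B γ w η ξ ≤ saddleObj A B γ w η' ξ'

theorem nonneg_of_forall_mul_add_mul_sq {a b : ℝ}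
    (h : ∀ t : ℝ, 0 < t → t ≤ 1 → 0 ≤ t * a + t ^ 2 * b) : 0 ≤ a := by
  by_contra! ha
  have hb : 0 < b := by have := h 1 one_pos le_rfl; linarith
  -- At `t = min 1 (-a / (2 b))` the linear term dominates.
  have ht : 0 < min 1 (-a / (2 * b)) := lt_min one_pos (div_pos (by linarith) (by linarith))
  have h1 := h _ ht (min_le_left _ _)
  have h2 : min 1 (-a / (2 * b)) * b ≤ -a / 2 := by
    calc _ ≤ -a / (2 * b) * b := by gcongr; exact min_le_right _ _
      _ = -a / 2 := by field_simp
  nlinarith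

/-- A saddle point exists: the dual problem of minimizing `‖A η - B ξ‖² / 2` plus the entropies
has a solution by compactness, and its first-order condition, which needs only that the entropy
is convex, is the saddle point property. -/
theorem exists_isSaddle (h₁ : (v.domain n₁).Nonempty) (h₂ : (v.domain n₂).Nonempty)
    (A : Matrix (Fin d) (Fin n₁) ℝ) (B : Matrix (Fin d) (Fin n₂) ℝ) (hγ : 0 ≤ γ) :
    ∃ w η ξ, IsSaddle v A B γ w η ξ := by
  set F : (Fin n₁ → ℝ) × (Fin n₂ → ℝ) → ℝ := fun p =>
    ((A *ᵥ p.1 - B *ᵥ p.2) ⬝ᵥ (A *ᵥ p.1 - B *ᵥ p.2)) / 2 + γ * entropyH p.1 + γ * entropyH p.2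
    with hF
  have hc : Continuous F := by
    have e₁ : Continuous fun p : (Fin n₁ → ℝ) × (Fin n₂ → ℝ) => entropyH p.1 :=
      continuous_entropyH.comp continuous_fst
    have e₂ : Continuous fun p : (Fin n₁ → ℝ) × (Fin n₂ → ℝ) => entropyH p.2 :=
      continuous_entropyH.comp continuous_snd
    have e₃ : Continuous fun p : (Fin n₁ → ℝ) × (Fin n₂ → ℝ) => A *ᵥ p.1 - B *ᵥ p.2 :=
      (continuous_const.matrix_mulVec continuous_fst).sub
        (continuous_const.matrix_mulVec continuous_snd)
    exact (((e₃.dotProduct e₃).div_const 2).add (continuous_const.mul e₁)).add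
      (continuous_const.mul e₂)
  obtain ⟨⟨η, ξ⟩, hmem, hmin⟩ :=
    ((v.isCompact_domain n₁).prod (v.isCompact_domain n₂)).exists_isMinOn
      (h₁.prod h₂) hc.continuousOn
  refine ⟨A *ᵥ η - B *ᵥ ξ, η, ξ, hmem.1, hmem.2, rfl, fun η' hη' ξ' hξ' => ?_⟩
  set w := A *ᵥ η - B *ᵥ ξ with hw
  set z := A *ᵥ (η' - η) - B *ᵥ (ξ' - ξ) with hz
  have hwz : A *ᵥ η' - B *ᵥ ξ' = w + z := by
    simp only [hw, hz, Matrix.mulVec_sub]; abel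
  have key : 0 ≤ w ⬝ᵥ z + γ * (entropyH η' - entropyH η) + γ * (entropyH ξ' - entropyH ξ) := by
    refine nonneg_of_forall_mul_add_mul_sq (b := (z ⬝ᵥ z) / 2) fun t ht₀ ht₁ => ?_
    have hm := hmin (show ((fun j => η j + t * (η' j - η j)), fun j => ξ j + t * (ξ' j - ξ j)) ∈
        v.domain n₁ ×ˢ v.domain n₂ from
      ⟨Variant.segment_mem_domain hmem.1 hη' ht₀.le ht₁,
        Variant.segment_mem_domain hmem.2 hξ' ht₀.le ht₁⟩)
    have hlin : A *ᵥ (fun j => η j + t * (η' j - η j)) - B *ᵥ (fun j => ξ j + t * (ξ' j - ξ j)) =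
        w + t • z := by
      have e₁ : (fun j => η j + t * (η' j - η j)) = η + t • (η' - η) := by ext; simp
      have e₂ : (fun j => ξ j + t * (ξ' j - ξ j)) = ξ + t • (ξ' - ξ) := by ext; simp
      simp only [e₁, e₂, hw, hz, Matrix.mulVec_add, Matrix.mulVec_smul, Matrix.mulVec_sub]
      module
    simp only [hF, Set.mem_ofPred_eq, hlin] at hm
    simp only [dotProduct_add, add_dotProduct, dotProduct_smul, smul_dotProduct, smul_eq_mul,
      dotProduct_comm z w] at hm
    have g₁ := entropyH_segment_le (fun j => ((Variant.mem_domain_iff.mp hmem.1).1 j).1)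
      (fun j => ((Variant.mem_domain_iff.mp hη').1 j).1) ht₀.le ht₁
    have g₂ := entropyH_segment_le (fun j => ((Variant.mem_domain_iff.mp hmem.2).1 j).1)
      (fun j => ((Variant.mem_domain_iff.mp hξ').1 j).1) ht₀.le ht₁
    have g₁' := mul_le_mul_of_nonneg_left g₁ hγ
    have g₂' := mul_le_mul_of_nonneg_left g₂ hγ
    simp only [← hw] at hm
    nlinarith
  rw [saddleObj_eq, saddleObj_eq, hwz, ← hw, dotProduct_add]
  linarith

theorem continuous_saddleObj (A : Matrix (Fin d) (Fin n₁) ℝ) (B : Matrix (Fin d) (Fin n₂) ℝ)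
    (γ : ℝ) (w : Fin d → ℝ) :
    Continuous fun p : (Fin n₁ → ℝ) × (Fin n₂ → ℝ) => saddleObj A B γ w p.1 p.2 := by
  have e₁ : Continuous fun p : (Fin n₁ → ℝ) × (Fin n₂ → ℝ) => entropyH p.1 :=
    continuous_entropyH.comp continuous_fst
  have e₂ : Continuous fun p : (Fin n₁ → ℝ) × (Fin n₂ → ℝ) => entropyH p.2 :=
    continuous_entropyH.comp continuous_snd
  have e₃ : Continuous fun p : (Fin n₁ → ℝ) × (Fin n₂ → ℝ) => w ⬝ᵥ (A *ᵥ p.1) :=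
    continuous_const.dotProduct (continuous_const.matrix_mulVec continuous_fst)
  have e₄ : Continuous fun p : (Fin n₁ → ℝ) × (Fin n₂ → ℝ) => w ⬝ᵥ (B *ᵥ p.2) :=
    continuous_const.dotProduct (continuous_const.matrix_mulVec continuous_snd)
  unfold saddleObj
  exact (((e₃.sub e₄).add (continuous_const.mul e₁)).add (continuous_const.mul e₂)).sub
    continuous_const

theorem lowerValue_le {η : Fin n₁ → ℝ} {ξ : Fin n₂ → ℝ} (hη : η ∈ v.domain n₁)
    (hξ : ξ ∈ v.domain n₂) (w : Fin d → ℝ) : lowerValue v A B γ w ≤ saddleObj A B γ w η ξ := by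
  refine csInf_le ?_ ⟨(η, ξ), ⟨hη, hξ⟩, rfl⟩
  exact (((v.isCompact_domain n₁).prod (v.isCompact_domain n₂)).image
    (continuous_saddleObj A B γ w)).bddBelow

theorem exists_lowerValue_eq (h₁ : (v.domain n₁).Nonempty) (h₂ : (v.domain n₂).Nonempty)
    (A : Matrix (Fin d) (Fin n₁) ℝ) (B : Matrix (Fin d) (Fin n₂) ℝ) (γ : ℝ) (w : Fin d → ℝ) :
    ∃ η ∈ v.domain n₁, ∃ ξ ∈ v.domain n₂, lowerValue v A B γ w = saddleObj A B γ w η ξ := by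
  obtain ⟨p, hp, he⟩ := (((v.isCompact_domain n₁).prod (v.isCompact_domain n₂)).image
    (continuous_saddleObj A B γ w)).sInf_mem ((h₁.prod h₂).image _)
  exact ⟨p.1, hp.1, p.2, hp.2, he.symm⟩

variable {w : Fin d → ℝ} {η : Fin n₁ → ℝ} {ξ : Fin n₂ → ℝ}

theorem IsSaddle.lowerValue_eq (hs : IsSaddle v A B γ w η ξ) :
    lowerValue v A B γ w = saddleObj A B γ w η ξ := by
  refine le_antisymm (lowerValue_le hs.mem_left hs.mem_right w) ?_
  obtain ⟨η', hη', ξ', hξ', he⟩ :=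
    exists_lowerValue_eq ⟨η, hs.mem_left⟩ ⟨ξ, hs.mem_right⟩ A B γ w
  rw [he]
  exact hs.le η' hη' ξ' hξ'

theorem IsSaddle.lowerValue_add_le (hs : IsSaddle v A B γ w η ξ) (w' : Fin d → ℝ) :
    lowerValue v A B γ w' + ((w' - w) ⬝ᵥ (w' - w)) / 2 ≤ lowerValue v A B γ w := by
  have h := lowerValue_le (A := A) (B := B) (γ := γ) hs.mem_left hs.mem_right w'
  rw [hs.lowerValue_eq]
  refine (add_le_add_left h _).trans (le_of_eq ?_)
  rw [saddleObj_eq, saddleObj_eq, ← hs.eq]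
  simp only [dotProduct_sub, sub_dotProduct, dotProduct_comm w w']
  ring

theorem IsSaddle.isOptimal_iff (hs : IsSaddle v A B γ w η ξ) (w' : Fin d → ℝ) :
    IsOptimal v A B γ w' ↔ w' = w := by
  constructor
  · intro h
    have h1 := h w
    have h2 := hs.lowerValue_add_le w'
    have h3 : (w' - w) ⬝ᵥ (w' - w) = 0 :=
      le_antisymm (by linarith) (dotProduct_self_nonneg' _)
    exact sub_eq_zero.mp (dotProduct_self_eq_zero.mp h3)
  · rintro rfl w''
    have := hs.lowerValue_add_le w''
    have := dotProduct_self_nonneg' (w'' - w')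
    linarith

theorem abs_dotProduct_sub_le (hA : ∀ j, ∑ i, A i j ^ 2 ≤ 1) (hB : ∀ j, ∑ i, B i j ^ 2 ≤ 1)
    (hη : η ∈ v.domain n₁) (hξ : ξ ∈ v.domain n₂) (z : Fin d → ℝ) :
    |z ⬝ᵥ (A *ᵥ η - B *ᵥ ξ)| ≤ 2 * √(z ⬝ᵥ z) := by
  have h₁ := abs_dotProduct_mulVec_le hA z η
  have h₂ := abs_dotProduct_mulVec_le hB z ξ
  rw [sum_abs_of_mem hη] at h₁
  rw [sum_abs_of_mem hξ] at h₂
  rw [dotProduct_sub]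
  have := abs_sub (z ⬝ᵥ (A *ᵥ η)) (z ⬝ᵥ (B *ᵥ ξ))
  linarith

theorem IsSaddle.sqrt_le (hs : IsSaddle v A B γ w η ξ) (hA : ∀ j, ∑ i, A i j ^ 2 ≤ 1)
    (hB : ∀ j, ∑ i, B i j ^ 2 ≤ 1) : √(w ⬝ᵥ w) ≤ 2 := by
  have h := abs_dotProduct_sub_le hA hB hs.mem_left hs.mem_right w
  rw [← hs.eq, abs_of_nonneg (dotProduct_self_nonneg' w)] at h
  have h1 := Real.sq_sqrt (dotProduct_self_nonneg' w)
  by_contra! hc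
  nlinarith

theorem IsSaddle.dotProduct_self_le (hs : IsSaddle v A B γ w η ξ) (hA : ∀ j, ∑ i, A i j ^ 2 ≤ 1)
    (hB : ∀ j, ∑ i, B i j ^ 2 ≤ 1) : w ⬝ᵥ w ≤ 4 := by
  have h := hs.sqrt_le hA hB
  rw [Real.sqrt_le_left (by norm_num)] at h
  linarith

/-- The lower value drops at most proportionally to the distance from a point of norm at most
`2`. -/
theorem lowerValue_sub_le (h₁ : (v.domain n₁).Nonempty) (h₂ : (v.domain n₂).Nonempty)
    (hA : ∀ j, ∑ i, A i j ^ 2 ≤ 1) (hB : ∀ j, ∑ i, B i j ^ 2 ≤ 1) (γ : ℝ) {w : Fin d → ℝ}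
    (hw : √(w ⬝ᵥ w) ≤ 2) (w' : Fin d → ℝ) :
    lowerValue v A B γ w - lowerValue v A B γ w' ≤
      4 * √((w' - w) ⬝ᵥ (w' - w)) + ((w' - w) ⬝ᵥ (w' - w)) / 2 := by
  obtain ⟨η, hη, ξ, hξ, he⟩ := exists_lowerValue_eq h₁ h₂ A B γ w'
  have hle := lowerValue_le (A := A) (B := B) (γ := γ) hη hξ w
  rw [he]
  set z := w' - w with hz
  have hw' : w' = w + z := by simp [hz]
  have h3 := abs_le.mp (abs_dotProduct_sub_le hA hB hη hξ z)
  have h4 := (le_abs_self _).trans (abs_dotProduct_le w z)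
  have h5 : √(w ⬝ᵥ w) * √(z ⬝ᵥ z) ≤ 2 * √(z ⬝ᵥ z) := by gcongr
  rw [hw', saddleObj_eq]
  rw [saddleObj_eq] at hle
  simp only [add_dotProduct, dotProduct_add, dotProduct_comm z w]
  linarith [h3.1]

theorem OPT_eq (hs : IsSaddle v A B 0 w η ξ) : OPT v A B = (w ⬝ᵥ w) / 2 := by
  have hmax : ∀ w', lowerValue v A B 0 w' ≤ lowerValue v A B 0 w :=
    (hs.isOptimal_iff w).mpr rfl
  have hval : lowerValue v A B 0 w = (w ⬝ᵥ w) / 2 := by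
    rw [hs.lowerValue_eq, saddleObj_eq, ← hs.eq]
    ring
  rw [← hval]
  exact le_antisymm (ciSup_le hmax) (le_ciSup ⟨_, Set.forall_mem_range.mpr hmax⟩ w)

theorem OPT_pos_le (h₁ : (v.domain n₁).Nonempty) (h₂ : (v.domain n₂).Nonempty)
    (hA : ∀ j, ∑ i, A i j ^ 2 ≤ 1) (hB : ∀ j, ∑ i, B i j ^ 2 ≤ 1)
    (hAB : ∀ η ∈ v.domain n₁, ∀ ξ ∈ v.domain n₂, A *ᵥ η ≠ B *ᵥ ξ) :
    0 < OPT v A B ∧ OPT v A B ≤ 2 := by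
  obtain ⟨w, η, ξ, hs⟩ := exists_isSaddle (γ := 0) h₁ h₂ A B le_rfl
  rw [OPT_eq hs]
  have h4 := hs.dotProduct_self_le hA hB
  have hw : w ≠ 0 := by
    rw [hs.eq]
    exact sub_ne_zero.mpr (hAB η hs.mem_left ξ hs.mem_right)
  have h0 : w ⬝ᵥ w ≠ 0 := fun h => hw (dotProduct_self_eq_zero.mp h)
  have := lt_of_le_of_ne (dotProduct_self_nonneg' w) h0.symm
  constructor <;> linarith

theorem mulVec_dotProduct_mulVec {O : Matrix (Fin d) (Fin d) ℝ} (hO : Oᵀ * O = 1)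
    (x y : Fin d → ℝ) : (O *ᵥ x) ⬝ᵥ (O *ᵥ y) = x ⬝ᵥ y := by
  rw [Matrix.dotProduct_mulVec, ← Matrix.mulVec_transpose, Matrix.mulVec_mulVec, hO,
    Matrix.one_mulVec]

/-- An orthogonal transformation of the data transforms the saddle points. -/
theorem IsSaddle.transform (hs : IsSaddle v A B γ w η ξ) {O : Matrix (Fin d) (Fin d) ℝ}
    (hO : Oᵀ * O = 1) : IsSaddle v (O * A) (O * B) γ (O *ᵥ w) η ξ := by
  refine ⟨hs.mem_left, hs.mem_right, ?_, fun η' hη' ξ' hξ' => ?_⟩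
  · rw [hs.eq, Matrix.mulVec_sub, Matrix.mulVec_mulVec, Matrix.mulVec_mulVec]
  · have h := hs.le η' hη' ξ' hξ'
    simpa only [saddleObj, ← Matrix.mulVec_mulVec, mulVec_dotProduct_mulVec hO] using h

end Saddle

/-! ### Linear convergence of the primal-dual iteration -/

theorem uniformExp_mono {α : Type*} [Fintype α] {f g : α → ℝ} (h : ∀ a, f a ≤ g a) :
    uniformExp f ≤ uniformExp g :=
  div_le_div_of_nonneg_right (Finset.sum_le_sum fun a _ => h a) (Nat.cast_nonneg _)

theorem uniformExp_const_mul {α : Type*} [Fintype α] (c : ℝ) (f : α → ℝ) :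
    uniformExp (fun a => c * f a) = c * uniformExp f := by
  rw [uniformExp, uniformExp, ← Finset.mul_sum, mul_div_assoc]

theorem uniformExp_add_const {α : Type*} [Fintype α] [Nonempty α] (c : ℝ) (f : α → ℝ) :
    uniformExp (fun a => f a + c) = uniformExp f + c := by
  have : (Fintype.card α : ℝ) ≠ 0 := by exact_mod_cast Fintype.card_ne_zero
  simp only [uniformExp, Finset.sum_add_distrib, Finset.sum_const, Finset.card_univ, nsmul_eq_mul]
  field_simp

/-- The last picked index is independent of the earlier ones. -/
theorem uniformExp_snoc {d T : ℕ} (f : (Fin T → Fin d) → Fin d → ℝ) :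
    (uniformExp fun ι : Fin (T + 1) → Fin d => f (fun t => ι t.castSucc) (ι (Fin.last T))) =
      uniformExp fun ι : Fin T → Fin d => uniformExp fun i => f ι i := by
  have h := (Fin.snocEquiv fun _ : Fin (T + 1) => Fin d).sum_comp
    fun ι => f (fun t => ι t.castSucc) (ι (Fin.last T))
  simp only [uniformExp, ← h, Fintype.sum_prod_type_right, Fintype.card_pi, Finset.prod_const,
    Finset.card_univ, Fintype.card_fin, Fin.snocEquiv_apply, Fin.snoc_castSucc, Fin.snoc_last,
    ← Finset.sum_div, pow_succ, Nat.cast_mul, Nat.cast_pow]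
  rw [div_div, mul_comm]

section Convergence

variable {d n₁ n₂ : ℕ} {v : Variant} {p : Params} {Xp : Matrix (Fin d) (Fin n₁) ℝ}
  {Xm : Matrix (Fin d) (Fin n₂) ℝ}

/-- The value `X⁺ η - X⁻ ξ`. -/
noncomputable def signedCombination (Xp : Matrix (Fin d) (Fin n₁) ℝ)
    (Xm : Matrix (Fin d) (Fin n₂) ℝ) (η : Fin n₁ → ℝ) (ξ : Fin n₂ → ℝ) : Fin d → ℝ :=
  Xp *ᵥ η - Xm *ᵥ ξ

/-- The change of the picked coordinate `i` of `w` in one iteration. -/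
noncomputable def coordStep (p : Params) (Xp : Matrix (Fin d) (Fin n₁) ℝ)
    (Xm : Matrix (Fin d) (Fin n₂) ℝ) (st : State d n₁ n₂) (i : Fin d) : ℝ :=
  (st.w i + p.σ * (∑ j, Xp i j * (st.η j + p.θ * (st.η j - st.ηPrev j)) -
    ∑ j, Xm i j * (st.ξ j + p.θ * (st.ξ j - st.ξPrev j)))) / (p.σ + 1) - st.w i

theorem next_w (st : State d n₁ n₂) (i : Fin d) :
    (st.next v p Xp Xm i).w = st.w + Pi.single i (coordStep p Xp Xm st i) := by
  funext k
  by_cases h : k = i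
  · subst h
    simp [State.next, coordStep]
  · simp [State.next, h]

theorem coordStep_mul (hσ : 0 < p.σ) (st : State d n₁ n₂) (i : Fin d) :
    coordStep p Xp Xm st i * (1 + p.σ) =
      p.σ * (signedCombination Xp Xm st.η st.ξ i +
        p.θ * signedCombination Xp Xm (st.η - st.ηPrev) (st.ξ - st.ξPrev) i - st.w i) := by
  have e : ∀ {m : ℕ} (X : Matrix (Fin d) (Fin m) ℝ) (x y : Fin m → ℝ),
      ∑ j, X i j * (x j + p.θ * (x j - y j)) = (X *ᵥ x) i + p.θ * (X *ᵥ (x - y)) i := by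
    intro m X x y
    simp only [Matrix.mulVec, dotProduct, Finset.mul_sum, ← Finset.sum_add_distrib, Pi.sub_apply]
    exact Finset.sum_congr rfl fun j _ => by ring
  have : p.σ + 1 ≠ 0 := by positivity
  simp only [coordStep, e, signedCombination, Pi.sub_apply]
  field_simp
  ring

/-- The three-point inequality for both mirror steps of one iteration. -/
theorem next_mirror (h₁ : (v.domain n₁).Nonempty) (h₂ : (v.domain n₂).Nonempty)
    (hd : 0 < d) (hγ : 0 < p.γ) (hτ : 0 < p.τ) (st : State d n₁ n₂) (i : Fin d) :
    let st' := st.next v p Xp Xm i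
    let u := st.w + (d : ℝ) • Pi.single i (coordStep p Xp Xm st i)
    (st'.η ∈ v.domain n₁ ∧ ∀ j, 0 < st'.η j) ∧ (st'.ξ ∈ v.domain n₂ ∧ ∀ j, 0 < st'.ξ j) ∧
    ∀ η ∈ v.domain n₁, ∀ ξ ∈ v.domain n₂,
      u ⬝ᵥ signedCombination Xp Xm st'.η st'.ξ + p.γ * entropyH st'.η + p.γ * entropyH st'.ξ +
          d / p.τ * (bregman st.η st'.η + bregman st.ξ st'.ξ) +
          (p.γ + d / p.τ) * (bregman st'.η η + bregman st'.ξ ξ) ≤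
        u ⬝ᵥ signedCombination Xp Xm η ξ + p.γ * entropyH η + p.γ * entropyH ξ +
          d / p.τ * (bregman st.η η + bregman st.ξ ξ) := by
  intro st' u
  have hd' : (0 : ℝ) < d := by exact_mod_cast hd
  have hu : st.w + (d : ℝ) • (st'.w - st.w) = u := by simp only [st', next_w, u]; abel_nf
  have lin : ∀ {m : ℕ} (X : Matrix (Fin d) (Fin m) ℝ) (y : Fin m → ℝ) (r : ℝ),
      r * (u ⬝ᵥ (X *ᵥ y)) = ∑ j, (r * (u ᵥ* X) j) * y j := by
    intro m X y r
    rw [Matrix.dotProduct_mulVec, dotProduct, Finset.mul_sum]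
    simp only [mul_assoc]
  obtain ⟨m₁, p₁, o₁⟩ := mirror_step h₁ hτ (div_pos hγ hd')
    (fun j => 1 / (d : ℝ) * (u ᵥ* Xp) j) st.η (f := fun η =>
      1 / d * (u ⬝ᵥ (Xp *ᵥ η)) + p.γ / d * entropyH η + 1 / p.τ * bregman st.η η)
    (fun y => by simp only [lin])
  obtain ⟨m₂, p₂, o₂⟩ := mirror_step h₂ hτ (div_pos hγ hd')
    (fun j => -(1 / (d : ℝ)) * (u ᵥ* Xm) j) st.ξ (f := fun ξ =>
      -(1 / d * (u ⬝ᵥ (Xm *ᵥ ξ))) + p.γ / d * entropyH ξ + 1 / p.τ * bregman st.ξ ξ)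
    (fun y => by rw [← neg_mul]; simp only [lin])
  have e₁ : st'.η = argmin (v.domain n₁) fun η =>
      1 / d * (u ⬝ᵥ (Xp *ᵥ η)) + p.γ / d * entropyH η + 1 / p.τ * bregman st.η η := by
    rw [← hu]; rfl
  have e₂ : st'.ξ = argmin (v.domain n₂) fun ξ =>
      -(1 / d * (u ⬝ᵥ (Xm *ᵥ ξ))) + p.γ / d * entropyH ξ + 1 / p.τ * bregman st.ξ ξ := by
    rw [← hu]; rfl
  rw [← e₁] at m₁ p₁ o₁
  rw [← e₂] at m₂ p₂ o₂
  refine ⟨⟨m₁, p₁⟩, ⟨m₂, p₂⟩, fun η hη ξ hξ => ?_⟩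
  have q₁ := mul_le_mul_of_nonneg_left (add_le_add (o₁ η hη) (o₂ ξ hξ)) hd'.le
  simp only [signedCombination, dotProduct_sub]
  have c₁ : (d : ℝ) * (1 / d) = 1 := by field_simp
  have c₂ : (d : ℝ) * (p.γ / d) = p.γ := by field_simp
  have c₃ : (d : ℝ) * (1 / p.τ) = d / p.τ := by field_simp
  refine le_of_sub_nonneg ((sub_nonneg.mpr q₁).trans (le_of_eq ?_))
  rw [← c₃]
  generalize p.γ / (d : ℝ) = g at *
  generalize 1 / (d : ℝ) = r at *
  rw [← c₂]
  linear_combination (u ⬝ᵥ Xp *ᵥ η - u ⬝ᵥ Xp *ᵥ st'.η - u ⬝ᵥ Xm *ᵥ ξ + u ⬝ᵥ Xm *ᵥ st'.ξ) * c₁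

end Convergence

section Potential

variable {d n₁ n₂ : ℕ} {v : Variant} {p : Params} {Xp : Matrix (Fin d) (Fin n₁) ℝ}
  {Xm : Matrix (Fin d) (Fin n₂) ℝ}

theorem signedCombination_sub (Xp : Matrix (Fin d) (Fin n₁) ℝ) (Xm : Matrix (Fin d) (Fin n₂) ℝ)
    (η η' : Fin n₁ → ℝ) (ξ ξ' : Fin n₂ → ℝ) :
    signedCombination Xp Xm (η - η') (ξ - ξ') =
      signedCombination Xp Xm η ξ - signedCombination Xp Xm η' ξ' := by
  simp only [signedCombination, Matrix.mulVec_sub]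
  abel

/-- The `ℓ₁` length of the last step of the weight vectors. -/
noncomputable def State.lastStep (st : State d n₁ n₂) : ℝ :=
  ∑ j, |st.η j - st.ηPrev j| + ∑ j, |st.ξ j - st.ξPrev j|

theorem State.lastStep_nonneg (st : State d n₁ n₂) : 0 ≤ st.lastStep :=
  add_nonneg (Finset.sum_nonneg fun _ _ => abs_nonneg _)
    (Finset.sum_nonneg fun _ _ => abs_nonneg _)

/-- The potential of a state with respect to a saddle point `(w, η, ξ)`: the weighted squared
distance in `w`, the Bregman divergences of the weight vectors, the length of the last step, and
the cross term that pays for the extrapolation. -/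
noncomputable def potential (p : Params) (Xp : Matrix (Fin d) (Fin n₁) ℝ)
    (Xm : Matrix (Fin d) (Fin n₂) ℝ) (w : Fin d → ℝ) (η : Fin n₁ → ℝ) (ξ : Fin n₂ → ℝ)
    (st : State d n₁ n₂) : ℝ :=
  d * (1 + 1 / (2 * p.σ)) * ((st.w - w) ⬝ᵥ (st.w - w)) +
    (p.γ + d / p.τ) * (bregman st.η η + bregman st.ξ ξ) + d / p.τ / 16 * st.lastStep ^ 2 +
    (st.w - w) ⬝ᵥ signedCombination Xp Xm (st.η - st.ηPrev) (st.ξ - st.ξPrev)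

/-- The relations between the step sizes, the dimension, the bound `R` on the entries of the data
and the contraction factor `ρ` on which the convergence proof rests. -/
structure StepSizes (d : ℕ) (p : Params) (R ρ : ℝ) : Prop where
  d_pos : 0 < d
  γ_pos : 0 < p.γ
  τ_pos : 0 < p.τ
  σ_pos : 0 < p.σ
  R_nonneg : 0 ≤ R
  cross : p.σ / d ≤ d / p.τ / 16
  coord : d * p.σ * R ^ 2 ≤ d / p.τ / 64
  θ_nonneg : 0 ≤ p.θ
  θ_eq : d * (1 + 1 / (2 * p.σ)) - 1 = p.θ * (d * (1 + 1 / (2 * p.σ)))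
  θ_le : p.θ ≤ ρ
  half_le : 1 / 2 ≤ ρ
  le_one : ρ ≤ 1
  mirror : d / p.τ ≤ ρ * (p.γ + d / p.τ)

theorem abs_signedCombination_le {R : ℝ} (hXp : ∀ i j, |Xp i j| ≤ R) (hXm : ∀ i j, |Xm i j| ≤ R)
    (η : Fin n₁ → ℝ) (ξ : Fin n₂ → ℝ) (i : Fin d) :
    |signedCombination Xp Xm η ξ i| ≤ R * (∑ j, |η j| + ∑ j, |ξ j|) := by
  have h : ∀ {m : ℕ} {X : Matrix (Fin d) (Fin m) ℝ}, (∀ i j, |X i j| ≤ R) → ∀ y : Fin m → ℝ,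
      |(X *ᵥ y) i| ≤ R * ∑ j, |y j| := by
    intro m X hX y
    rw [Finset.mul_sum, Matrix.mulVec, dotProduct]
    refine (Finset.abs_sum_le_sum_abs _ _).trans (Finset.sum_le_sum fun j _ => ?_)
    rw [abs_mul]
    exact mul_le_mul_of_nonneg_right (hX i j) (abs_nonneg _)
  simp only [signedCombination, Pi.sub_apply]
  have := abs_sub ((Xp *ᵥ η) i) ((Xm *ᵥ ξ) i)
  have := h hXp η
  have := h hXm ξ
  linarith

theorem abs_dotProduct_signedCombination_le (hXp : ∀ j, ∑ i, Xp i j ^ 2 ≤ 1)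
    (hXm : ∀ j, ∑ i, Xm i j ^ 2 ≤ 1) (z : Fin d → ℝ) (η : Fin n₁ → ℝ) (ξ : Fin n₂ → ℝ) :
    |z ⬝ᵥ signedCombination Xp Xm η ξ| ≤ √(z ⬝ᵥ z) * (∑ j, |η j| + ∑ j, |ξ j|) := by
  simp only [signedCombination, dotProduct_sub]
  have := abs_sub (z ⬝ᵥ (Xp *ᵥ η)) (z ⬝ᵥ (Xm *ᵥ ξ))
  have := abs_dotProduct_mulVec_le hXp z η
  have := abs_dotProduct_mulVec_le hXm z ξ
  linarith

variable {R ρ : ℝ} {w : Fin d → ℝ} {η : Fin n₁ → ℝ} {ξ : Fin n₂ → ℝ}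

/-- Young's inequality for the cross term of the potential. -/
theorem neg_cross_le (hp : StepSizes d p R ρ) (hXp : ∀ j, ∑ i, Xp i j ^ 2 ≤ 1)
    (hXm : ∀ j, ∑ i, Xm i j ^ 2 ≤ 1) (st : State d n₁ n₂) (z : Fin d → ℝ) :
    -(z ⬝ᵥ signedCombination Xp Xm (st.η - st.ηPrev) (st.ξ - st.ξPrev)) ≤
      d / (4 * p.σ) * (z ⬝ᵥ z) + d / p.τ / 16 * st.lastStep ^ 2 := by
  have h := (abs_le.mp (abs_dotProduct_signedCombination_le hXp hXm z
    (st.η - st.ηPrev) (st.ξ - st.ξPrev))).1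
  simp only [Pi.sub_apply] at h
  change -(√(z ⬝ᵥ z) * st.lastStep) ≤ _ at h
  have hd : (0 : ℝ) < d := by exact_mod_cast hp.d_pos
  have hσ := hp.σ_pos
  have h1 : √(z ⬝ᵥ z) * st.lastStep ≤
      d / (4 * p.σ) * √(z ⬝ᵥ z) ^ 2 + p.σ / d * st.lastStep ^ 2 := by
    have : d / (4 * p.σ) * √(z ⬝ᵥ z) ^ 2 + p.σ / d * st.lastStep ^ 2 -
        √(z ⬝ᵥ z) * st.lastStep =
        (d * √(z ⬝ᵥ z) - 2 * p.σ * st.lastStep) ^ 2 / (4 * p.σ * d) := by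
      field_simp
      ring
    have h2 : 0 ≤ (d * √(z ⬝ᵥ z) - 2 * p.σ * st.lastStep) ^ 2 / (4 * p.σ * d) := by positivity
    linarith
  rw [Real.sq_sqrt (dotProduct_self_nonneg' z)] at h1
  have h2 := mul_le_mul_of_nonneg_right hp.cross (sq_nonneg st.lastStep)
  linarith

/-- The potential after one iteration, for a given picked index. -/
theorem potential_next_le (hp : StepSizes d p R ρ) (hXp : ∀ i j, |Xp i j| ≤ R)
    (hXm : ∀ i j, |Xm i j| ≤ R) (hs : IsSaddle v Xp Xm p.γ w η ξ) (st : State d n₁ n₂)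
    (hη : st.η ∈ v.domain n₁ ∧ ∀ j, 0 < st.η j) (hξ : st.ξ ∈ v.domain n₂ ∧ ∀ j, 0 < st.ξ j)
    (i : Fin d) :
    let z := st.w - w
    let a := signedCombination Xp Xm (st.η - η) (st.ξ - ξ)
    let δ := coordStep p Xp Xm st i
    potential p Xp Xm w η ξ (st.next v p Xp Xm i) ≤
      d * (1 + 1 / (2 * p.σ)) * (z ⬝ᵥ z + 2 * δ * z i + δ ^ 2) +
        d / p.τ * (bregman st.η η + bregman st.ξ ξ) + d / (4 * p.σ) * δ ^ 2 -
        z ⬝ᵥ a - d * δ * a i := by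
  intro z a δ
  have hd : (0 : ℝ) < d := by exact_mod_cast hp.d_pos
  have hd1 : (1 : ℝ) ≤ d := by exact_mod_cast hp.d_pos
  have hσ := hp.σ_pos
  have hR := hp.R_nonneg
  obtain ⟨⟨m₁, p₁⟩, ⟨m₂, p₂⟩, hm⟩ := next_mirror (Xp := Xp) (Xm := Xm) ⟨_, hs.mem_left⟩
    ⟨_, hs.mem_right⟩ hp.d_pos hp.γ_pos hp.τ_pos st i
  have hm := hm η hs.mem_left ξ hs.mem_right
  have hsad := hs.le _ m₁ _ m₂
  set st' := st.next v p Xp Xm i with hst'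
  have hprev₁ : st'.ηPrev = st.η := rfl
  have hprev₂ : st'.ξPrev = st.ξ := rfl
  rw [saddleObj_eq, saddleObj_eq] at hsad
  change w ⬝ᵥ signedCombination Xp Xm η ξ + _ + _ - _ ≤
    w ⬝ᵥ signedCombination Xp Xm st'.η st'.ξ + _ + _ - _ at hsad
  -- The step `y` of the weight vectors and its image `b`.
  set y := st'.lastStep with hy
  set b := signedCombination Xp Xm (st'.η - st.η) (st'.ξ - st.ξ) with hb
  have hy0 : 0 ≤ y := st'.lastStep_nonneg
  have hbi : |b i| ≤ R * y :=
    abs_signedCombination_le hXp hXm (st'.η - st.η) (st'.ξ - st.ξ) i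
  have hV : y ^ 2 ≤ 8 * (bregman st.η st'.η + bregman st.ξ st'.ξ) := by
    have k₁ := sq_l1_le_bregman hη.2 (fun j => (p₁ j).le)
      (Variant.mem_domain_iff.mp hη.1).2 (Variant.mem_domain_iff.mp m₁).2
    have k₂ := sq_l1_le_bregman hξ.2 (fun j => (p₂ j).le)
      (Variant.mem_domain_iff.mp hξ.1).2 (Variant.mem_domain_iff.mp m₂).2
    have hy' : y = ∑ j, |st'.η j - st.η j| + ∑ j, |st'.ξ j - st.ξ j| := rfl
    rw [hy']
    nlinarith [sq_nonneg (∑ j, |st'.η j - st.η j| - ∑ j, |st'.ξ j - st.ξ j|)]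
  have hw : st'.w - w = z + Pi.single i δ := by
    rw [hst', next_w]
    simp only [z, δ]
    abel
  have hMx' : signedCombination Xp Xm st'.η st'.ξ = signedCombination Xp Xm η ξ + a + b := by
    simp only [a, hb, signedCombination_sub]
    abel
  have hu : st.w + (d : ℝ) • Pi.single i δ = w + z + (d : ℝ) • Pi.single i δ := by
    simp only [z]
    abel
  have hpot : potential p Xp Xm w η ξ st' =
      d * (1 + 1 / (2 * p.σ)) * (z ⬝ᵥ z + 2 * δ * z i + δ ^ 2) +
      (p.γ + d / p.τ) * (bregman st'.η η + bregman st'.ξ ξ) + d / p.τ / 16 * y ^ 2 +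
      (z ⬝ᵥ b + δ * b i) := by
    rw [potential, hprev₁, hprev₂, hw, ← hb]
    simp only [add_dotProduct, dotProduct_add, single_dotProduct, dotProduct_single, Pi.add_apply,
      Pi.single_eq_same]
    rw [hy]
    ring
  rw [hpot]
  change (st.w + (d : ℝ) • Pi.single i δ) ⬝ᵥ _ + _ + _ + _ + _ ≤
    (st.w + (d : ℝ) • Pi.single i δ) ⬝ᵥ _ + _ + _ + _ at hm
  rw [hu, hMx'] at hm
  rw [hMx'] at hsad
  simp only [add_dotProduct, dotProduct_add, single_dotProduct, smul_dotProduct, smul_eq_mul]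
    at hm hsad
  have hL : 0 ≤ d / p.τ := (div_pos hd hp.τ_pos).le
  have hV' := mul_le_mul_of_nonneg_left hV hL
  -- The step in the single coordinate `i` sees only the entries of the data.
  have herr : -((d - 1) * δ * b i) ≤ d / (4 * p.σ) * δ ^ 2 + d / p.τ / 16 * y ^ 2 := by
    have h1 : -((d - 1) * δ * b i) ≤ d * (|δ| * (R * y)) := by
      calc -((d - 1) * δ * b i) ≤ |(d - 1) * δ * b i| := neg_le_abs _
        _ = (d - 1) * (|δ| * |b i|) := by
          rw [abs_mul, abs_mul, abs_of_nonneg (by linarith : (0 : ℝ) ≤ d - 1), mul_assoc]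
        _ ≤ d * (|δ| * (R * y)) := by gcongr; linarith
    have h2 : d * (|δ| * (R * y)) ≤ d / (4 * p.σ) * |δ| ^ 2 + d * p.σ * R ^ 2 * y ^ 2 := by
      have e : d / (4 * p.σ) * |δ| ^ 2 + d * p.σ * R ^ 2 * y ^ 2 - d * (|δ| * (R * y)) =
          d * (|δ| - 2 * p.σ * R * y) ^ 2 / (4 * p.σ) := by
        field_simp
        ring
      have : 0 ≤ d * (|δ| - 2 * p.σ * R * y) ^ 2 / (4 * p.σ) := by positivity
      linarith
    have h3 := mul_le_mul_of_nonneg_right hp.coord (sq_nonneg y)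
    have h4 : 0 ≤ d / p.τ * y ^ 2 := by positivity
    rw [sq_abs] at h2
    linarith
  linarith

/-- One iteration contracts the potential in expectation. -/
theorem uniformExp_potential_next_le (hp : StepSizes d p R ρ)
    (hcp : ∀ j, ∑ i, Xp i j ^ 2 ≤ 1) (hcm : ∀ j, ∑ i, Xm i j ^ 2 ≤ 1)
    (hXp : ∀ i j, |Xp i j| ≤ R)
    (hXm : ∀ i j, |Xm i j| ≤ R) (hs : IsSaddle v Xp Xm p.γ w η ξ) (st : State d n₁ n₂)
    (hη : st.η ∈ v.domain n₁ ∧ ∀ j, 0 < st.η j) (hξ : st.ξ ∈ v.domain n₂ ∧ ∀ j, 0 < st.ξ j) :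
    (uniformExp fun i => potential p Xp Xm w η ξ (st.next v p Xp Xm i)) ≤
      ρ * potential p Xp Xm w η ξ st := by
  have hd : (0 : ℝ) < d := by exact_mod_cast hp.d_pos
  have hσ := hp.σ_pos
  set z := st.w - w with hz
  set a := signedCombination Xp Xm (st.η - η) (st.ξ - ξ) with ha
  set b := signedCombination Xp Xm (st.η - st.ηPrev) (st.ξ - st.ξPrev) with hb
  set y := st.lastStep with hy
  set V := bregman st.η η + bregman st.ξ ξ with hVdef
  set D := d * (1 + 1 / (2 * p.σ)) with hD
  have hbi : ∀ i, b i ^ 2 ≤ R ^ 2 * y ^ 2 := by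
    intro i
    have := abs_signedCombination_le hXp hXm (st.η - st.ηPrev) (st.ξ - st.ξPrev) i
    simp only [Pi.sub_apply] at this
    change |b i| ≤ R * y at this
    rw [← mul_pow, ← sq_abs (b i)]
    exact pow_le_pow_left₀ (abs_nonneg _) this 2
  have hterm : ∀ i, potential p Xp Xm w η ξ (st.next v p Xp Xm i) ≤
      D * (z ⬝ᵥ z) + d / p.τ * V - z ⬝ᵥ a +
        d * (z i * a i - z i ^ 2 + p.θ * (z i * b i) + p.σ * p.θ ^ 2 * (R ^ 2 * y ^ 2)) := by
    intro i
    refine (potential_next_le hp hXp hXm hs st hη hξ i).trans ?_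
    simp only [← hz, ← ha, ← hVdef, ← hD]
    set δ := coordStep p Xp Xm st i
    have hδ : δ * (1 + p.σ) = p.σ * (a i + p.θ * b i - z i) := by
      rw [coordStep_mul hσ]
      simp only [ha, hb, hz, signedCombination_sub, Pi.sub_apply]
      have : w i = signedCombination Xp Xm η ξ i := congrFun hs.eq i
      rw [this]
      ring
    have ha' : a i = δ * (1 + p.σ) / p.σ - p.θ * b i + z i := by
      rw [hδ]
      field_simp
      ring
    have hsq : 0 ≤ (δ - 2 * p.σ * p.θ * b i) ^ 2 / (4 * p.σ) := by positivity
    have hb2 := mul_le_mul_of_nonneg_left (hbi i) (show 0 ≤ p.σ * p.θ ^ 2 by positivity)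
    have hcore : (1 + 1 / (2 * p.σ)) * (2 * δ * z i + δ ^ 2) + 1 / (4 * p.σ) * δ ^ 2 - δ * a i ≤
        z i * a i - z i ^ 2 + p.θ * (z i * b i) + p.σ * p.θ ^ 2 * (R ^ 2 * y ^ 2) := by
      have e : (1 + 1 / (2 * p.σ)) * (2 * δ * z i + δ ^ 2) + 1 / (4 * p.σ) * δ ^ 2 - δ * a i -
          (z i * a i - z i ^ 2 + p.θ * (z i * b i) + p.σ * p.θ ^ 2 * b i ^ 2) =
          -((δ - 2 * p.σ * p.θ * b i) ^ 2 / (4 * p.σ)) := by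
        rw [ha']
        field_simp
        ring
      linarith
    have h2 := mul_le_mul_of_nonneg_left hcore hd.le
    have e2 : (d : ℝ) / (4 * p.σ) = d * (1 / (4 * p.σ)) := by ring
    rw [e2, hD]
    linarith
  have havg : (uniformExp fun i => potential p Xp Xm w η ξ (st.next v p Xp Xm i)) ≤
      D * (z ⬝ᵥ z) + d / p.τ * V - z ⬝ᵥ z + p.θ * (z ⬝ᵥ b) +
        d * p.σ * R ^ 2 * (p.θ ^ 2 * y ^ 2) := by
    refine (uniformExp_mono hterm).trans (le_of_eq ?_)
    simp only [uniformExp, Finset.sum_add_distrib, Finset.sum_sub_distrib, ← Finset.mul_sum,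
      Finset.sum_const, Finset.card_univ, Fintype.card_fin, nsmul_eq_mul]
    have e₁ : z ⬝ᵥ a = ∑ i, z i * a i := rfl
    have e₂ : z ⬝ᵥ b = ∑ i, z i * b i := rfl
    have e₃ : ∑ i, z i ^ 2 = z ⬝ᵥ z := by simp only [dotProduct, sq]
    rw [← e₁, ← e₂, e₃]
    field_simp
    ring
  refine havg.trans ?_
  have hcross := neg_cross_le hp hcp hcm st z
  rw [← hb, ← hy] at hcross
  have hθ := hp.θ_eq
  rw [← hD] at hθ
  have hpot : potential p Xp Xm w η ξ st =
      D * (z ⬝ᵥ z) + (p.γ + d / p.τ) * V + d / p.τ / 16 * y ^ 2 + z ⬝ᵥ b := rfl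
  rw [hpot]
  have hL : 0 < d / p.τ := div_pos hd hp.τ_pos
  have hV0 : 0 ≤ V := add_nonneg
    (bregman_nonneg hη.2 fun j => ((Variant.mem_domain_iff.mp hs.mem_left).1 j).1)
    (bregman_nonneg hξ.2 fun j => ((Variant.mem_domain_iff.mp hs.mem_right).1 j).1)
  have hV := mul_le_mul_of_nonneg_right hp.mirror hV0
  have hzz := dotProduct_self_nonneg' z
  have hDd : d / (4 * p.σ) * (z ⬝ᵥ z) ≤ D * (z ⬝ᵥ z) := by
    refine mul_le_mul_of_nonneg_right ?_ hzz
    have : D = d + 2 * (d / (4 * p.σ)) := by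
      rw [hD]
      field_simp
      ring
    have : 0 < d / (4 * p.σ) := by positivity
    linarith
  have hθ1 : p.θ ^ 2 ≤ p.θ := by nlinarith [hp.θ_nonneg, hp.θ_le, hp.le_one]
  have hc := mul_le_mul_of_nonneg_right hp.coord (show 0 ≤ p.θ ^ 2 * y ^ 2 by positivity)
  -- The surplus `ρ - θ` of the contraction factor is spent on the cross term.
  have hsur := mul_nonneg (sub_nonneg.mpr hp.θ_le)
    (show 0 ≤ D * (z ⬝ᵥ z) + d / p.τ / 16 * y ^ 2 + z ⬝ᵥ b by linarith)
  have hy2 : d / p.τ / 64 * (p.θ ^ 2 * y ^ 2) ≤ p.θ * (d / p.τ / 16 * y ^ 2) := by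
    have h1 : d / p.τ / 64 * (p.θ ^ 2 * y ^ 2) ≤ d / p.τ / 64 * (p.θ * y ^ 2) := by gcongr
    have h2 : 0 ≤ d / p.τ * (p.θ * y ^ 2) :=
      mul_nonneg hL.le (mul_nonneg hp.θ_nonneg (sq_nonneg _))
    linarith
  linear_combination hV + hsur + hy2 + hc + (z ⬝ᵥ z) * hθ

theorem run_mem (h₁ : (v.domain n₁).Nonempty) (h₂ : (v.domain n₂).Nonempty) (hd : 0 < d)
    (hγ : 0 < p.γ) (hτ : 0 < p.τ) : ∀ (T : ℕ) (ι : Fin T → Fin d),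
      ((run v p Xp Xm T ι).η ∈ v.domain n₁ ∧ ∀ j, 0 < (run v p Xp Xm T ι).η j) ∧
      ((run v p Xp Xm T ι).ξ ∈ v.domain n₂ ∧ ∀ j, 0 < (run v p Xp Xm T ι).ξ j)
  | 0, _ => by
    have k₁ : (0 : ℝ) < n₁ := by exact_mod_cast Variant.size_pos h₁
    have k₂ : (0 : ℝ) < n₂ := by exact_mod_cast Variant.size_pos h₂
    exact ⟨⟨Variant.uniform_mem_domain h₁, fun j => by simp only [run, State.start]; positivity⟩,
      ⟨Variant.uniform_mem_domain h₂, fun j => by simp only [run, State.start]; positivity⟩⟩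
  | T + 1, ι => by
    have h := next_mirror (Xp := Xp) (Xm := Xm) h₁ h₂ hd hγ hτ
      (run v p Xp Xm T fun t => ι t.castSucc) (ι (Fin.last T))
    exact ⟨h.1, h.2.1⟩

theorem uniformExp_potential_run_le (hp : StepSizes d p R ρ)
    (hcp : ∀ j, ∑ i, Xp i j ^ 2 ≤ 1) (hcm : ∀ j, ∑ i, Xm i j ^ 2 ≤ 1)
    (hXp : ∀ i j, |Xp i j| ≤ R)
    (hXm : ∀ i j, |Xm i j| ≤ R) (hs : IsSaddle v Xp Xm p.γ w η ξ) (T : ℕ) :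
    (uniformExp fun ι : Fin T → Fin d => potential p Xp Xm w η ξ (run v p Xp Xm T ι)) ≤
      ρ ^ T * potential p Xp Xm w η ξ (State.start d n₁ n₂) := by
  induction T with
  | zero => simp [uniformExp, run]
  | succ T ih =>
    have h := uniformExp_snoc (T := T) fun (ι : Fin T → Fin d) i =>
      potential p Xp Xm w η ξ ((run v p Xp Xm T ι).next v p Xp Xm i)
    simp only [run]
    rw [h]
    calc _ ≤ uniformExp fun ι : Fin T → Fin d =>
          ρ * potential p Xp Xm w η ξ (run v p Xp Xm T ι) := by
          refine uniformExp_mono fun ι => ?_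
          obtain ⟨m₁, m₂⟩ := run_mem (Xp := Xp) (Xm := Xm) ⟨_, hs.mem_left⟩ ⟨_, hs.mem_right⟩
            hp.d_pos hp.γ_pos hp.τ_pos T ι
          exact uniformExp_potential_next_le hp hcp hcm hXp hXm hs _ m₁ m₂
      _ ≤ ρ * (ρ ^ T * potential p Xp Xm w η ξ (State.start d n₁ n₂)) := by
          rw [uniformExp_const_mul]
          exact mul_le_mul_of_nonneg_left ih (by linarith [hp.half_le])
      _ = _ := by ring

/-- The expected squared distance of `w[T]` to the optimum decreases geometrically. -/
theorem uniformExp_distance_le (hp : StepSizes d p R ρ)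
    (hcp : ∀ j, ∑ i, Xp i j ^ 2 ≤ 1) (hcm : ∀ j, ∑ i, Xm i j ^ 2 ≤ 1)
    (hXp : ∀ i j, |Xp i j| ≤ R)
    (hXm : ∀ i j, |Xm i j| ≤ R) (hs : IsSaddle v Xp Xm p.γ w η ξ) (T : ℕ) :
    (d * (1 + 1 / (4 * p.σ))) * (uniformExp fun ι : Fin T → Fin d =>
        ((run v p Xp Xm T ι).w - w) ⬝ᵥ ((run v p Xp Xm T ι).w - w)) ≤
      ρ ^ T * (d * (1 + 1 / (2 * p.σ)) * (w ⬝ᵥ w) +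
        (p.γ + d / p.τ) * (Real.log n₁ + Real.log n₂)) := by
  have hd : (0 : ℝ) < d := by exact_mod_cast hp.d_pos
  have hσ := hp.σ_pos
  have hγ := hp.γ_pos
  have hτ := hp.τ_pos
  rw [← uniformExp_const_mul]
  refine (uniformExp_mono (g := fun ι => potential p Xp Xm w η ξ (run v p Xp Xm T ι))
    fun ι => ?_).trans ((uniformExp_potential_run_le hp hcp hcm hXp hXm hs T).trans ?_)
  · obtain ⟨m₁, m₂⟩ := run_mem (Xp := Xp) (Xm := Xm) ⟨_, hs.mem_left⟩ ⟨_, hs.mem_right⟩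
      hp.d_pos hp.γ_pos hp.τ_pos T ι
    set st := run v p Xp Xm T ι
    have hcross := neg_cross_le hp hcp hcm st (st.w - w)
    have hV0 : 0 ≤ bregman st.η η + bregman st.ξ ξ := add_nonneg
      (bregman_nonneg m₁.2 fun j => ((Variant.mem_domain_iff.mp hs.mem_left).1 j).1)
      (bregman_nonneg m₂.2 fun j => ((Variant.mem_domain_iff.mp hs.mem_right).1 j).1)
    have hV1 : 0 ≤ (p.γ + d / p.τ) * (bregman st.η η + bregman st.ξ ξ) := by positivity
    have e : d * (1 + 1 / (4 * p.σ)) + d / (4 * p.σ) = d * (1 + 1 / (2 * p.σ)) := by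
      field_simp
      ring
    rw [potential, ← e]
    linarith
  · have hρ : 0 ≤ ρ := by linarith [hp.half_le]
    refine mul_le_mul_of_nonneg_left ?_ (pow_nonneg hρ T)
    have k₁ := bregman_uniform_le hs.mem_left
    have k₂ := bregman_uniform_le hs.mem_right
    have hz : signedCombination Xp Xm (0 : Fin n₁ → ℝ) (0 : Fin n₂ → ℝ) = 0 := by
      simp [signedCombination]
    simp only [potential, State.start, State.lastStep, sub_self, hz, dotProduct_zero, zero_sub,
      neg_dotProduct, dotProduct_neg, neg_neg, abs_zero, Finset.sum_const_zero]
    have := mul_le_mul_of_nonneg_left (add_le_add k₁ k₂)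
      (show 0 ≤ p.γ + d / p.τ by positivity)
    linarith

end Potential

/-! ### The randomized Walsh-Hadamard transformation -/

/-- The columns of the sign pattern are orthogonal: complementing a binary digit of the row index
at which two column indices differ changes the sign of the product of the entries. -/
theorem sum_walsh_signs_eq_zero {k : ℕ} {i j : Fin (2 ^ k)} (hij : i ≠ j) :
    ∑ r : Fin (2 ^ k),
      (∏ l ∈ Finset.range (2 ^ k), if r.val.testBit l && i.val.testBit l then (-1 : ℝ) else 1) *
      (∏ l ∈ Finset.range (2 ^ k), if r.val.testBit l && j.val.testBit l then (-1 : ℝ) else 1) =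
    0 := by
  obtain ⟨l₀, hl₀⟩ : ∃ l, i.val.testBit l ≠ j.val.testBit l := by
    by_contra! h
    exact hij (Fin.ext (Nat.eq_of_testBit_eq h))
  have hlk : l₀ < k := by
    by_contra! h
    apply hl₀
    rw [Nat.testBit_lt_two_pow (i.2.trans_le (Nat.pow_le_pow_right two_pos h)),
      Nat.testBit_lt_two_pow (j.2.trans_le (Nat.pow_le_pow_right two_pos h))]
  have hmem : l₀ ∈ Finset.range (2 ^ k) := Finset.mem_range.mpr (hlk.trans Nat.lt_two_pow_self)
  let g : Fin (2 ^ k) → Fin (2 ^ k) := fun r =>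
    ⟨r.val ^^^ 2 ^ l₀, Nat.xor_lt_two_pow r.2 (Nat.pow_lt_pow_right one_lt_two hlk)⟩
  have hbit : ∀ r l, (g r).val.testBit l = (r.val.testBit l ^^ decide (l₀ = l)) := fun r l => by
    simp only [g, Nat.testBit_xor, Nat.testBit_two_pow]
  simp only [← Finset.prod_mul_distrib]
  refine Finset.sum_involution (fun r _ => g r) (fun r _ => ?_) (fun r _ _ h => ?_)
    (fun _ _ => Finset.mem_univ _) fun r _ => ?_
  · rw [← Finset.mul_prod_erase _ _ hmem, ← Finset.mul_prod_erase _ _ hmem]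
    rw [Finset.prod_congr rfl (s₁ := (Finset.range (2 ^ k)).erase l₀)
      (f := fun l => (if (g r).val.testBit l && i.val.testBit l then (-1 : ℝ) else 1) *
        if (g r).val.testBit l && j.val.testBit l then (-1 : ℝ) else 1)
      (g := fun l => (if r.val.testBit l && i.val.testBit l then (-1 : ℝ) else 1) *
        if r.val.testBit l && j.val.testBit l then (-1 : ℝ) else 1)]
    · rw [← add_mul]
      refine mul_eq_zero_of_left ?_ _
      rw [hbit]
      cases hr : r.val.testBit l₀ <;> cases hi : i.val.testBit l₀ <;>
        cases hj : j.val.testBit l₀ <;> simp_all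
    · intro l hl
      have : l₀ ≠ l := (Finset.ne_of_mem_erase hl).symm
      simp only [hbit, this, decide_false, Bool.xor_false]
  · have := hbit r l₀
    rw [h] at this
    simp at this
  · refine Fin.ext (Nat.eq_of_testBit_eq fun l => ?_)
    rw [hbit, hbit]
    simp

theorem walshHadamard_orthogonal {d k : ℕ} (hd : d = 2 ^ k) :
    (walshHadamard d)ᵀ * walshHadamard d = 1 := by
  subst hd
  have h0 : (0 : ℝ) < ((2 ^ k : ℕ) : ℝ) := by positivity
  have hs : √((2 ^ k : ℕ) : ℝ) * √((2 ^ k : ℕ) : ℝ) = ((2 ^ k : ℕ) : ℝ) :=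
    Real.mul_self_sqrt h0.le
  ext i j
  simp only [Matrix.mul_apply, Matrix.transpose_apply, walshHadamard, Matrix.of_apply,
    div_mul_div_comm, hs, ← Finset.sum_div]
  by_cases hij : i = j
  · subst hij
    have : ∀ r : Fin (2 ^ k),
        (∏ l ∈ Finset.range (2 ^ k),
          if r.val.testBit l && i.val.testBit l then (-1 : ℝ) else 1) *
        (∏ l ∈ Finset.range (2 ^ k),
          if r.val.testBit l && i.val.testBit l then (-1 : ℝ) else 1) = 1 := by
      intro r
      rw [← Finset.prod_mul_distrib]
      exact Finset.prod_eq_one fun l _ => by split <;> norm_num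
    simp only [this, Matrix.one_apply_eq]
    simp
  · rw [sum_walsh_signs_eq_zero hij, Matrix.one_apply_ne hij, zero_div]

theorem walshHadamard_sq {d : ℕ} (i j : Fin d) : walshHadamard d i j ^ 2 = 1 / d := by
  rw [walshHadamard, Matrix.of_apply, div_pow, Real.sq_sqrt (Nat.cast_nonneg d), ← Finset.prod_pow,
    Finset.prod_eq_one fun l _ => by split <;> norm_num]

theorem sign_mul_self (u : ℤˣ) : ((u : ℤ) : ℝ) * ((u : ℤ) : ℝ) = 1 := by
  rcases Int.units_eq_one_or u with rfl | rfl <;> norm_num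

theorem hadamardTransform_orthogonal {d k : ℕ} (hd : d = 2 ^ k) (s : Fin d → ℤˣ) :
    (hadamardTransform s)ᵀ * hadamardTransform s = 1 := by
  rw [hadamardTransform, Matrix.transpose_mul, Matrix.mul_assoc,
    ← Matrix.mul_assoc (walshHadamard d)ᵀ, walshHadamard_orthogonal hd, Matrix.one_mul,
    Matrix.diagonal_transpose, Matrix.diagonal_mul_diagonal]
  simp only [sign_mul_self, Matrix.diagonal_one]

theorem uniformProb_eq_uniformExp {α : Type*} [Fintype α] (P : α → Prop) [DecidablePred P] :
    uniformProb P = uniformExp fun a => if P a then (1 : ℝ) else 0 := by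
  rw [uniformProb, uniformExp, Nat.card_eq_fintype_card, Fintype.card_subtype]
  simp

theorem uniformProb_mono {α : Type*} [Fintype α] {P Q : α → Prop} (h : ∀ a, P a → Q a) :
    uniformProb P ≤ uniformProb Q := by
  classical
  rw [uniformProb_eq_uniformExp, uniformProb_eq_uniformExp]
  refine uniformExp_mono fun a => ?_
  split_ifs with h1 h2 h2
  · exact le_rfl
  · exact absurd (h a h1) h2
  · exact zero_le_one
  · exact le_rfl

theorem uniformExp_add {α : Type*} [Fintype α] (f g : α → ℝ) :
    uniformExp (fun a => f a + g a) = uniformExp f + uniformExp g := by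
  rw [uniformExp, uniformExp, uniformExp, Finset.sum_add_distrib, add_div]

/-- The union bound. -/
theorem one_sub_le_uniformProb {α κ : Type*} [Fintype α] [Nonempty α] [Fintype κ]
    {P : α → Prop} {bad : κ → α → Prop} {r : ℝ} (hP : ∀ a, (∀ i, ¬ bad i a) → P a)
    (hbad : ∀ i, uniformProb (bad i) ≤ r) : 1 - Fintype.card κ * r ≤ uniformProb P := by
  classical
  have hc : (0 : ℝ) < Fintype.card α := by exact_mod_cast Fintype.card_pos
  have h1 : (1 : ℝ) ≤ uniformProb P + ∑ i, uniformProb (bad i) := by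
    simp only [uniformProb_eq_uniformExp, uniformExp, ← Finset.sum_div]
    rw [← add_div, le_div_iff₀ hc, one_mul, Finset.sum_comm, ← Finset.sum_add_distrib]
    calc (Fintype.card α : ℝ) = ∑ _a : α, 1 := by simp
      _ ≤ _ := by
        refine Finset.sum_le_sum fun a _ => ?_
        by_cases ha : P a
        · rw [if_pos ha]
          exact le_add_of_nonneg_right (Finset.sum_nonneg fun i _ => by split <;> norm_num)
        · have hex : ∃ i, bad i a := by
            by_contra! h
            exact ha (hP a h)
          obtain ⟨i, hi⟩ := hex
          rw [if_neg ha, zero_add]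
          calc (1 : ℝ) = if bad i a then 1 else 0 := by rw [if_pos hi]
            _ ≤ _ := Finset.single_le_sum (f := fun i => if bad i a then (1 : ℝ) else 0)
              (fun i _ => by split <;> norm_num) (Finset.mem_univ i)
  have h2 : ∑ i, uniformProb (bad i) ≤ Fintype.card κ * r := by
    refine (Finset.sum_le_sum fun i _ => hbad i).trans (le_of_eq ?_)
    simp
  linarith

/-- The moment generating function of a Rademacher sum. -/
theorem uniformExp_exp_rademacher_le {d : ℕ} (a : Fin d → ℝ) :
    (uniformExp fun s : Fin d → ℤˣ => Real.exp (∑ k, a k * ((s k : ℤ) : ℝ))) ≤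
      Real.exp ((∑ k, a k ^ 2) / 2) := by
  have h1 : ∑ s : Fin d → ℤˣ, Real.exp (∑ k, a k * ((s k : ℤ) : ℝ)) =
      ∏ k, (2 * Real.cosh (a k)) := by
    simp only [Real.exp_sum]
    have h := Finset.prod_univ_sum (fun _ : Fin d => (Finset.univ : Finset ℤˣ))
      fun k u => Real.exp (a k * ((u : ℤ) : ℝ))
    rw [Fintype.piFinset_univ] at h
    rw [← h]
    refine Finset.prod_congr rfl fun k _ => ?_
    rw [Real.cosh_eq]
    have hu : (Finset.univ : Finset ℤˣ) = {1, -1} := rfl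
    rw [hu, Finset.sum_pair (by decide)]
    simp
    ring
  have hcard : (Fintype.card (Fin d → ℤˣ) : ℝ) = 2 ^ d := by
    rw [Fintype.card_fun, Fintype.card_fin]
    norm_num [Fintype.card_units_int]
  rw [uniformExp, h1, hcard, Finset.prod_mul_distrib, Finset.prod_const, Finset.card_univ,
    Fintype.card_fin, mul_div_cancel_left₀ _ (by positivity), Finset.sum_div, Real.exp_sum]
  exact Finset.prod_le_prod (fun k _ => (Real.cosh_pos _).le)
    fun k _ => Real.cosh_le_exp_half_sq (a k)

/-- Hoeffding's inequality for a Rademacher sum. -/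
theorem uniformProb_rademacher_le {d : ℕ} {a : Fin d → ℝ} {S R : ℝ} (hS : 0 < S)
    (ha : ∑ k, a k ^ 2 ≤ S) (hR : 0 ≤ R) :
    (uniformProb fun s : Fin d → ℤˣ => R < |∑ k, a k * ((s k : ℤ) : ℝ)|) ≤
      2 * Real.exp (-(R ^ 2 / (2 * S))) := by
  classical
  set t : ℝ := R / S with ht
  have ht0 : 0 ≤ t := div_nonneg hR hS.le
  have hmgf : ∀ r : ℝ, r ^ 2 = t ^ 2 →
      (uniformExp fun s : Fin d → ℤˣ => Real.exp (∑ k, r * a k * ((s k : ℤ) : ℝ))) ≤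
        Real.exp (t ^ 2 * S / 2) := by
    intro r hr
    refine (uniformExp_exp_rademacher_le fun k => r * a k).trans (Real.exp_le_exp.mpr ?_)
    simp only [mul_pow, ← Finset.mul_sum, hr]
    gcongr
  have hp := hmgf t rfl
  have hn := hmgf (-t) (by ring)
  have key : ∀ s : Fin d → ℤˣ,
      (if R < |∑ k, a k * ((s k : ℤ) : ℝ)| then (1 : ℝ) else 0) ≤
        Real.exp (-(t * R)) * (Real.exp (∑ k, t * a k * ((s k : ℤ) : ℝ)) +
          Real.exp (∑ k, -t * a k * ((s k : ℤ) : ℝ))) := by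
    intro s
    split_ifs with h
    · simp only [mul_assoc, ← Finset.mul_sum]
      set X := ∑ k, a k * ((s k : ℤ) : ℝ)
      rw [mul_add, ← Real.exp_add, ← Real.exp_add]
      rcases lt_abs.mp h with h | h
      · have : 1 ≤ Real.exp (-(t * R) + t * X) := Real.one_le_exp (by nlinarith)
        have := Real.exp_pos (-(t * R) + -t * X)
        linarith
      · have : 1 ≤ Real.exp (-(t * R) + -t * X) := Real.one_le_exp (by nlinarith)
        have := Real.exp_pos (-(t * R) + t * X)
        linarith
    · positivity
  rw [uniformProb_eq_uniformExp]
  refine (uniformExp_mono key).trans ?_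
  rw [uniformExp_const_mul, uniformExp_add]
  calc _ ≤ Real.exp (-(t * R)) * (Real.exp (t ^ 2 * S / 2) + Real.exp (t ^ 2 * S / 2)) := by gcongr
    _ = 2 * Real.exp (-(t * R) + t ^ 2 * S / 2) := by rw [Real.exp_add]; ring
    _ = 2 * Real.exp (-(R ^ 2 / (2 * S))) := by
      congr 2
      rw [ht]
      field_simp
      ring

/-- A fixed entry of the transformed data is large with small probability. -/
theorem uniformProb_hadamardTransform_entry_le {d m : ℕ} (hd : 0 < d)
    {X : Matrix (Fin d) (Fin m) ℝ} (hX : ∀ j, ∑ i, X i j ^ 2 ≤ 1) {R : ℝ} (hR : 0 ≤ R)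
    (i : Fin d) (j : Fin m) :
    (uniformProb fun s : Fin d → ℤˣ => R < |(hadamardTransform s * X) i j|) ≤
      2 * Real.exp (-(R ^ 2 * d / 2)) := by
  have hd' : (0 : ℝ) < d := by exact_mod_cast hd
  have e : ∀ s : Fin d → ℤˣ, (hadamardTransform s * X) i j =
      ∑ k, walshHadamard d i k * X k j * ((s k : ℤ) : ℝ) := by
    intro s
    rw [hadamardTransform, Matrix.mul_assoc, Matrix.mul_apply]
    refine Finset.sum_congr rfl fun k _ => ?_
    rw [Matrix.diagonal_mul]
    ring
  have hsum : ∑ k, (walshHadamard d i k * X k j) ^ 2 ≤ 1 / d := by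
    simp only [mul_pow, walshHadamard_sq, ← Finset.mul_sum]
    exact mul_le_of_le_one_right (by positivity) (hX j)
  simp only [e]
  refine (uniformProb_rademacher_le (by positivity) hsum hR).trans (le_of_eq ?_)
  congr 2
  field_simp

/-- With high probability, all entries of the transformed data are `O(√(log n / d))`. -/
theorem one_sub_le_uniformProb_hadamardTransform {d n₁ n₂ : ℕ} (hd : 0 < d) (hn : 2 ≤ n₁ + n₂)
    {A : Matrix (Fin d) (Fin n₁) ℝ} {B : Matrix (Fin d) (Fin n₂) ℝ}
    (hA : ∀ j, ∑ i, A i j ^ 2 ≤ 1) (hB : ∀ j, ∑ i, B i j ^ 2 ≤ 1) (a : ℕ) {R : ℝ} (hR0 : 0 ≤ R)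
    (hR : 2 * (a + 2) * Real.log ((n₁ + n₂ : ℕ) : ℝ) ≤ R ^ 2 * d) :
    1 - (d : ℝ) / ((n₁ + n₂ : ℕ) : ℝ) ^ a ≤ uniformProb fun s : Fin d → ℤˣ =>
      (∀ i j, |(hadamardTransform s * A) i j| ≤ R) ∧
        ∀ i j, |(hadamardTransform s * B) i j| ≤ R := by
  set n := n₁ + n₂ with hn'
  have hn2 : (2 : ℝ) ≤ n := by exact_mod_cast hn
  have hn0 : (0 : ℝ) < n := by linarith
  have hd' : (0 : ℝ) < d := by exact_mod_cast hd
  have hexp : 2 * Real.exp (-(R ^ 2 * d / 2)) ≤ 2 * ((n : ℝ) ^ (a + 2))⁻¹ := by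
    have : Real.exp (-(R ^ 2 * d / 2)) ≤ Real.exp (-(((a + 2 : ℕ) : ℝ) * Real.log n)) := by
      apply Real.exp_le_exp.mpr
      push_cast
      linarith
    rw [Real.exp_neg (_ * _), mul_comm (((a + 2 : ℕ) : ℝ)), Real.exp_mul, Real.exp_log hn0,
      Real.rpow_natCast] at this
    linarith
  have h := one_sub_le_uniformProb (α := Fin d → ℤˣ) (κ := Fin d × (Fin n₁ ⊕ Fin n₂))
    (P := fun s : Fin d → ℤˣ => (∀ i j, |(hadamardTransform s * A) i j| ≤ R) ∧
        ∀ i j, |(hadamardTransform s * B) i j| ≤ R)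
    (bad := fun q s => match q with
      | (i, Sum.inl j) => R < |(hadamardTransform s * A) i j|
      | (i, Sum.inr j) => R < |(hadamardTransform s * B) i j|)
    (r := 2 * ((n : ℝ) ^ (a + 2))⁻¹)
    (fun s hs => ⟨fun i j => not_lt.mp (hs (i, Sum.inl j)),
      fun i j => not_lt.mp (hs (i, Sum.inr j))⟩)
    (by
      rintro ⟨i, j | j⟩
      · exact (uniformProb_hadamardTransform_entry_le hd hA hR0 i j).trans hexp
      · exact (uniformProb_hadamardTransform_entry_le hd hB hR0 i j).trans hexp)
  refine le_trans ?_ h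
  have hcard : (Fintype.card (Fin d × (Fin n₁ ⊕ Fin n₂)) : ℝ) = d * n := by
    simp [hn']
  rw [hcard]
  have : (d : ℝ) * n * (2 * ((n : ℝ) ^ (a + 2))⁻¹) ≤ d / (n : ℝ) ^ a := by
    rw [show (d : ℝ) * n * (2 * ((n : ℝ) ^ (a + 2))⁻¹) = d / (n : ℝ) ^ a * (2 / n) by
      rw [pow_add]; field_simp]
    exact mul_le_of_le_one_right (by positivity) ((div_le_one hn0).mpr hn2)
  linarith

/-! ### The number of iterations -/

theorem half_le_log {n : ℕ} (hn : 2 ≤ n) : 1 / 2 ≤ Real.log n := by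
  have h1 := Real.log_two_gt_d9
  have h2 : Real.log 2 ≤ Real.log n := Real.log_le_log two_pos (by exact_mod_cast hn)
  linarith

theorem gammaOf_pos {n : ℕ} (hn : 2 ≤ n) {ε β : ℝ} (hε : 0 < ε) (hβ : 0 < β) :
    0 < gammaOf n ε β := by
  have := half_le_log hn
  unfold gammaOf
  positivity

theorem gammaOf_mul_log {n : ℕ} (hn : 2 ≤ n) (ε β : ℝ) :
    gammaOf n ε β * Real.log n = ε * β / 2 := by
  have := half_le_log hn
  have : Real.log n ≠ 0 := by linarith
  unfold gammaOf
  field_simp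

/-- The quantity `q √d / √γ`, which equals `d / (2 σ)` for the parameters of the algorithm. -/
noncomputable def conditioning (d n : ℕ) (ε β c : ℝ) : ℝ :=
  c * √(Real.log n) * √d / √(gammaOf n ε β)

/-- The contraction factor of one iteration. -/
noncomputable def contraction (d n : ℕ) (ε β c : ℝ) : ℝ :=
  1 - 1 / (2 * (d + conditioning d n ε β c))

section

variable {d n : ℕ} {ε β c : ℝ}

theorem conditioning_nonneg (hc : 0 ≤ c) : 0 ≤ conditioning d n ε β c := by
  unfold conditioning
  positivity

theorem paramsOf_identities (hd : 0 < d) (hn : 2 ≤ n) (hε : 0 < ε) (hβ : 0 < β) (hc : 0 < c) :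
    0 < (paramsOf d n ε β c).τ ∧ 0 < (paramsOf d n ε β c).σ ∧
    d * (1 + 1 / (2 * (paramsOf d n ε β c).σ)) = d + conditioning d n ε β c ∧
    d / (paramsOf d n ε β c).τ = 2 * conditioning d n ε β c * gammaOf n ε β ∧
    (paramsOf d n ε β c).σ * (paramsOf d n ε β c).τ = d / (4 * (c * √(Real.log n)) ^ 2) := by
  have hγ := gammaOf_pos hn hε hβ
  have hl : 0 < Real.log n := by linarith [half_le_log hn]
  have hd' : (0 : ℝ) < d := by exact_mod_cast hd
  have hτ : (paramsOf d n ε β c).τ = 1 / (2 * (c * √(Real.log n))) * √(d / gammaOf n ε β) := rfl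
  have hσ : (paramsOf d n ε β c).σ = 1 / (2 * (c * √(Real.log n))) * √(d * gammaOf n ε β) := rfl
  rw [Real.sqrt_div hd'.le] at hτ
  rw [Real.sqrt_mul hd'.le] at hσ
  rw [hτ, hσ, conditioning]
  generalize gammaOf n ε β = γ at *
  have eγ := Real.sq_sqrt hγ.le
  have ed := Real.sq_sqrt hd'.le
  have pγ := Real.sqrt_pos.mpr hγ
  have pd := Real.sqrt_pos.mpr hd'
  have pl := Real.sqrt_pos.mpr hl
  generalize √γ = g at *
  generalize √(Real.log n) = l at *
  generalize √(d : ℝ) = s at *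
  rw [← eγ, ← ed]
  refine ⟨by positivity, by positivity, by field_simp, by field_simp, by field_simp; ring⟩

/-- The parameters of the algorithm satisfy the requirements of the convergence proof, provided
that the entries of the data are at most `q / (4 √d)`. -/
theorem stepSizes_paramsOf (hd : 0 < d) (hn : 2 ≤ n) (hε : 0 < ε) (hβ : 0 < β) (hc : 4 ≤ c)
    {R : ℝ} (hR0 : 0 ≤ R) (hR : 16 * (R ^ 2 * d) ≤ (c * √(Real.log n)) ^ 2) :
    StepSizes d (paramsOf d n ε β c) R (contraction d n ε β c) := by
  have hγ := gammaOf_pos hn hε hβ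
  have hl := half_le_log hn
  have hc0 : 0 < c := by linarith
  have hd1 : (1 : ℝ) ≤ d := by exact_mod_cast hd
  have hd' : (0 : ℝ) < d := by linarith
  have hq : 4 ≤ (c * √(Real.log n)) ^ 2 := by
    rw [mul_pow, Real.sq_sqrt (by linarith)]
    nlinarith
  obtain ⟨hτ, hσ, hD, hL, hστ⟩ := paramsOf_identities hd hn hε hβ hc0
  have hQ := conditioning_nonneg (d := d) (n := n) (ε := ε) (β := β) hc0.le
  have hθ : (paramsOf d n ε β c).θ = 1 - 1 / (d + conditioning d n ε β c) := rfl
  have hγ' : (paramsOf d n ε β c).γ = gammaOf n ε β := rfl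
  have hρ : contraction d n ε β c = 1 - 1 / (2 * (d + conditioning d n ε β c)) := rfl
  set Q := conditioning d n ε β c
  set q := c * √(Real.log n)
  set τ := (paramsOf d n ε β c).τ
  set σ := (paramsOf d n ε β c).σ
  have hD1 : 1 ≤ d + Q := by linarith
  have hinv : 1 / (d + Q) ≤ 1 := (div_le_one (by linarith)).mpr hD1
  have hinv0 : 0 < 1 / (d + Q) := by positivity
  have hhalf : 1 / (2 * (d + Q)) = 1 / (d + Q) / 2 := by field_simp
  refine ⟨hd, hγ, hτ, hσ, hR0, ?_, ?_, ?_, ?_, ?_, ?_, ?_, ?_⟩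
  · rw [div_div, div_le_div_iff₀ hd' (by positivity)]
    have h1 : σ * (τ * 16) ≤ d := by
      rw [← mul_assoc, hστ, div_mul_eq_mul_div, div_le_iff₀ (by positivity)]
      nlinarith
    exact h1.trans (by nlinarith)
  · rw [div_div, le_div_iff₀ (by positivity)]
    have h1 : d * σ * R ^ 2 * (τ * 64) = 16 * (R ^ 2 * d) / q ^ 2 * d := by
      calc d * σ * R ^ 2 * (τ * 64) = d * R ^ 2 * 64 * (σ * τ) := by ring
        _ = _ := by rw [hστ]; field_simp; ring
    rw [h1]
    exact mul_le_of_le_one_left hd'.le ((div_le_one (by positivity)).mpr hR)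
  · rw [hθ]; linarith
  · rw [hD, hθ]; field_simp
  · rw [hθ, hρ, hhalf]; linarith
  · rw [hρ, hhalf]; linarith
  · rw [hρ, hhalf]; linarith
  · rw [hL, hγ', hρ]
    generalize gammaOf n ε β = γ at *
    have : (1 - 1 / (2 * (d + Q))) * (γ + 2 * Q * γ) - 2 * Q * γ =
        γ * (2 * d - 1) / (2 * (d + Q)) := by
      field_simp
      ring
    have h0 : 0 ≤ γ * (2 * d - 1) / (2 * (d + Q)) :=
      div_nonneg (mul_nonneg hγ.le (by linarith)) (by linarith)
    linarith

theorem conditioning_eq (hd : 0 < d) (hn : 2 ≤ n) (hε : 0 < ε) (hβ : 0 < β) :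
    conditioning d n ε β c = c * √2 * (√(d / (ε * β)) * Real.log n) := by
  have hl : 0 < Real.log n := by linarith [half_le_log hn]
  have hd' : (0 : ℝ) < d := by exact_mod_cast hd
  rw [conditioning, gammaOf, Real.sqrt_div (by positivity), Real.sqrt_div (by positivity),
    Real.sqrt_mul two_pos.le]
  have h1 := Real.sq_sqrt hl.le
  have h2 : 0 < √(ε * β) := Real.sqrt_pos.mpr (by positivity)
  have h3 : 0 < √(Real.log n) := Real.sqrt_pos.mpr hl
  field_simp
  linear_combination c * h1

/-- After the stated number of iterations the contraction has reached the required accuracy. -/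
theorem contraction_pow_le (hd : 0 < d) (hn : 2 ≤ n) (hε : 0 < ε) (hβ : 0 < β) (hc : 1 ≤ c)
    {μ : ℝ} (hμ : 0 < μ) (hμ2 : μ ≤ 2) {T : ℕ}
    (hT : (8 * c + 20) * (d + √(d / (ε * β)) * Real.log n) * Real.log ((8 * c + 20) / μ) ≤ T) :
    contraction d n ε β c ^ T ≤ μ ^ 2 / 216 := by
  have hd1 : (1 : ℝ) ≤ d := by exact_mod_cast hd
  have hl : 0 < Real.log n := by linarith [half_le_log hn]
  have hQ := conditioning_nonneg (d := d) (n := n) (ε := ε) (β := β) (by linarith : 0 ≤ c)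
  set M := √(d / (ε * β)) * Real.log n
  have hM : 0 ≤ M := by positivity
  have hQM : conditioning d n ε β c ≤ 2 * c * M := by
    rw [conditioning_eq hd hn hε hβ]
    have h2 : √2 ≤ 2 := by rw [Real.sqrt_le_left (by norm_num)]; norm_num
    calc _ ≤ c * 2 * M := by gcongr
      _ = _ := by ring
  set Q := conditioning d n ε β c
  set C := 8 * c + 20
  have hC0 : 0 < C := by simp only [C]; linarith
  have hlog : 0 ≤ Real.log (C / μ) := Real.log_nonneg <| by
    rw [one_le_div hμ]
    simp only [C]
    linarith
  have hT2 : 2 * Real.log (C / μ) ≤ T / (2 * (d + Q)) := by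
    rw [le_div_iff₀ (by linarith)]
    refine le_trans ?_ hT
    have : 2 * (2 * (d + Q)) ≤ C * (d + M) := by
      have : 0 ≤ c * M := by positivity
      have : 0 ≤ c * d := by positivity
      simp only [C]
      linarith
    nlinarith
  have hx0 : 0 < 1 / (2 * (d + Q)) := by positivity
  have hx1 : 1 / (2 * (d + Q)) ≤ 1 := (div_le_one (by linarith)).mpr (by linarith)
  calc contraction d n ε β c ^ T ≤ Real.exp (-(1 / (2 * (d + Q)))) ^ T := by
        refine pow_le_pow_left₀ ?_ ?_ T
        · change 0 ≤ 1 - 1 / (2 * (d + Q))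
          linarith
        · change 1 - 1 / (2 * (d + Q)) ≤ _
          exact Real.one_sub_le_exp_neg _
    _ = Real.exp (-(T / (2 * (d + Q)))) := by
        rw [← Real.exp_nat_mul]
        congr 1
        ring
    _ ≤ Real.exp (-(2 * Real.log (C / μ))) := by
        apply Real.exp_le_exp.mpr
        linarith
    _ = (μ / C) ^ 2 := by
        rw [Real.exp_neg, two_mul, Real.exp_add, Real.exp_log (by positivity)]
        field_simp
    _ ≤ μ ^ 2 / 216 := by
        rw [div_pow]
        gcongr
        simp only [C]
        nlinarith

end

section

variable {d n₁ n₂ : ℕ} {v : Variant} {Xp : Matrix (Fin d) (Fin n₁) ℝ}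
  {Xm : Matrix (Fin d) (Fin n₂) ℝ} {w : Fin d → ℝ} {η : Fin n₁ → ℝ} {ξ : Fin n₂ → ℝ}

theorem uniformExp_distance_paramsOf_le (hd : 0 < d) {ε β c : ℝ} (hε : 0 < ε) (hε1 : ε < 1)
    (hβ : 0 < β) (hβ1 : β ≤ 1)
    (hc : 4 ≤ c) {R : ℝ} (hR0 : 0 ≤ R)
    (hR : 16 * (R ^ 2 * d) ≤ (c * √(Real.log ((n₁ + n₂ : ℕ) : ℝ))) ^ 2)
    (hcp : ∀ j, ∑ i, Xp i j ^ 2 ≤ 1) (hcm : ∀ j, ∑ i, Xm i j ^ 2 ≤ 1)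
    (hXp : ∀ i j, |Xp i j| ≤ R) (hXm : ∀ i j, |Xm i j| ≤ R)
    (hs : IsSaddle v Xp Xm (gammaOf (n₁ + n₂) ε β) w η ξ) (T : ℕ) :
    (uniformExp fun ι : Fin T → Fin d =>
      ((run v (paramsOf d (n₁ + n₂) ε β c) Xp Xm T ι).w - w) ⬝ᵥ
        ((run v (paramsOf d (n₁ + n₂) ε β c) Xp Xm T ι).w - w)) ≤
      12 * contraction d (n₁ + n₂) ε β c ^ T := by
  have k₁ := Variant.size_pos ⟨η, hs.mem_left⟩
  have k₂ := Variant.size_pos ⟨ξ, hs.mem_right⟩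
  have hn : 2 ≤ n₁ + n₂ := by lia
  have hp := stepSizes_paramsOf hd hn hε hβ hc hR0 hR
  have h := uniformExp_distance_le hp hcp hcm hXp hXm hs T
  obtain ⟨hτ, hσ, hD, hL, -⟩ := paramsOf_identities hd hn hε hβ (by linarith : 0 < c)
  have hγ' : (paramsOf d (n₁ + n₂) ε β c).γ = gammaOf (n₁ + n₂) ε β := rfl
  have hγ := gammaOf_pos hn hε hβ
  have hlog := gammaOf_mul_log hn ε β
  have hQ := conditioning_nonneg (d := d) (n := n₁ + n₂) (ε := ε) (β := β) (by linarith : 0 ≤ c)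
  have hww := hs.dotProduct_self_le hcp hcm
  have hw0 := dotProduct_self_nonneg' w
  have hρ : 0 ≤ contraction d (n₁ + n₂) ε β c := by linarith [hp.half_le]
  have hD' : d * (1 + 1 / (4 * (paramsOf d (n₁ + n₂) ε β c).σ)) =
      d + conditioning d (n₁ + n₂) ε β c / 2 := by
    have : d * (1 + 1 / (4 * (paramsOf d (n₁ + n₂) ε β c).σ)) =
        d / 2 + d * (1 + 1 / (2 * (paramsOf d (n₁ + n₂) ε β c).σ)) / 2 := by
      field_simp
      ring
    rw [this, hD]
    ring
  rw [hD', hD, hL, hγ'] at h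
  set Q := conditioning d (n₁ + n₂) ε β c
  have hd1 : (1 : ℝ) ≤ d := by exact_mod_cast hd
  have l₁ : Real.log n₁ ≤ Real.log ((n₁ + n₂ : ℕ) : ℝ) :=
    Real.log_le_log (by exact_mod_cast k₁) (by exact_mod_cast (by lia : n₁ ≤ n₁ + n₂))
  have l₂ : Real.log n₂ ≤ Real.log ((n₁ + n₂ : ℕ) : ℝ) :=
    Real.log_le_log (by exact_mod_cast k₂) (by exact_mod_cast (by lia : n₂ ≤ n₁ + n₂))
  have hεβ : ε * β ≤ 1 := by nlinarith
  have hbound : (d + Q) * (w ⬝ᵥ w) + (gammaOf (n₁ + n₂) ε β + 2 * Q * gammaOf (n₁ + n₂) ε β) *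
      (Real.log n₁ + Real.log n₂) ≤ 12 * (d + Q / 2) := by
    have b₁ : (d + Q) * (w ⬝ᵥ w) ≤ (d + Q) * 4 := by gcongr
    have b₂ : (gammaOf (n₁ + n₂) ε β + 2 * Q * gammaOf (n₁ + n₂) ε β) *
        (Real.log n₁ + Real.log n₂) ≤ (1 + 2 * Q) * (ε * β) := by
      calc _ = (1 + 2 * Q) * gammaOf (n₁ + n₂) ε β * (Real.log n₁ + Real.log n₂) := by ring
        _ ≤ (1 + 2 * Q) * gammaOf (n₁ + n₂) ε β *
            (Real.log ((n₁ + n₂ : ℕ) : ℝ) + Real.log ((n₁ + n₂ : ℕ) : ℝ)) := by gcongr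
        _ = (1 + 2 * Q) * (ε * β) := by linear_combination 2 * (1 + 2 * Q) * hlog
    have b₃ : (1 + 2 * Q) * (ε * β) ≤ 1 + 2 * Q := mul_le_of_le_one_right (by linarith) hεβ
    linarith
  have h2 := h.trans (mul_le_mul_of_nonneg_left hbound (pow_nonneg hρ T))
  have hpos : 0 < d + Q / 2 := by linarith
  refine le_of_mul_le_mul_left ?_ hpos
  linarith

theorem sum_sq_mul_le {O : Matrix (Fin d) (Fin d) ℝ} (hO : Oᵀ * O = 1)
    {m : ℕ} {X : Matrix (Fin d) (Fin m) ℝ} (hX : ∀ j, ∑ i, X i j ^ 2 ≤ 1) (j : Fin m) :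
    ∑ i, (O * X) i j ^ 2 ≤ 1 := by
  have h := mulVec_dotProduct_mulVec hO (fun i => X i j) (fun i => X i j)
  refine le_trans (le_of_eq ?_) (hX j)
  simp only [dotProduct, ← sq] at h
  exact h

/-- The part of the argument that is deterministic in the signs: if the entries of the transformed
data are small, the expected loss is at most `ε OPT`. -/
theorem uniformExp_loss_le {k : ℕ} (hd : d = 2 ^ k) {A : Matrix (Fin d) (Fin n₁) ℝ}
    {B : Matrix (Fin d) (Fin n₂) ℝ} {ε β c μ : ℝ} (hε : 0 < ε) (hε1 : ε < 1)
    (hβ : 0 < β) (hβ1 : β ≤ 1) (hc : 4 ≤ c) {R : ℝ} (hR0 : 0 ≤ R)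
    (hR : 16 * (R ^ 2 * d) ≤ (c * √(Real.log ((n₁ + n₂ : ℕ) : ℝ))) ^ 2)
    (hA : ∀ j, ∑ i, A i j ^ 2 ≤ 1) (hB : ∀ j, ∑ i, B i j ^ 2 ≤ 1) {s : Fin d → ℤˣ}
    (hsA : ∀ i j, |(hadamardTransform s * A) i j| ≤ R)
    (hsB : ∀ i j, |(hadamardTransform s * B) i j| ≤ R)
    (hs : IsSaddle v A B (gammaOf (n₁ + n₂) ε β) w η ξ) (hμ : 0 < μ) (hμ2 : μ ≤ 2) {T : ℕ}
    (hT : (8 * c + 20) * (d + √(d / (ε * β)) * Real.log ((n₁ + n₂ : ℕ) : ℝ)) *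
      Real.log ((8 * c + 20) / μ) ≤ T) (γ : ℝ) :
    (uniformExp fun ι : Fin T → Fin d => lowerValue v A B γ w -
      lowerValue v A B γ (output v (paramsOf d (n₁ + n₂) ε β c) A B s T ι)) ≤ μ := by
  have hd0 : 0 < d := by rw [hd]; positivity
  have k₁ := Variant.size_pos ⟨η, hs.mem_left⟩
  have k₂ := Variant.size_pos ⟨ξ, hs.mem_right⟩
  have hn : 2 ≤ n₁ + n₂ := by lia
  have : Nonempty (Fin d) := ⟨⟨0, hd0⟩⟩
  set O := hadamardTransform s with hOdef
  have hO : Oᵀ * O = 1 := hadamardTransform_orthogonal hd s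
  have hO' : O * Oᵀ = 1 := mul_eq_one_comm.mp hO
  have hdist := uniformExp_distance_paramsOf_le hd0 hε hε1 hβ hβ1 hc hR0 hR
    (sum_sq_mul_le hO hA) (sum_sq_mul_le hO hB) hsA hsB (hs.transform hO) T
  have hpow := contraction_pow_le hd0 hn hε hβ (by linarith : 1 ≤ c) hμ hμ2 hT
  have hpt : ∀ ι : Fin T → Fin d, lowerValue v A B γ w -
      lowerValue v A B γ (output v (paramsOf d (n₁ + n₂) ε β c) A B s T ι) ≤
      9 / μ * (((run v (paramsOf d (n₁ + n₂) ε β c) (O * A) (O * B) T ι).w - O *ᵥ w) ⬝ᵥ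
        ((run v (paramsOf d (n₁ + n₂) ε β c) (O * A) (O * B) T ι).w - O *ᵥ w)) + μ / 2 := by
    intro ι
    refine (lowerValue_sub_le ⟨_, hs.mem_left⟩ ⟨_, hs.mem_right⟩ hA hB γ
      (hs.sqrt_le hA hB) _).trans ?_
    have hz : (output v (paramsOf d (n₁ + n₂) ε β c) A B s T ι - w) ⬝ᵥ
        (output v (paramsOf d (n₁ + n₂) ε β c) A B s T ι - w) =
        ((run v (paramsOf d (n₁ + n₂) ε β c) (O * A) (O * B) T ι).w - O *ᵥ w) ⬝ᵥ
        ((run v (paramsOf d (n₁ + n₂) ε β c) (O * A) (O * B) T ι).w - O *ᵥ w) := by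
      rw [← mulVec_dotProduct_mulVec hO, Matrix.mulVec_sub, output, ← hOdef,
        Matrix.mulVec_mulVec, hO', Matrix.one_mulVec]
    rw [hz]
    generalize (run v (paramsOf d (n₁ + n₂) ε β c) (O * A) (O * B) T ι).w - O *ᵥ w = z
    have hz0 := dotProduct_self_nonneg' z
    have hsq := Real.sq_sqrt hz0
    -- `4 r ≤ μ / 2 + 8 r² / μ`, and `1 / 2 ≤ 1 / μ`.
    have h1 : 4 * √(z ⬝ᵥ z) ≤ μ / 2 + 8 / μ * √(z ⬝ᵥ z) ^ 2 := by
      have e : μ / 2 + 8 / μ * √(z ⬝ᵥ z) ^ 2 - 4 * √(z ⬝ᵥ z) =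
          (μ - 4 * √(z ⬝ᵥ z)) ^ 2 / (2 * μ) := by
        field_simp
        ring
      have : 0 ≤ (μ - 4 * √(z ⬝ᵥ z)) ^ 2 / (2 * μ) := by positivity
      linarith
    have h2 : (z ⬝ᵥ z) / 2 ≤ 1 / μ * (z ⬝ᵥ z) := by
      rw [div_eq_mul_one_div, mul_comm]
      gcongr
    rw [hsq] at h1
    have e : 9 / μ = 8 / μ + 1 / μ := by rw [← add_div]; norm_num
    rw [e]
    linarith
  refine (uniformExp_mono hpt).trans ?_
  rw [uniformExp_add_const, uniformExp_const_mul]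
  calc _ ≤ 9 / μ * (12 * (μ ^ 2 / 216)) + μ / 2 := by
        gcongr
        exact hdist.trans (by gcongr)
    _ = μ := by field_simp; norm_num

end

/-- The constants are `c₀ = 32 (a + 2)`, which makes the bound `R = √(2 (a + 2) log n / d)` on the
entries admissible for the step sizes, and `C = 8 c + 20`. The loss bound holds for every
regularization weight, not only for the two in the statement. -/
theorem convergence (a : ℕ) : ∃ c₀ > (0 : ℝ), ∀ c ≥ c₀, ∃ C > (0 : ℝ),
      ∀ (d n₁ n₂ : ℕ) (v : Variant)
        (A : Matrix (Fin d) (Fin n₁) ℝ) (B : Matrix (Fin d) (Fin n₂) ℝ) (ε β : ℝ),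
        (∃ k : ℕ, d = 2 ^ k) →
        (v.domain n₁).Nonempty → (v.domain n₂).Nonempty →
        (∀ j, ∑ i, A i j ^ 2 ≤ 1) → (∀ j, ∑ i, B i j ^ 2 ≤ 1) →
        (∀ η ∈ v.domain n₁, ∀ ξ ∈ v.domain n₂, A *ᵥ η ≠ B *ᵥ ξ) →
        0 < ε → ε < 1 → 0 < β → β ≤ 1 →
        ∃ w₀ : Fin d → ℝ,
          (∀ w, IsOptimal v A B (gammaOf (n₁ + n₂) ε β) w ↔ w = w₀) ∧
          1 - (d : ℝ) / ((n₁ + n₂ : ℕ) : ℝ) ^ a ≤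
            uniformProb fun s : Fin d → ℤˣ =>
              ∀ T : ℕ,
                C * (d + √(d / (ε * β)) * Real.log (n₁ + n₂ : ℕ)) *
                    Real.log (C / (ε * OPT v A B)) ≤ T →
                ∀ γ ∈ ({0, gammaOf (n₁ + n₂) ε β} : Set ℝ),
                  (uniformExp fun ι : Fin T → Fin d =>
                    lowerValue v A B γ w₀ -
                      lowerValue v A B γ
                        (output v (paramsOf d (n₁ + n₂) ε β c) A B s T ι)) ≤
                    ε * OPT v A B := by
  refine ⟨32 * (a + 2), by positivity, fun c hc => ?_⟩
  have ha0 : (0 : ℝ) ≤ a := Nat.cast_nonneg a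
  have hc4 : 4 ≤ c := by linarith
  refine ⟨8 * c + 20, by linarith, fun d n₁ n₂ v A B ε β hdk h₁ h₂ hA hB hAB hε hε1 hβ hβ1 => ?_⟩
  obtain ⟨k, hd⟩ := hdk
  have hd0 : 0 < d := by rw [hd]; positivity
  have hd' : (0 : ℝ) < d := by exact_mod_cast hd0
  have hn : 2 ≤ n₁ + n₂ := by
    have := Variant.size_pos h₁
    have := Variant.size_pos h₂
    lia
  have hl := half_le_log hn
  obtain ⟨w, η, ξ, hs⟩ := exists_isSaddle h₁ h₂ A B (gammaOf_pos hn hε hβ).le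
  refine ⟨w, hs.isOptimal_iff, ?_⟩
  set R := √(2 * (a + 2) * Real.log ((n₁ + n₂ : ℕ) : ℝ) / d) with hRdef
  have hRd : R ^ 2 * d = 2 * (a + 2) * Real.log ((n₁ + n₂ : ℕ) : ℝ) := by
    rw [hRdef, Real.sq_sqrt (by positivity)]
    field_simp
  refine (one_sub_le_uniformProb_hadamardTransform hd0 hn hA hB a (Real.sqrt_nonneg _)
    hRd.ge).trans (uniformProb_mono fun s hsAB T hT γ _ => ?_)
  obtain ⟨hO0, hO2⟩ := OPT_pos_le h₁ h₂ hA hB hAB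
  refine uniformExp_loss_le hd hε hε1 hβ hβ1 hc4 (Real.sqrt_nonneg _) ?_ hA hB hsAB.1 hsAB.2 hs
    (mul_pos hε hO0) (by nlinarith) hT γ
  rw [← hRdef, hRd, mul_pow, Real.sq_sqrt (by linarith)]
  have : 32 * (a + 2) ≤ c ^ 2 := by nlinarith
  nlinarith

/-! ### Reasoning about programs -/

/-- Started in `s`, the program `P` stops after at most `k` steps in a store satisfying `Q`. -/
def Costs (P : Program) (s : Store) (k : ℕ) (Q : Store → Prop) : Prop :=
  ∃ k' ≤ k, ∃ s', Exec P s k' s' ∧ Q s'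

theorem Costs.mono {P : Program} {s : Store} {k l : ℕ} {Q R : Store → Prop} (h : Costs P s k Q)
    (hkl : k ≤ l) (hQR : ∀ s', Q s' → R s') : Costs P s l R := by
  obtain ⟨k', hk', s', he, hq⟩ := h
  exact ⟨k', hk'.trans hkl, s', he, hQR _ hq⟩

theorem Costs.op {o : Op} {s : Store} {Q : Store → Prop} (h : Q (o.apply s)) :
    Costs (.op o) s 1 Q :=
  ⟨1, le_rfl, _, .op o s, h⟩

theorem Costs.seq {P P' : Program} {s : Store} {k l : ℕ} {Q R : Store → Prop}
    (h : Costs P s k Q) (h' : ∀ s', Q s' → Costs P' s' l R) : Costs (.seq P P') s (k + l) R := by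
  obtain ⟨k', hk', s', he, hq⟩ := h
  obtain ⟨l', hl', s'', he', hr⟩ := h' s' hq
  exact ⟨k' + l', by lia, s'', .seq he he', hr⟩

theorem Costs.ifThenElse {b : Test} {P P' : Program} {s : Store} {k : ℕ} {Q : Store → Prop}
    (h : b.Holds s → Costs P s k Q) (h' : ¬ b.Holds s → Costs P' s k Q) :
    Costs (.ifThenElse b P P') s (k + 1) Q := by
  by_cases hb : b.Holds s
  · obtain ⟨k', hk', s', he, hq⟩ := h hb
    exact ⟨k' + 1, by lia, s', .ifTrue hb he, hq⟩
  · obtain ⟨k', hk', s', he, hq⟩ := h' hb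
    exact ⟨k' + 1, by lia, s', .ifFalse hb he, hq⟩

/-- A loop with an invariant indexed by the number of rounds, which is at most `n`. -/
theorem Costs.while {b : Test} {P : Program} {c n : ℕ} {Q : Store → Prop}
    (Inv : ℕ → Store → Prop)
    (hstep : ∀ j s, Inv j s → b.Holds s → j < n ∧ Costs P s c (Inv (j + 1)))
    (hend : ∀ j s, Inv j s → ¬ b.Holds s → Q s) {s : Store} (h0 : Inv 0 s) :
    Costs (.while b P) s (n * (c + 1) + 1) Q := by
  have key : ∀ m j s, n ≤ j + m → Inv j s → Costs (.while b P) s (m * (c + 1) + 1) Q := by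
    intro m
    induction m with
    | zero =>
      intro j s hj hI
      by_cases hb : b.Holds s
      · have := (hstep j s hI hb).1
        lia
      · exact ⟨1, by lia, s, .whileFalse hb, hend j s hI hb⟩
    | succ m ih =>
      intro j s hj hI
      by_cases hb : b.Holds s
      · obtain ⟨k, hk, s', he, hI'⟩ := (hstep j s hI hb).2
        obtain ⟨l, hl, s'', he', hq⟩ := ih (j + 1) s' (by lia) hI'
        exact ⟨k + l + 1, by lia, s'', .whileTrue hb he he', hq⟩
      · exact ⟨1, by lia, s, .whileFalse hb, hend j s hI hb⟩
  exact key n 0 s (by lia) h0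

/-- A nonempty sequence of elementary operations. -/
def Program.ofOps : Op → List Op → Program
  | o, [] => .op o
  | o, o' :: l => .seq (.op o) (ofOps o' l)

theorem Costs.ofOps {Q : Store → Prop} : ∀ {o : Op} {l : List Op} {s : Store},
    Q ((o :: l).foldl (fun s o => o.apply s) s) → Costs (Program.ofOps o l) s (l.length + 1) Q
  | o, [], s, h => Costs.op h
  | o, o' :: l, s, h => by
    rw [List.length_cons, add_comm (l.length + 1) 1]
    exact Costs.seq (Q := fun s' => s' = o.apply s) (Costs.op rfl) fun s' hs' =>
      Costs.ofOps (by rw [hs']; exact h)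

/-- A loop over the indices below `n`; the natural-number register `5` holds the index. -/
theorem Costs.for {P : Program} {c n N : ℕ} (Inv : ℕ → Store → Prop)
    (hreg : ∀ j s, Inv j s → s.nat 5 = j ∧ s.nat N = n)
    (hstep : ∀ j s, j < n → Inv j s → Costs P s c (Inv (j + 1))) {s : Store} (h0 : Inv 0 s) :
    Costs (.while (.natLt 5 N) P) s (n * (c + 1) + 1) (Inv n) := by
  refine Costs.while (fun j s => j ≤ n ∧ Inv j s) (fun j s h hb => ?_) (fun j s h hb => ?_)
    ⟨Nat.zero_le _, h0⟩
  · obtain ⟨h5, hN⟩ := hreg j s h.2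
    simp only [Test.Holds, h5, hN] at hb
    exact ⟨hb, (hstep j s hb h.2).mono le_rfl fun s' h' => ⟨hb, h'⟩⟩
  · obtain ⟨h5, hN⟩ := hreg j s h.2
    simp only [Test.Holds, h5, hN] at hb
    have : j = n := by lia
    exact this ▸ h.2

/-! ### The program of one iteration -/

/-!
Register conventions. The natural-number registers `0`, `1`, `2`, `3` hold `n₁`, `n₂`, `d` and the
picked index, `4` the constant `1`, `5` the index of the current loop, `10`, …, `17` the numbers
`0`, …, `7`, and `18` and `19` the array numbers of the picked rows. The real registers `0`, …, `7`
hold `d`, `γ`, `τ`, `σ`, `θ`, the upper bound on the weights, `0` and `1`; the registers `8` and `9`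
hold `δ⁺` and `δ⁻`; `10` and `11` hold the change of the picked coordinate of `w` and `d` times this
change; `12`, `13`, `14` hold `γ / d + 1 / τ`, `± 1 / d` and `1 / τ`; `15` holds the scale of
the weights. The real registers from `16` on are scratch. In the subprograms, `N` is the register
with the number of weights, and `cur`, `prev`, `prod`, `row` are the registers with the numbers of
the arrays that hold the current and the previous weights, the product of `w` with the data, and the
picked row.
-/

/-- The extrapolated product `∑ⱼ Xⱼ (xⱼ + θ (xⱼ - yⱼ))` in the real register `acc`. -/
def dotProgram (N cur prev row acc : ℕ) : Program :=
  .seq (.ofOps (.natConst 5 0) [.realConst acc 0])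
    (.while (.natLt 5 N) (.ofOps (.load 20 cur 5) [.load 21 prev 5, .realSub 21 20 21,
      .realMul 21 4 21, .realAdd 20 20 21, .load 21 row 5, .realMul 20 21 20,
      .realAdd acc acc 20, .natAdd 5 5 4]))

theorem dotProgram_spec {n N cur prev row acc : ℕ} {s : Store} (hN : N ≠ 5) (hcur : cur ≠ 5)
    (hprev : prev ≠ 5) (hrow : row ≠ 5) (hacc : 8 ≤ acc) (hacc' : acc < 20) (h4 : s.nat 4 = 1)
    (hn : s.nat N = n) :
    Costs (dotProgram N cur prev row acc) s (10 * n + 3) fun s' =>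
      (∀ r, r ≠ 5 → s'.nat r = s.nat r) ∧ (∀ r < 20, r ≠ acc → s'.real r = s.real r) ∧
      s'.mem = s.mem ∧
      s'.real acc = ∑ b ∈ Finset.range n, s.mem (s.nat row) b *
        (s.mem (s.nat cur) b + s.real 4 * (s.mem (s.nat cur) b - s.mem (s.nat prev) b)) := by
  have hk : 10 * n + 3 = (1 + 1) + (n * (9 + 1) + 1) := by ring
  rw [hk]
  refine Costs.seq (Costs.ofOps (Q := fun s' => s' = _) rfl) ?_
  rintro _ rfl
  refine (Costs.for (n := n) (fun j s' => s'.nat 5 = j ∧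
      (∀ r, r ≠ 5 → s'.nat r = s.nat r) ∧ (∀ r < 20, r ≠ acc → s'.real r = s.real r) ∧
      s'.mem = s.mem ∧
      s'.real acc = ∑ b ∈ Finset.range j, s.mem (s.nat row) b *
        (s.mem (s.nat cur) b + s.real 4 * (s.mem (s.nat cur) b - s.mem (s.nat prev) b)))
      ?_ ?_ ?_).mono le_rfl ?_
  · rintro j s' ⟨h5, hnat, -⟩
    exact ⟨h5, (hnat N hN).trans hn⟩
  · rintro j s' hj ⟨h5, hnat, hreal, hmem, hsum⟩
    refine Costs.ofOps ?_
    have e1 : acc ≠ 20 := by lia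
    have e2 : acc ≠ 21 := by lia
    have e3 : 4 ≠ acc := by lia
    refine ⟨?_, ?_, ?_, ?_, ?_⟩
    · simp [Op.apply, h5, hnat 4 (by decide), h4]
    · intro r hr
      simp [Op.apply, Function.update_apply, hr, hnat r hr]
    · intro r hr hra
      have : r ≠ 20 := by lia
      have : r ≠ 21 := by lia
      simp [Op.apply, *]
    · simp [Op.apply, hmem]
    · simp [Op.apply, e1, e2, Finset.sum_range_succ, hsum, h5, hmem,
        hnat cur hcur, hnat prev hprev, hnat row hrow, hreal 4 (by decide) e3]
  · refine ⟨?_, ?_, ?_, ?_, ?_⟩ <;> simp +contextual [Op.apply]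
  · rintro s' ⟨-, h⟩
    exact h

/-- The unnormalized new weights: for each index `j` below the size the loop moves the current
weight to the array of the previous weights, writes the Gibbs weight of the mirror step in its
place and updates the entry of the product of `w` with the data. -/
def weightProgram (N cur prev prod row : ℕ) : Program :=
  .seq (.op (.natConst 5 0))
    (.while (.natLt 5 N) (.ofOps (.load 20 cur 5) [.store prev 5 20, .realLog 21 20,
      .realAdd 21 21 7, .realMul 21 14 21, .load 22 prod 5, .load 23 row 5, .realMul 24 11 23,
      .realAdd 24 22 24, .realMul 24 13 24, .realSub 24 24 21, .realSub 24 6 24,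
      .realDiv 24 24 12, .realExp 24 24, .store cur 5 24, .realMul 23 10 23, .realAdd 22 22 23,
      .store prod 5 22, .natAdd 5 5 4]))

theorem weightProgram_spec {n N cur prev prod row : ℕ} {s : Store} (hN : N ≠ 5) (hcur : cur ≠ 5)
    (hprev : prev ≠ 5) (hprod : prod ≠ 5) (hrow : row ≠ 5) (h4 : s.nat 4 = 1) (h6 : s.real 6 = 0)
    (h7 : s.real 7 = 1) (hn : s.nat N = n)
    (d₁ : s.nat cur ≠ s.nat prev) (d₂ : s.nat cur ≠ s.nat prod) (d₃ : s.nat prev ≠ s.nat prod)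
    (d₄ : s.nat row ≠ s.nat cur) (d₅ : s.nat row ≠ s.nat prev) (d₆ : s.nat row ≠ s.nat prod) :
    Costs (weightProgram N cur prev prod row) s (20 * n + 2) fun s' =>
      (∀ r, r ≠ 5 → s'.nat r = s.nat r) ∧ (∀ r < 20, s'.real r = s.real r) ∧
      (∀ a, a ≠ s.nat cur → a ≠ s.nat prev → a ≠ s.nat prod → s'.mem a = s.mem a) ∧
      (∀ b, s'.mem (s.nat cur) b = if b < n then
        Real.exp (-(s.real 13 * (s.mem (s.nat prod) b + s.real 11 * s.mem (s.nat row) b) -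
          s.real 14 * (Real.log (s.mem (s.nat cur) b) + 1)) / s.real 12)
        else s.mem (s.nat cur) b) ∧
      (∀ b, s'.mem (s.nat prev) b = if b < n then s.mem (s.nat cur) b
        else s.mem (s.nat prev) b) ∧
      (∀ b, s'.mem (s.nat prod) b = if b < n then
        s.mem (s.nat prod) b + s.real 10 * s.mem (s.nat row) b else s.mem (s.nat prod) b) := by
  have hk : 20 * n + 2 = 1 + (n * (19 + 1) + 1) := by ring
  rw [hk]
  refine Costs.seq (Costs.op (Q := fun s' => s' = _) rfl) ?_
  rintro _ rfl
  refine (Costs.for (n := n) (fun j s' => s'.nat 5 = j ∧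
      (∀ r, r ≠ 5 → s'.nat r = s.nat r) ∧ (∀ r < 20, s'.real r = s.real r) ∧
      (∀ a, a ≠ s.nat cur → a ≠ s.nat prev → a ≠ s.nat prod → s'.mem a = s.mem a) ∧
      (∀ b, s'.mem (s.nat cur) b = if b < j then
        Real.exp (-(s.real 13 * (s.mem (s.nat prod) b + s.real 11 * s.mem (s.nat row) b) -
          s.real 14 * (Real.log (s.mem (s.nat cur) b) + 1)) / s.real 12)
        else s.mem (s.nat cur) b) ∧
      (∀ b, s'.mem (s.nat prev) b = if b < j then s.mem (s.nat cur) b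
        else s.mem (s.nat prev) b) ∧
      (∀ b, s'.mem (s.nat prod) b = if b < j then
        s.mem (s.nat prod) b + s.real 10 * s.mem (s.nat row) b else s.mem (s.nat prod) b))
      ?_ ?_ ?_).mono le_rfl ?_
  · rintro j s' ⟨h5, hnat, -⟩
    exact ⟨h5, (hnat N hN).trans hn⟩
  · rintro j s' hj ⟨h5, hnat, hreal, hmem, hc, hp, hq⟩
    refine Costs.ofOps ?_
    have nc := hnat cur hcur
    have np := hnat prev hprev
    have nq := hnat prod hprod
    have nr := hnat row hrow
    have n4 := hnat 4 (by decide)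
    have mr := hmem (s.nat row) d₄ d₅ d₆
    have mc := hc j
    have mp := hp j
    have mq := hq j
    rw [if_neg (lt_irrefl j)] at mc mp mq
    have r6 := hreal 6 (by decide)
    have r7 := hreal 7 (by decide)
    have r10 := hreal 10 (by decide)
    have r11 := hreal 11 (by decide)
    have r12 := hreal 12 (by decide)
    have r13 := hreal 13 (by decide)
    have r14 := hreal 14 (by decide)
    have succ_iff : ∀ b, b < j + 1 ↔ b = j ∨ b < j := fun b => by lia
    refine ⟨?_, ?_, ?_, ?_, ?_, ?_, ?_⟩
    · simp [Op.apply, h5, n4, h4]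
    · intro r hr
      simp [Op.apply, hr, hnat r hr]
    · intro r hr
      have : r ≠ 20 := by lia
      have : r ≠ 21 := by lia
      have : r ≠ 22 := by lia
      have : r ≠ 23 := by lia
      have : r ≠ 24 := by lia
      simp [Op.apply, *]
    · intro a a₁ a₂ a₃
      simp [Op.apply, nc, np, nq, a₁, a₂, a₃, hmem a a₁ a₂ a₃]
    · intro b
      by_cases hb : b = j
      · subst hb
        simp [Op.apply, nc, np, nq, nr, h5, d₁, d₂, d₂.symm, d₃.symm, d₅, mr, mc, mq, r6, r7, r11,
          r12, r13, r14, h6, h7]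
      · simp [Op.apply, nc, np, nq, h5, d₁, d₂, hb, hc b, succ_iff]
    · intro b
      by_cases hb : b = j
      · subst hb
        simp [Op.apply, nc, np, nq, h5, d₁.symm, d₃, mc]
      · simp [Op.apply, nc, np, nq, h5, d₁, d₁.symm, d₃, hb, hp b, succ_iff]
    · intro b
      by_cases hb : b = j
      · subst hb
        simp [Op.apply, nc, np, nq, nr, h5, d₁, d₂.symm, d₃.symm, d₅, mr, mq, r10]
      · simp [Op.apply, nc, np, nq, h5, d₂.symm, d₃.symm, hb, hq b, succ_iff]
  · refine ⟨?_, ?_, ?_, ?_, ?_, ?_, ?_⟩ <;> simp +contextual [Op.apply]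
  · rintro s' ⟨-, h⟩
    exact h

/-- Scaling by the real register `15` and cutting at the upper bound in the real register `5`. -/
def cutProgram (N cur : ℕ) : Program :=
  .seq (.op (.natConst 5 0))
    (.while (.natLt 5 N) (.seq (.ofOps (.load 20 cur 5) [.realMul 20 15 20])
      (.seq (.ifThenElse (.realLt 5 20) (.op (.realAdd 20 5 6)) (.op (.realAdd 20 20 6)))
        (.ofOps (.store cur 5 20) [.natAdd 5 5 4]))))

theorem cutProgram_spec {n N cur : ℕ} {s : Store} (hN : N ≠ 5) (hcur : cur ≠ 5)
    (h4 : s.nat 4 = 1) (h6 : s.real 6 = 0) (hn : s.nat N = n) :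
    Costs (cutProgram N cur) s (7 * n + 2) fun s' =>
      (∀ r, r ≠ 5 → s'.nat r = s.nat r) ∧ (∀ r < 20, s'.real r = s.real r) ∧
      (∀ a, a ≠ s.nat cur → s'.mem a = s.mem a) ∧
      (∀ b, s'.mem (s.nat cur) b = if b < n then
        min (s.real 5) (s.real 15 * s.mem (s.nat cur) b) else s.mem (s.nat cur) b) := by
  have hk : 7 * n + 2 = 1 + (n * (6 + 1) + 1) := by ring
  rw [hk]
  refine Costs.seq (Costs.op (Q := fun s' => s' = _) rfl) ?_
  rintro _ rfl
  refine (Costs.for (n := n) (fun j s' => s'.nat 5 = j ∧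
      (∀ r, r ≠ 5 → s'.nat r = s.nat r) ∧ (∀ r < 20, s'.real r = s.real r) ∧
      (∀ a, a ≠ s.nat cur → s'.mem a = s.mem a) ∧
      (∀ b, s'.mem (s.nat cur) b = if b < j then
        min (s.real 5) (s.real 15 * s.mem (s.nat cur) b) else s.mem (s.nat cur) b))
      ?_ ?_ ?_).mono le_rfl ?_
  · rintro j s' ⟨h5, hnat, -⟩
    exact ⟨h5, (hnat N hN).trans hn⟩
  · rintro j s' hj ⟨h5, hnat, hreal, hmem, hc⟩
    have nc := hnat cur hcur
    have n4 := hnat 4 (by decide)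
    have mc := hc j
    rw [if_neg (lt_irrefl j)] at mc
    have r5 := hreal 5 (by decide)
    have r6 := hreal 6 (by decide)
    have r15 := hreal 15 (by decide)
    have succ_iff : ∀ b, b < j + 1 ↔ b = j ∨ b < j := fun b => by lia
    refine Costs.seq (k := 2) (l := 4) (Q := fun t => t.nat = s'.nat ∧
      (∀ r < 20, t.real r = s.real r) ∧ t.mem = s'.mem ∧ t.real 20 = s.real 15 * s.mem (s.nat cur) j) ?_ ?_
    · refine Costs.ofOps ⟨?_, ?_, ?_, ?_⟩
      · simp [Op.apply]
      · intro r hr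
        simp [Op.apply, hr.ne, hreal r hr]
      · simp [Op.apply]
      · simp [Op.apply, nc, h5, mc, r15]
    rintro t ⟨t1, t2, t3, t4⟩
    refine Costs.seq (k := 2) (l := 2) (Q := fun t => t.nat = s'.nat ∧
      (∀ r < 20, t.real r = s.real r) ∧ t.mem = s'.mem ∧
      t.real 20 = min (s.real 5) (s.real 15 * s.mem (s.nat cur) j)) (Costs.ifThenElse ?_ ?_) ?_
    · intro hlt
      simp only [Test.Holds, t4, t2 5 (by decide)] at hlt
      refine Costs.op ⟨t1, ?_, t3, ?_⟩
      · intro r hr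
        simp [Op.apply, hr.ne, t2 r hr]
      · simp [Op.apply, t2 5, t2 6, h6, min_eq_left hlt.le]
    · intro hlt
      simp only [Test.Holds, t4, t2 5 (by decide)] at hlt
      refine Costs.op ⟨t1, ?_, t3, ?_⟩
      · intro r hr
        simp [Op.apply, hr.ne, t2 r hr]
      · simp [Op.apply, t4, t2 6, h6, min_eq_right (not_lt.mp hlt)]
    rintro t ⟨t1, t2, t3, t4⟩
    refine Costs.ofOps ⟨?_, ?_, ?_, ?_, ?_⟩
    · simp [Op.apply, t1, h5, n4, h4]
    · intro r hr
      simp [Op.apply, hr, t1, hnat r hr]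
    · intro r hr
      simp [Op.apply, t2 r hr]
    · intro a ha
      simp [Op.apply, t1, t3, nc, ha, hmem a ha]
    · intro b
      by_cases hb : b = j
      · subst hb
        simp [Op.apply, t1, t3, t4, nc, h5]
      · simp [Op.apply, t1, t3, nc, h5, hb, hc b, succ_iff]
  · refine ⟨?_, ?_, ?_, ?_, ?_⟩ <;> simp +contextual [Op.apply]
  · rintro s' ⟨-, h⟩
    exact h

/-! ### The search for the scale of the capped weights -/

section Scale

variable {ν : ℝ} {e : ℕ → ℝ} {n : ℕ} {l : ℝ}

/-- The number of entries that exceed the bound `ν` at the scale `l`. -/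
noncomputable def cutCount (ν : ℝ) (e : ℕ → ℝ) (n : ℕ) (l : ℝ) : ℕ :=
  ((Finset.range n).filter fun b => ν < l * e b).card

/-- The unscaled mass of the entries that do not exceed the bound `ν` at the scale `l`. -/
noncomputable def uncutMass (ν : ℝ) (e : ℕ → ℝ) (n : ℕ) (l : ℝ) : ℝ :=
  ∑ b ∈ (Finset.range n).filter (fun b => ¬ ν < l * e b), e b

/-- The scale that would give total mass `1` if exactly the entries cut at the scale `l` were
cut. -/
noncomputable def nextScale (ν : ℝ) (e : ℕ → ℝ) (n : ℕ) (l : ℝ) : ℝ :=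
  (1 - ν * cutCount ν e n l) / uncutMass ν e n l

/-- A scale from which the search may continue: the total mass is at most `1`, and not all entries
are cut. -/
structure IsSubscale (ν : ℝ) (e : ℕ → ℝ) (n : ℕ) (l : ℝ) : Prop where
  nonneg : 0 ≤ l
  mass_le : ∑ b ∈ Finset.range n, min ν (l * e b) ≤ 1
  uncut : ∃ b < n, l * e b ≤ ν

theorem sum_min_eq (ν : ℝ) (e : ℕ → ℝ) (n : ℕ) (l : ℝ) :
    ∑ b ∈ Finset.range n, min ν (l * e b) = ν * cutCount ν e n l + l * uncutMass ν e n l := by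
  rw [← Finset.sum_filter_add_sum_filter_not _ (fun b => ν < l * e b), uncutMass, cutCount,
    Finset.mul_sum]
  congr 1
  · rw [Finset.sum_congr rfl fun b hb => min_eq_left (Finset.mem_filter.mp hb).2.le]
    simp [mul_comm]
  · exact Finset.sum_congr rfl fun b hb => min_eq_right (not_lt.mp (Finset.mem_filter.mp hb).2)

theorem isSubscale_zero (hν : 0 < ν) (hn : 1 ≤ n * ν) : IsSubscale ν e n 0 := by
  refine ⟨le_rfl, by simp [hν.le], ⟨0, ?_, by simpa using hν.le⟩⟩
  rcases Nat.eq_zero_or_pos n with rfl | h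
  · norm_num at hn
  · exact h

theorem IsSubscale.uncutMass_pos (he : ∀ b, b < n → 0 < e b) (h : IsSubscale ν e n l) :
    0 < uncutMass ν e n l := by
  obtain ⟨b, hb, hle⟩ := h.uncut
  refine Finset.sum_pos (fun b hb => he b (Finset.mem_range.mp (Finset.mem_filter.mp hb).1))
    ⟨b, ?_⟩
  exact Finset.mem_filter.mpr ⟨Finset.mem_range.mpr hb, not_lt.mpr hle⟩

theorem IsSubscale.mul_cutCount_le (he : ∀ b, b < n → 0 < e b) (h : IsSubscale ν e n l) :
    ν * cutCount ν e n l ≤ 1 := by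
  have h1 := h.mass_le
  rw [sum_min_eq] at h1
  have := mul_nonneg h.nonneg (h.uncutMass_pos he).le
  linarith

theorem IsSubscale.nextScale_mul (he : ∀ b, b < n → 0 < e b) (h : IsSubscale ν e n l) :
    ν * cutCount ν e n l + nextScale ν e n l * uncutMass ν e n l = 1 := by
  rw [nextScale, div_mul_cancel₀ _ (h.uncutMass_pos he).ne']
  ring

theorem IsSubscale.le_nextScale (he : ∀ b, b < n → 0 < e b) (h : IsSubscale ν e n l) :
    l ≤ nextScale ν e n l := by
  have h1 := h.mass_le
  rw [sum_min_eq] at h1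
  have h2 := h.nextScale_mul he
  exact le_of_mul_le_mul_right (by linarith) (h.uncutMass_pos he)

theorem IsSubscale.next (hν : 1 ≤ n * ν) (he : ∀ b, b < n → 0 < e b) (h : IsSubscale ν e n l) :
    IsSubscale ν e n (nextScale ν e n l) := by
  refine ⟨h.nonneg.trans (h.le_nextScale he), ?_, ?_⟩
  · rw [← h.nextScale_mul he, ← Finset.sum_filter_add_sum_filter_not _ (fun b => ν < l * e b),
      uncutMass, cutCount, Finset.mul_sum]
    refine add_le_add ?_ (Finset.sum_le_sum fun b _ => min_le_right _ _)
    refine (Finset.sum_le_sum fun b _ => min_le_left _ _).trans (le_of_eq ?_)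
    simp [mul_comm]
  · -- Otherwise every entry not cut at `l` would exceed `ν`, and the total mass `n ν`.
    by_contra! hc
    have h1 := h.nextScale_mul he
    rw [uncutMass, Finset.mul_sum] at h1
    obtain ⟨b, hb, hle⟩ := h.uncut
    have h2 : ∑ b ∈ (Finset.range n).filter (fun b => ¬ ν < l * e b), ν <
        ∑ b ∈ (Finset.range n).filter (fun b => ¬ ν < l * e b), nextScale ν e n l * e b :=
      Finset.sum_lt_sum_of_nonempty
        ⟨b, Finset.mem_filter.mpr ⟨Finset.mem_range.mpr hb, not_lt.mpr hle⟩⟩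
        fun b hb => hc b (Finset.mem_range.mp (Finset.mem_filter.mp hb).1)
    have h3 : ν * cutCount ν e n l + ∑ b ∈ (Finset.range n).filter (fun b => ¬ ν < l * e b), ν =
        n * ν := by
      have := Finset.card_filter_add_card_filter_not (s := Finset.range n) (fun b => ν < l * e b)
      rw [Finset.card_range] at this
      have h4 : (n : ℝ) = cutCount ν e n l +
          ((Finset.range n).filter fun b => ¬ ν < l * e b).card := by
        rw [cutCount]
        exact_mod_cast this.symm
      rw [h4, Finset.sum_const, nsmul_eq_mul]
      ring
    linarith

/-- If no further entry is cut at the next scale, the next scale gives total mass `1`. -/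
theorem IsSubscale.stable (he : ∀ b, b < n → 0 < e b) (h : IsSubscale ν e n l)
    (hle : cutCount ν e n (nextScale ν e n l) ≤ cutCount ν e n l) :
    nextScale ν e n (nextScale ν e n l) = nextScale ν e n l ∧
      ∑ b ∈ Finset.range n, min ν (nextScale ν e n l * e b) = 1 := by
  have hsub : (Finset.range n).filter (fun b => ν < l * e b) ⊆
      (Finset.range n).filter (fun b => ν < nextScale ν e n l * e b) := by
    intro b hb
    have hb' := Finset.mem_filter.mp hb
    refine Finset.mem_filter.mpr ⟨hb'.1, hb'.2.trans_le ?_⟩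
    exact mul_le_mul_of_nonneg_right (h.le_nextScale he) (he b (Finset.mem_range.mp hb'.1)).le
  have heq := Finset.eq_of_subset_of_card_le hsub hle
  have hc : cutCount ν e n (nextScale ν e n l) = cutCount ν e n l := by
    rw [cutCount, cutCount, heq]
  have hu : uncutMass ν e n (nextScale ν e n l) = uncutMass ν e n l := by
    rw [uncutMass, uncutMass, Finset.filter_not, Finset.filter_not, heq]
  constructor
  · conv_lhs => rw [nextScale, hc, hu]
    rfl
  · rw [sum_min_eq, hc, hu, h.nextScale_mul he]

end Scale

/-- One round of the search for the scale: it computes the mass of the cut entries (register `16`,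
whose old value moves to `17`) and the unscaled mass of the others (register `18`) at the scale in
register `15`, and replaces the latter by the next scale. -/
def scaleRound (N cur : ℕ) : Program :=
  .seq
    (.ofOps (.realAdd 17 16 6) [.realConst 16 0, .realConst 18 0, .natConst 5 0])
    (.seq
      (.while (.natLt 5 N) (.seq (.ofOps (.load 20 cur 5) [.realMul 21 15 20])
        (.seq (.ifThenElse (.realLt 5 21) (.op (.realAdd 16 16 5)) (.op (.realAdd 18 18 20)))
          (.op (.natAdd 5 5 4)))))
      (.ofOps (.realSub 15 7 16) [.realDiv 15 15 18]))

/-- The search for the scale, which ends when the cut mass has not grown in a round. -/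
def scaleProgram (N cur : ℕ) : Program :=
  .seq (.ofOps (.realConst 15 0) [.realSub 16 6 5, .realSub 17 16 5])
    (.while (.realLt 17 16) (scaleRound N cur))

theorem scaleRound_spec {n N cur : ℕ} {s : Store} (hN : N ≠ 5) (hcur : cur ≠ 5)
    (h4 : s.nat 4 = 1) (h6 : s.real 6 = 0) (h7 : s.real 7 = 1) (hn : s.nat N = n) :
    Costs (scaleRound N cur) s (6 * n + 7) fun s' =>
      (∀ r, r ≠ 5 → s'.nat r = s.nat r) ∧ (∀ r < 15, s'.real r = s.real r) ∧ s'.mem = s.mem ∧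
      s'.real 17 = s.real 16 ∧
      s'.real 16 = s.real 5 * cutCount (s.real 5) (s.mem (s.nat cur)) n (s.real 15) ∧
      s'.real 15 = nextScale (s.real 5) (s.mem (s.nat cur)) n (s.real 15) := by
  have hk : 6 * n + 7 = 4 + ((n * (5 + 1) + 1) + 2) := by ring
  rw [hk]
  refine Costs.seq (Q := fun s' => s' = _) (Costs.ofOps rfl) ?_
  rintro _ rfl
  refine Costs.seq (Costs.for (n := n) (fun j s' => s'.nat 5 = j ∧
      (∀ r, r ≠ 5 → s'.nat r = s.nat r) ∧ (∀ r < 16, s'.real r = s.real r) ∧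
      s'.mem = s.mem ∧ s'.real 17 = s.real 16 ∧
      s'.real 16 = s.real 5 * cutCount (s.real 5) (s.mem (s.nat cur)) j (s.real 15) ∧
      s'.real 18 = uncutMass (s.real 5) (s.mem (s.nat cur)) j (s.real 15)) ?_ ?_ ?_) ?_
  · rintro j s' ⟨h5, hnat, -⟩
    exact ⟨h5, (hnat N hN).trans hn⟩
  · rintro j s' hj ⟨h5, hnat, hreal, hmem, h17, h16, h18⟩
    have nc := hnat cur hcur
    have n4 := hnat 4 (by decide)
    have r5 := hreal 5 (by decide)
    have r15 := hreal 15 (by decide)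
    refine Costs.seq (k := 2) (l := 3) (Q := fun t => t.nat = s'.nat ∧
      (∀ r < 16, t.real r = s.real r) ∧ t.mem = s.mem ∧ t.real 17 = s.real 16 ∧
      t.real 16 = s'.real 16 ∧ t.real 18 = s'.real 18 ∧ t.real 20 = s.mem (s.nat cur) j ∧
      t.real 21 = s.real 15 * s.mem (s.nat cur) j) ?_ ?_
    · refine Costs.ofOps ⟨?_, ?_, ?_, ?_, ?_, ?_, ?_, ?_⟩
      · simp [Op.apply]
      · intro r hr
        have : r ≠ 20 := by lia
        have : r ≠ 21 := by lia
        simp [Op.apply, *]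
      all_goals simp [Op.apply, hmem, h17, nc, h5, r15]
    rintro t ⟨t1, t2, t3, t4, t5, t6, t7, t8⟩
    refine Costs.seq (k := 2) (l := 1) (Q := fun t => t.nat = s'.nat ∧
      (∀ r < 16, t.real r = s.real r) ∧ t.mem = s.mem ∧ t.real 17 = s.real 16 ∧
      t.real 16 = s.real 5 * cutCount (s.real 5) (s.mem (s.nat cur)) (j + 1) (s.real 15) ∧
      t.real 18 = uncutMass (s.real 5) (s.mem (s.nat cur)) (j + 1) (s.real 15))
      (Costs.ifThenElse ?_ ?_) ?_
    · intro hlt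
      simp only [Test.Holds, t8, t2 5 (by decide)] at hlt
      refine Costs.op ⟨t1, ?_, t3, ?_, ?_, ?_⟩
      · intro r hr
        simp [Op.apply, hr.ne, t2 r hr]
      · simp [Op.apply, t4]
      · simp [Op.apply, t2 5, t5, h16, cutCount, Finset.range_add_one, Finset.filter_insert, hlt]
        ring
      · simp [Op.apply, t6, h18, uncutMass, Finset.range_add_one, Finset.filter_insert,
          hlt.not_ge]
    · intro hlt
      simp only [Test.Holds, t8, t2 5 (by decide)] at hlt
      refine Costs.op ⟨t1, ?_, t3, ?_, ?_, ?_⟩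
      · intro r hr
        have : r ≠ 18 := by lia
        simp [Op.apply, this, t2 r hr]
      · simp [Op.apply, t4]
      · simp [Op.apply, t5, h16, cutCount, Finset.range_add_one, Finset.filter_insert, hlt]
      · simp only [uncutMass, Finset.range_add_one, Finset.filter_insert, hlt] at h18 ⊢
        simp [Op.apply, t6, t7, h18, add_comm]
    rintro t ⟨t1, t2, t3, t4, t5, t6⟩
    refine Costs.op ⟨?_, ?_, ?_, ?_, ?_, ?_, ?_⟩
    · simp [Op.apply, t1, h5, n4, h4]
    · intro r hr
      simp [Op.apply, hr, t1, hnat r hr]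
    all_goals simp_all [Op.apply]
  · refine ⟨?_, ?_, ?_, ?_, ?_, ?_, ?_⟩
    · simp [Op.apply]
    · intro r hr
      simp [Op.apply, hr]
    · intro r hr
      have : r ≠ 16 := by lia
      have : r ≠ 17 := by lia
      have : r ≠ 18 := by lia
      simp [Op.apply, *]
    · simp [Op.apply]
    · simp [Op.apply, h6]
    · simp [Op.apply, cutCount]
    · simp [Op.apply, uncutMass]
  · rintro t ⟨-, t2, t3, t4, t5, t6, t7⟩
    refine Costs.ofOps ⟨?_, ?_, ?_, ?_, ?_, ?_⟩
    · intro r hr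
      simp [Op.apply, t2 r hr]
    · intro r hr
      have : r < 16 := by lia
      simp [Op.apply, hr.ne, t3 r this]
    · simp [Op.apply, t4]
    · simp [Op.apply, t5]
    · simp [Op.apply, t6]
    · simp [Op.apply, t6, t7, t3 7, h7, nextScale]

theorem scaleProgram_spec {n N cur : ℕ} {s : Store} (hN : N ≠ 5) (hcur : cur ≠ 5)
    (h4 : s.nat 4 = 1) (h6 : s.real 6 = 0) (h7 : s.real 7 = 1) (hn : s.nat N = n)
    (hcap : 0 < s.real 5) (hcapn : 1 ≤ n * s.real 5)
    (he : ∀ b, b < n → 0 < s.mem (s.nat cur) b) :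
    Costs (scaleProgram N cur) s ((⌊1 / s.real 5⌋₊ + 2) * (6 * n + 8) + 4) fun s' =>
      (∀ r, r ≠ 5 → s'.nat r = s.nat r) ∧ (∀ r < 15, s'.real r = s.real r) ∧ s'.mem = s.mem ∧
      0 < s'.real 15 ∧
      ∑ b ∈ Finset.range n, min (s.real 5) (s'.real 15 * s.mem (s.nat cur) b) = 1 := by
  set ν := s.real 5 with hν
  set e := s.mem (s.nat cur) with hedef
  have hk : (⌊1 / ν⌋₊ + 2) * (6 * n + 8) + 4 = 3 + ((⌊1 / ν⌋₊ + 2) * (6 * n + 7 + 1) + 1) := by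
    ring
  rw [hk]
  refine Costs.seq (Q := fun s' => s' = _) (Costs.ofOps rfl) ?_
  rintro _ rfl
  -- The registers `17` and `16` hold `ν` times the numbers `c₀` and `c₁` of cut entries in the
  -- last two rounds, which start as `-2` and `-1`, so that the first two rounds always count as
  -- progress.
  refine Costs.while (fun k s' => (∀ r, r ≠ 5 → s'.nat r = s.nat r) ∧
      (∀ r < 15, s'.real r = s.real r) ∧ s'.mem = s.mem ∧ IsSubscale ν e n (s'.real 15) ∧
      ∃ c₀ c₁ : ℤ, s'.real 17 = ν * c₀ ∧ s'.real 16 = ν * c₁ ∧ k ≤ c₀ + 2 ∧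
        (c₁ = -1 ∨ ∃ l, IsSubscale ν e n l ∧ c₁ = cutCount ν e n l ∧
          s'.real 15 = nextScale ν e n l) ∧
        (c₀ < c₁ ∨ ∑ b ∈ Finset.range n, min ν (s'.real 15 * e b) = 1)) ?_ ?_ ?_
  · rintro k s' ⟨hnat, hreal, hmem, hsub, c₀, c₁, h17, h16, hkc, hc₁, -⟩ hb
    simp only [Test.Holds, h17, h16] at hb
    have hlt : c₀ < c₁ := by exact_mod_cast lt_of_mul_lt_mul_left hb hcap.le
    constructor
    · have hcle : c₁ ≤ ⌊1 / ν⌋₊ := by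
        rcases hc₁ with h | ⟨l, hl, h, -⟩
        · rw [h]
          exact (by norm_num : (-1 : ℤ) ≤ 0).trans (Int.natCast_nonneg _)
        · rw [h]
          have := hl.mul_cutCount_le he
          have : cutCount ν e n l ≤ ⌊1 / ν⌋₊ := by
            apply Nat.le_floor
            rw [le_div_iff₀ hcap]
            linarith
          exact_mod_cast this
      lia
    · refine (scaleRound_spec (n := n) hN hcur (by rw [hnat 4 (by decide), h4])
        (by rw [hreal 6 (by decide), h6]) (by rw [hreal 7 (by decide), h7])
        (by rw [hnat N hN, hn])).mono le_rfl ?_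
      rw [hreal 5 (by decide), hmem, hnat cur hcur]
      rintro t ⟨t1, t2, t3, t4, t5, t6⟩
      refine ⟨fun r hr => (t1 r hr).trans (hnat r hr), fun r hr => (t2 r hr).trans (hreal r hr),
        t3, ?_, c₁, cutCount ν e n (s'.real 15), ?_, ?_, ?_, ?_, ?_⟩
      · rw [t6]
        exact hsub.next hcapn he
      · rw [t4, h16]
      · rw [t5]
        norm_cast
      · push_cast
        lia
      · exact Or.inr ⟨_, hsub, rfl, t6⟩
      · rcases hc₁ with h | ⟨l, hl, h, hl'⟩
        · left
          rw [h]
          exact (by norm_num : (-1 : ℤ) < 0).trans_le (Int.natCast_nonneg _)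
        · by_cases hgrow : cutCount ν e n l < cutCount ν e n (s'.real 15)
          · left
            rw [h]
            exact_mod_cast hgrow
          · right
            rw [hl'] at hgrow t6
            obtain ⟨q1, q2⟩ := hl.stable he (not_lt.mp hgrow)
            rw [t6, q1]
            exact q2
  · rintro k s' ⟨hnat, hreal, hmem, hsub, c₀, c₁, h17, h16, -, -, hc⟩ hb
    simp only [Test.Holds, h17, h16] at hb
    have hle : ¬ c₀ < c₁ := fun h => hb (mul_lt_mul_of_pos_left (by exact_mod_cast h) hcap)
    have hsum := hc.resolve_left hle
    refine ⟨hnat, hreal, hmem, lt_of_le_of_ne hsub.nonneg ?_, hsum⟩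
    intro h0
    rw [← h0] at hsum
    simp [hcap.le] at hsum
  · refine ⟨?_, ?_, ?_, ?_, -2, -1, ?_, ?_, ?_, Or.inl rfl, Or.inl (by norm_num)⟩
    · simp [Op.apply]
    · intro r hr
      have : r ≠ 15 := by lia
      have : r ≠ 16 := by lia
      have : r ≠ 17 := by lia
      simp [Op.apply, *]
    · simp [Op.apply]
    · simpa [Op.apply] using isSubscale_zero hcap hcapn
    · simp [Op.apply, h6, ← hν]
      ring
    · simp [Op.apply, h6, ← hν]
    · simp

/-! ### The cost of one iteration -/

/-- The mirror step for one of the two weight vectors. -/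
def mirrorProgram (N cur prev prod row : ℕ) : Program :=
  .seq (weightProgram N cur prev prod row) (.seq (scaleProgram N cur) (cutProgram N cur))

/-- The number of steps allowed to the mirror step for `n` weights with the upper bound `ν`. -/
noncomputable def mirrorCost (ν : ℝ) (n : ℕ) : ℕ :=
  (20 * n + 2) + (((⌊1 / ν⌋₊ + 2) * (6 * n + 8) + 4) + (7 * n + 2))

theorem mirrorProgram_spec {n N cur prev prod row : ℕ} {s : Store} (hN : N ≠ 5) (hcur : cur ≠ 5)
    (hprev : prev ≠ 5) (hprod : prod ≠ 5) (hrow : row ≠ 5) (h4 : s.nat 4 = 1) (h6 : s.real 6 = 0)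
    (h7 : s.real 7 = 1) (hn : s.nat N = n)
    (d₁ : s.nat cur ≠ s.nat prev) (d₂ : s.nat cur ≠ s.nat prod) (d₃ : s.nat prev ≠ s.nat prod)
    (d₄ : s.nat row ≠ s.nat cur) (d₅ : s.nat row ≠ s.nat prev) (d₆ : s.nat row ≠ s.nat prod)
    (hcap : 0 < s.real 5) (hcapn : 1 ≤ n * s.real 5) {E : ℕ → ℝ}
    (hE : ∀ b, E b = Real.exp (-(s.real 13 * (s.mem (s.nat prod) b +
      s.real 11 * s.mem (s.nat row) b) - s.real 14 * (Real.log (s.mem (s.nat cur) b) + 1)) /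
        s.real 12)) :
    Costs (mirrorProgram N cur prev prod row) s (mirrorCost (s.real 5) n) fun s' =>
      (∀ r, r ≠ 5 → s'.nat r = s.nat r) ∧ (∀ r < 15, s'.real r = s.real r) ∧
      (∀ a, a ≠ s.nat cur → a ≠ s.nat prev → a ≠ s.nat prod → s'.mem a = s.mem a) ∧
      (∃ l, 0 < l ∧ ∑ b ∈ Finset.range n, min (s.real 5) (l * E b) = 1 ∧
        ∀ b < n, s'.mem (s.nat cur) b = min (s.real 5) (l * E b)) ∧
      (∀ b < n, s'.mem (s.nat prev) b = s.mem (s.nat cur) b) ∧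
      (∀ b < n, s'.mem (s.nat prod) b =
        s.mem (s.nat prod) b + s.real 10 * s.mem (s.nat row) b) := by
  refine Costs.seq (weightProgram_spec hN hcur hprev hprod hrow h4 h6 h7 hn d₁ d₂ d₃ d₄ d₅ d₆) ?_
  rintro s₁ ⟨nat₁, real₁, mem₁, cur₁, prev₁, prod₁⟩
  have ncur₁ := nat₁ cur hcur
  have hcur₁ : ∀ b < n, s₁.mem (s₁.nat cur) b = E b := by
    intro b hb
    rw [ncur₁, cur₁, if_pos hb, hE]
  have r5 := real₁ 5 (by decide)
  refine Costs.seq (Costs.mono (scaleProgram_spec (n := n) (N := N) (cur := cur) (s := s₁) hN hcur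
    ?_ ?_ ?_ ?_ ?_ ?_ ?_) (by rw [r5]) fun s' h => h) ?_
  · rw [nat₁ 4 (by decide), h4]
  · rw [real₁ 6 (by decide), h6]
  · rw [real₁ 7 (by decide), h7]
  · rw [nat₁ N hN, hn]
  · rwa [r5]
  · rwa [r5]
  · intro b hb
    rw [hcur₁ b hb, hE]
    exact Real.exp_pos _
  rintro s₂ ⟨nat₂, real₂, mem₂, hl, hsum⟩
  have ncur₂ : s₂.nat cur = s.nat cur := (nat₂ cur hcur).trans ncur₁
  refine (cutProgram_spec (n := n) (N := N) (cur := cur) (s := s₂) hN hcur ?_ ?_ ?_).mono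
    le_rfl ?_
  · rw [nat₂ 4 (by decide), nat₁ 4 (by decide), h4]
  · rw [real₂ 6 (by decide), real₁ 6 (by decide), h6]
  · rw [nat₂ N hN, nat₁ N hN, hn]
  rintro s₃ ⟨nat₃, real₃, mem₃, cur₃⟩
  rw [ncur₂] at mem₃ cur₃
  refine ⟨fun r hr => (nat₃ r hr).trans ((nat₂ r hr).trans (nat₁ r hr)),
    fun r hr => (real₃ r (by lia)).trans ((real₂ r hr).trans (real₁ r (by lia))),
    fun a a₁ a₂ a₃ => (mem₃ a a₁).trans (by rw [mem₂, mem₁ a a₁ a₂ a₃]),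
    ⟨s₂.real 15, hl, ?_, ?_⟩, ?_, ?_⟩
  · rw [← hsum]
    refine Finset.sum_congr rfl fun b hb => ?_
    rw [hcur₁ b (Finset.mem_range.mp hb), r5]
  · intro b hb
    rw [cur₃, if_pos hb, mem₂, ← ncur₁, hcur₁ b hb, real₂ 5 (by decide), r5]
  · intro b hb
    rw [mem₃ _ d₁.symm, mem₂, prev₁, if_pos hb]
  · intro b hb
    rw [mem₃ _ d₂.symm, mem₂, prod₁, if_pos hb]

/-- The weights computed by the mirror step are the minimizer of its objective. -/
theorem argmin_mirror_eq {v : Variant} {m : ℕ} (h : (v.domain m).Nonempty) {τ γ l : ℝ}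
    (hτ : 0 < τ) (hγ : 0 < γ) (hl : 0 < l) {b x : Fin m → ℝ} {f : (Fin m → ℝ) → ℝ}
    (hf : ∀ y, f y = ∑ j, b j * y j + γ * entropyH y + 1 / τ * bregman x y) {E : ℕ → ℝ}
    (hE : ∀ j : Fin m, E j = Real.exp (-mirrorCoeff τ b x j / (γ + 1 / τ)))
    (hs : ∑ b ∈ Finset.range m, min v.cap (l * E b) = 1) (j : Fin m) :
    argmin (v.domain m) f j = min v.cap (l * E j) := by
  have hs' : ∑ j, cappedGibbs v (γ + 1 / τ) (mirrorCoeff τ b x) l j = 1 := by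
    refine Eq.trans ?_ hs
    rw [Finset.sum_range]
    simp only [cappedGibbs, hE]
  rw [argmin_eq_cappedGibbs h (by positivity) hl hs'
    fun y => (hf y).trans (mirror_objective τ γ b x y), cappedGibbs, hE]

/-- The natural-number registers hold the sizes, the picked index `i` and the array numbers. -/
structure NatContext (d n₁ n₂ i : ℕ) (s : Store) : Prop where
  r0 : s.nat 0 = n₁
  r1 : s.nat 1 = n₂
  r2 : s.nat 2 = d
  r3 : s.nat 3 = i
  r4 : s.nat 4 = 1
  r11 : s.nat 11 = 1
  r12 : s.nat 12 = 2
  r13 : s.nat 13 = 3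
  r14 : s.nat 14 = 4
  r15 : s.nat 15 = 5
  r16 : s.nat 16 = 6
  r17 : s.nat 17 = 7
  r18 : s.nat 18 = i + i + 8
  r19 : s.nat 19 = i + i + 9

theorem NatContext.congr {d n₁ n₂ i : ℕ} {s s' : Store} (h : NatContext d n₁ n₂ i s)
    (hs : ∀ r, r ≠ 5 → s'.nat r = s.nat r) : NatContext d n₁ n₂ i s' := by
  constructor <;> rw [hs _ (by decide)]
  exacts [h.r0, h.r1, h.r2, h.r3, h.r4, h.r11, h.r12, h.r13, h.r14, h.r15, h.r16, h.r17, h.r18,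
    h.r19]

/-- The first real registers hold the parameters and the constants `0` and `1`. -/
structure RealContext (d : ℕ) (p : Params) (cap : ℝ) (s : Store) : Prop where
  r0 : s.real 0 = d
  r1 : s.real 1 = p.γ
  r2 : s.real 2 = p.τ
  r3 : s.real 3 = p.σ
  r4 : s.real 4 = p.θ
  r5 : s.real 5 = cap
  r6 : s.real 6 = 0
  r7 : s.real 7 = 1

theorem RealContext.congr {d : ℕ} {p : Params} {cap : ℝ} {s s' : Store}
    (h : RealContext d p cap s) (hs : ∀ r < 8, s'.real r = s.real r) :
    RealContext d p cap s' := by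
  constructor <;> rw [hs _ (by decide)]
  exacts [h.r0, h.r1, h.r2, h.r3, h.r4, h.r5, h.r6, h.r7]

/-- The part of the memory that holds the parameters and the data. -/
structure DataContext {d n₁ n₂ : ℕ} (v : Variant) (p : Params) (Xp : Matrix (Fin d) (Fin n₁) ℝ)
    (Xm : Matrix (Fin d) (Fin n₂) ℝ) (s : Store) : Prop where
  m0 : s.mem 0 0 = d
  m1 : s.mem 0 1 = p.γ
  m2 : s.mem 0 2 = p.τ
  m3 : s.mem 0 3 = p.σ
  m4 : s.mem 0 4 = p.θ
  m5 : s.mem 0 5 = v.cap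
  rowp : ∀ (i : Fin d) (j : Fin n₁), s.mem (i + i + 8) j = Xp i j
  rowm : ∀ (i : Fin d) (j : Fin n₂), s.mem (i + i + 9) j = Xm i j

theorem DataContext.congr {d n₁ n₂ : ℕ} {v : Variant} {p : Params}
    {Xp : Matrix (Fin d) (Fin n₁) ℝ} {Xm : Matrix (Fin d) (Fin n₂) ℝ} {s s' : Store}
    (h : DataContext v p Xp Xm s)
    (hs : ∀ a, a = 0 ∨ 8 ≤ a → s'.mem a = s.mem a) : DataContext v p Xp Xm s' := by
  have h0 := hs 0 (Or.inl rfl)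
  refine ⟨?_, ?_, ?_, ?_, ?_, ?_, fun i j => ?_, fun i j => ?_⟩
  · rw [h0, h.m0]
  · rw [h0, h.m1]
  · rw [h0, h.m2]
  · rw [h0, h.m3]
  · rw [h0, h.m4]
  · rw [h0, h.m5]
  · rw [hs _ (Or.inr (by lia)), h.rowp]
  · rw [hs _ (Or.inr (by lia)), h.rowm]

/-- The store between two iterations. Besides the variables of the algorithm it holds the products
of `w` with the two data matrices in the arrays `6` and `7`: recomputing them would cost a factor
`d` in each iteration. -/
structure Between {d n₁ n₂ : ℕ} (v : Variant) (p : Params) (Xp : Matrix (Fin d) (Fin n₁) ℝ)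
    (Xm : Matrix (Fin d) (Fin n₂) ℝ) (s : Store) (st : State d n₁ n₂) : Prop where
  r0 : s.nat 0 = n₁
  r1 : s.nat 1 = n₂
  r2 : s.nat 2 = d
  data : DataContext v p Xp Xm s
  rep : s.Represents st
  prodp : ∀ j : Fin n₁, s.mem 6 j = (st.w ᵥ* Xp) j
  prodm : ∀ j : Fin n₂, s.mem 7 j = (st.w ᵥ* Xm) j

theorem between_startStore {d n₁ n₂ : ℕ} (v : Variant) (p : Params)
    (Xp : Matrix (Fin d) (Fin n₁) ℝ) (Xm : Matrix (Fin d) (Fin n₂) ℝ) :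
    Between v p Xp Xm (startStore v p Xp Xm) (State.start d n₁ n₂) := by
  refine ⟨rfl, rfl, rfl, ⟨rfl, rfl, rfl, rfl, rfl, rfl, fun i j => ?_, fun i j => ?_⟩,
    ⟨fun i => rfl, fun j => ?_, fun j => ?_⟩, fun j => ?_, fun j => ?_⟩
  · have h1 : ((i : ℕ) + i) / 2 = i := by lia
    have h2 : ((i : ℕ) + i) % 2 = 0 := by lia
    simp [startStore, h1, h2]
  · have h1 : ((i : ℕ) + i + 1) / 2 = i := by lia
    have h2 : ((i : ℕ) + i + 1) % 2 = 1 := by lia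
    change (startStore v p Xp Xm).mem ((i + i + 1 : ℕ) + 8) j = _
    simp [startStore, h1, h2]
  · simp [startStore, State.start]
  · simp [startStore, State.start]
  · simp [startStore, State.start]
  · simp [startStore, State.start]

/-- Loads the constants and parameters into the registers. -/
def setupProgram : Program :=
  .ofOps (.natConst 4 1) [.natConst 10 0, .natConst 11 1, .natConst 12 2, .natConst 13 3,
    .natConst 14 4, .natConst 15 5, .natConst 16 6, .natConst 17 7, .natAdd 18 3 3,
    .natConst 19 8, .natAdd 18 18 19, .natAdd 19 18 4, .load 0 10 10, .load 1 10 11,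
    .load 2 10 12, .load 3 10 13, .load 4 10 14, .load 5 10 15, .realConst 6 0, .realConst 7 1]

theorem setupProgram_spec {d n₁ n₂ i : ℕ} {v : Variant} {p : Params}
    {Xp : Matrix (Fin d) (Fin n₁) ℝ} {Xm : Matrix (Fin d) (Fin n₂) ℝ} {s : Store}
    (r0 : s.nat 0 = n₁) (r1 : s.nat 1 = n₂) (r2 : s.nat 2 = d) (r3 : s.nat 3 = i)
    (h : DataContext v p Xp Xm s) :
    Costs setupProgram s 21 fun s' =>
      NatContext d n₁ n₂ i s' ∧ RealContext d p v.cap s' ∧ s'.mem = s.mem := by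
  refine Costs.ofOps ⟨?_, ?_, ?_⟩
  · constructor <;> simp [Op.apply, *]
  · constructor <;> simp [Op.apply, h.m0, h.m1, h.m2, h.m3, h.m4, h.m5]
  · simp [Op.apply]

/-- The step in the coordinate of `w` whose index is held in the natural-number register `3`,
and the coefficients of the mirror steps. -/
def coordProgram : Program :=
  .ofOps (.load 20 11 3) [.realSub 21 8 9, .realMul 21 3 21, .realAdd 21 20 21, .realAdd 22 3 7,
    .realDiv 21 21 22, .store 11 3 21, .realSub 10 21 20, .realMul 11 0 10, .realDiv 12 1 0,
    .realDiv 14 7 2, .realAdd 12 12 14, .realDiv 13 7 0]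

theorem coordProgram_spec {d n₁ n₂ i : ℕ} {p : Params} {cap : ℝ} {s : Store} {δ : ℝ}
    (hN : NatContext d n₁ n₂ i s) (hR : RealContext d p cap s)
    (hδ : δ = (s.mem 1 i + p.σ * (s.real 8 - s.real 9)) / (p.σ + 1) - s.mem 1 i) :
    Costs coordProgram s 13 fun s' =>
      NatContext d n₁ n₂ i s' ∧ RealContext d p cap s' ∧
      s'.real 10 = δ ∧ s'.real 11 = d * δ ∧ s'.real 12 = p.γ / d + 1 / p.τ ∧
      s'.real 13 = 1 / d ∧ s'.real 14 = 1 / p.τ ∧ (∀ a, a ≠ 1 → s'.mem a = s.mem a) ∧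
      ∀ b, s'.mem 1 b = if b = i then s.mem 1 b + δ else s.mem 1 b := by
  have n3 := hN.r3
  have n11 := hN.r11
  have h0 := hR.r0
  have h1 := hR.r1
  have h2 := hR.r2
  have h3 := hR.r3
  have h7 := hR.r7
  refine Costs.ofOps ⟨hN.congr ?_, hR.congr ?_, ?_, ?_, ?_, ?_, ?_, ?_, ?_⟩
  · simp [Op.apply]
  · intro r hr
    interval_cases r <;> simp [Op.apply]
  · simp [Op.apply, n3, n11, h3, h7, hδ]
  · simp [Op.apply, n3, n11, h0, h3, h7, hδ]
  · simp [Op.apply, h0, h1, h2, h7]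
  · simp [Op.apply, h0, h7]
  · simp [Op.apply, h2, h7]
  · intro a ha
    simp [Op.apply, n11, ha]
  · intro b
    by_cases hb : b = i
    · subst hb
      simp [Op.apply, n3, n11, h3, h7, hδ]
    · simp [Op.apply, n3, n11, hb]

/-- One iteration of the algorithm; the natural-number register `3` holds the picked index. -/
def iterationProgram : Program :=
  .seq setupProgram (.seq (dotProgram 0 12 13 18 8) (.seq (dotProgram 1 14 15 19 9)
    (.seq coordProgram (.seq (mirrorProgram 0 12 13 16 18) (.seq (.op (.realSub 13 6 13))
      (mirrorProgram 1 14 15 17 19))))))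

theorem vecMul_add_single {d m : ℕ} (w : Fin d → ℝ) (X : Matrix (Fin d) (Fin m) ℝ) (i : Fin d)
    (r : ℝ) (j : Fin m) : ((w + Pi.single i r) ᵥ* X) j = (w ᵥ* X) j + r * X i j := by
  simp [Matrix.add_vecMul, Matrix.single_vecMul]

theorem iterationProgram_spec {d n₁ n₂ : ℕ} {v : Variant} {p : Params}
    {Xp : Matrix (Fin d) (Fin n₁) ℝ} {Xm : Matrix (Fin d) (Fin n₂) ℝ} {s : Store}
    {st : State d n₁ n₂} (h₁ : (v.domain n₁).Nonempty) (h₂ : (v.domain n₂).Nonempty)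
    (hγ : 0 < p.γ) (hτ : 0 < p.τ) (hs : Between v p Xp Xm s st) (i : Fin d) :
    Costs iterationProgram (s.withIndex i)
      (21 + ((10 * n₁ + 3) + ((10 * n₂ + 3) + (13 + (mirrorCost v.cap n₁ +
        (1 + mirrorCost v.cap n₂))))))
      fun s' => Between v p Xp Xm s' (st.next v p Xp Xm i) := by
  have hd : (0 : ℝ) < d := by exact_mod_cast i.pos
  set δ := coordStep p Xp Xm st i with hδ
  have hu : st.w + (d : ℝ) • ((st.next v p Xp Xm i).w - st.w) = st.w + Pi.single i (d * δ) := by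
    rw [next_w, add_sub_cancel_left, ← hδ, ← Pi.single_smul, smul_eq_mul]
  obtain ⟨rw0, rη, rξ⟩ := hs.rep
  have hdata : DataContext v p Xp Xm (s.withIndex i) := hs.data.congr fun _ _ => rfl
  refine Costs.seq (setupProgram_spec (i := i) hs.r0 hs.r1 hs.r2
    (by simp [Store.withIndex]) hdata) ?_
  rintro s₁ ⟨hN₁, hR₁, mem₁⟩
  change s₁.mem = s.mem at mem₁
  refine Costs.seq (dotProgram_spec (n := n₁) (by decide) (by decide) (by decide) (by decide)
    (by decide) (by decide) hN₁.r4 hN₁.r0) ?_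
  rintro s₂ ⟨nat₂, real₂, mem₂, dot₂⟩
  have hN₂ := hN₁.congr nat₂
  have hR₂ := hR₁.congr fun r hr => real₂ r (by lia) (by lia)
  refine Costs.seq (dotProgram_spec (n := n₂) (by decide) (by decide) (by decide) (by decide)
    (by decide) (by decide) hN₂.r4 hN₂.r1) ?_
  rintro s₃ ⟨nat₃, real₃, mem₃, dot₃⟩
  have hN₃ := hN₂.congr nat₃
  have hR₃ := hR₂.congr fun r hr => real₃ r (by lia) (by lia)
  have hδ₃ : δ = (s₃.mem 1 i + p.σ * (s₃.real 8 - s₃.real 9)) / (p.σ + 1) - s₃.mem 1 i := by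
    rw [dot₃, real₃ 8 (by decide) (by decide), dot₂, mem₃, mem₂, mem₁, hN₁.r12, hN₁.r13, hN₁.r18,
      hN₂.r14, hN₂.r15, hN₂.r19, hR₁.r4, hR₂.r4, Finset.sum_range, Finset.sum_range]
    simp only [(rη _).1, (rη _).2, (rξ _).1, (rξ _).2, hs.data.rowp, hs.data.rowm, rw0]
    rfl
  refine Costs.seq (coordProgram_spec hN₃ hR₃ hδ₃) ?_
  rintro s₄ ⟨hN₄, hR₄, r10, r11, r12, r13, r14, mem₄, w₄⟩
  rw [mem₃, mem₂, mem₁] at mem₄ w₄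
  have hcap := Variant.cap_pos h₁
  refine Costs.seq (Costs.mono (mirrorProgram_spec (n := n₁) (N := 0) (cur := 12) (prev := 13)
    (prod := 16) (row := 18) (s := s₄)
    (by decide) (by decide) (by decide) (by decide) (by decide) hN₄.r4 hR₄.r6 hR₄.r7 hN₄.r0
    (by rw [hN₄.r12, hN₄.r13]; decide) (by rw [hN₄.r12, hN₄.r16]; decide)
    (by rw [hN₄.r13, hN₄.r16]; decide)
    (by rw [hN₄.r18, hN₄.r12]; lia) (by rw [hN₄.r18, hN₄.r13]; lia)
    (by rw [hN₄.r18, hN₄.r16]; lia)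
    (by rw [hR₄.r5]; exact hcap) (by rw [hR₄.r5]; exact Variant.one_le_mul_cap h₁)
    fun b => rfl) (by rw [hR₄.r5]) fun _ h => h) ?_
  rintro s₅ ⟨nat₅, real₅, mem₅, ⟨l₁, hl₁, hsum₁, cur₅⟩, prev₅, prod₅⟩
  simp only [hN₄.r12, hN₄.r13, hN₄.r16, hN₄.r18, hR₄.r5, r10, r11, r12, r13, r14,
    mem₄ 2 (by decide), mem₄ 6 (by decide), mem₄ (i + i + 8) (by lia)]
    at mem₅ hsum₁ cur₅ prev₅ prod₅
  have hN₅ := hN₄.congr nat₅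
  have hR₅ := hR₄.congr fun r hr => real₅ r (by lia)
  refine Costs.seq (Costs.op (Q := fun s' => s' = _) rfl) ?_
  rintro _ rfl
  set s₆ := (Op.realSub 13 6 13).apply s₅ with hs₆
  have hN₆ : NatContext d n₁ n₂ i s₆ := hN₅.congr fun _ _ => rfl
  have hR₆ : RealContext d p v.cap s₆ := hR₅.congr fun r hr => by
    have : r ≠ 13 := by lia
    simp [hs₆, Op.apply, this]
  have mem₆ : s₆.mem = s₅.mem := rfl
  have q10 : s₆.real 10 = δ := by simp [hs₆, Op.apply, real₅ 10, r10]
  have q11 : s₆.real 11 = d * δ := by simp [hs₆, Op.apply, real₅ 11, r11]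
  have q12 : s₆.real 12 = p.γ / d + 1 / p.τ := by simp [hs₆, Op.apply, real₅ 12, r12]
  have q13 : s₆.real 13 = -(1 / d) := by simp [hs₆, Op.apply, real₅ 13, r13, hR₅.r6]
  have q14 : s₆.real 14 = 1 / p.τ := by simp [hs₆, Op.apply, real₅ 14, r14]
  refine (mirrorProgram_spec (n := n₂) (N := 1) (cur := 14) (prev := 15)
    (prod := 17) (row := 19) (s := s₆)
    (by decide) (by decide) (by decide) (by decide) (by decide) hN₆.r4 hR₆.r6 hR₆.r7 hN₆.r1
    (by rw [hN₆.r14, hN₆.r15]; decide) (by rw [hN₆.r14, hN₆.r17]; decide)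
    (by rw [hN₆.r15, hN₆.r17]; decide)
    (by rw [hN₆.r19, hN₆.r14]; lia) (by rw [hN₆.r19, hN₆.r15]; lia)
    (by rw [hN₆.r19, hN₆.r17]; lia)
    (by rw [hR₆.r5]; exact hcap) (by rw [hR₆.r5]; exact Variant.one_le_mul_cap h₂)
    fun b => rfl).mono (by rw [hR₆.r5]) ?_
  rintro s₇ ⟨nat₇, real₇, mem₇, ⟨l₂, hl₂, hsum₂, cur₇⟩, prev₇, prod₇⟩
  have m4 : s₅.mem 4 = s.mem 4 := (mem₅ 4 (by decide) (by decide) (by decide)).trans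
    (mem₄ 4 (by decide))
  have m7 : s₅.mem 7 = s.mem 7 := (mem₅ 7 (by decide) (by decide) (by decide)).trans
    (mem₄ 7 (by decide))
  have m19 : s₅.mem (i + i + 9) = s.mem (i + i + 9) :=
    (mem₅ _ (by lia) (by lia) (by lia)).trans (mem₄ _ (by lia))
  simp only [hN₆.r14, hN₆.r15, hN₆.r17, hN₆.r19, hR₆.r5, q10, q11, q12, q13, q14, mem₆, m4, m7, m19]
    at mem₇ hsum₂ cur₇ prev₇ prod₇
  have hN₇ := hN₆.congr nat₇
  have back : ∀ a, a ≠ 2 → a ≠ 3 → a ≠ 6 → a ≠ 4 → a ≠ 5 → a ≠ 7 → s₇.mem a = s₄.mem a :=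
    fun a a₂ a₃ a₆ a₄ a₅ a₇ => (mem₇ a a₄ a₅ a₇).trans (mem₅ a a₂ a₃ a₆)
  have lin : ∀ {m : ℕ} (X : Matrix (Fin d) (Fin m) ℝ) (y : Fin m → ℝ) (u : Fin d → ℝ) (r : ℝ),
      r * (u ⬝ᵥ (X *ᵥ y)) = ∑ j, (r * (u ᵥ* X) j) * y j := by
    intro m X y u r
    rw [Matrix.dotProduct_mulVec, dotProduct, Finset.mul_sum]
    simp only [mul_assoc]
  set u := st.w + Pi.single i (d * δ) with hudef
  have eη : (st.next v p Xp Xm i).η = argmin (v.domain n₁) fun η =>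
      1 / d * (u ⬝ᵥ (Xp *ᵥ η)) + p.γ / d * entropyH η + 1 / p.τ * bregman st.η η := by
    rw [← hu]; rfl
  have eξ : (st.next v p Xp Xm i).ξ = argmin (v.domain n₂) fun ξ =>
      -(1 / d * (u ⬝ᵥ (Xm *ᵥ ξ))) + p.γ / d * entropyH ξ + 1 / p.τ * bregman st.ξ ξ := by
    rw [← hu]; rfl
  refine ⟨hN₇.r0, hN₇.r1, hN₇.r2, hs.data.congr fun a ha => ?_,
    ⟨fun k => ?_, fun j => ⟨?_, ?_⟩, fun j => ⟨?_, ?_⟩⟩, fun j => ?_, fun j => ?_⟩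
  · rw [back a (by lia) (by lia) (by lia) (by lia) (by lia) (by lia), mem₄ a (by lia)]
  · rw [back 1 (by decide) (by decide) (by decide) (by decide) (by decide) (by decide), w₄, next_w,
      rw0 k, Pi.add_apply]
    by_cases hk : k = i
    · subst hk
      rw [if_pos rfl, Pi.single_eq_same]
    · rw [if_neg (fun h => hk (Fin.ext h)), Pi.single_eq_of_ne hk, add_zero]
  · rw [mem₇ 2 (by decide) (by decide) (by decide), cur₅ j j.2, eη,
      argmin_mirror_eq (b := fun j => 1 / (d : ℝ) * (u ᵥ* Xp) j) (x := st.η) h₁ hτ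
        (div_pos hγ hd) hl₁ (fun y => by simp only [lin]) ?_ hsum₁ j]
    intro j
    simp only [mirrorCoeff, hudef, vecMul_add_single, hs.prodp, hs.data.rowp, (rη j).1]
  · rw [mem₇ 3 (by decide) (by decide) (by decide), prev₅ j j.2, (rη j).1]
    rfl
  · rw [cur₇ j j.2, eξ,
      argmin_mirror_eq (b := fun j => -(1 / (d : ℝ)) * (u ᵥ* Xm) j) (x := st.ξ) h₂ hτ
        (div_pos hγ hd) hl₂ (fun y => by rw [← neg_mul]; simp only [lin]) ?_ hsum₂ j]
    intro j
    simp only [mirrorCoeff, hudef, vecMul_add_single, hs.prodm, hs.data.rowm, (rξ j).1]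
  · rw [prev₇ j j.2, (rξ j).1]
    rfl
  · rw [mem₇ 6 (by decide) (by decide) (by decide), prod₅ j j.2, next_w, vecMul_add_single,
      hs.prodp, hs.data.rowp]
  · rw [prod₇ j j.2, next_w, vecMul_add_single, hs.prodm, hs.data.rowm]

/-- The number of steps of one iteration is linear in the number of points, times `1 + 1 / ν`. -/
theorem iteration_cost_le {n₁ n₂ : ℕ} {ν : ℝ} (hν : 0 < ν) (h₁ : 0 < n₁) (h₂ : 0 < n₂) :
    ((21 + ((10 * n₁ + 3) + ((10 * n₂ + 3) + (13 + (mirrorCost ν n₁ +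
        (1 + mirrorCost ν n₂))))) : ℕ) : ℝ) ≤ 94 * (n₁ + n₂) * (1 + 1 / ν) := by
  have hF : (⌊1 / ν⌋₊ : ℝ) ≤ 1 / ν := Nat.floor_le (by positivity)
  have k₁ : (1 : ℝ) ≤ n₁ := by exact_mod_cast h₁
  have k₂ : (1 : ℝ) ≤ n₂ := by exact_mod_cast h₂
  have hF0 : (0 : ℝ) ≤ ⌊1 / ν⌋₊ := Nat.cast_nonneg _
  simp only [mirrorCost]
  push_cast
  generalize (⌊1 / ν⌋₊ : ℝ) = F at *
  generalize 1 / ν = r at *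
  nlinarith

/-- The stores between the iterations are obtained by recursion from `Between`. -/
theorem iteration_cost : ∃ (P : Program) (K : ℝ),
      ∀ (d n₁ n₂ : ℕ) (v : Variant) (p : Params)
        (Xp : Matrix (Fin d) (Fin n₁) ℝ) (Xm : Matrix (Fin d) (Fin n₂) ℝ) (ι : ℕ → Fin d),
        (v.domain n₁).Nonempty → (v.domain n₂).Nonempty →
        0 < p.γ → 0 < p.τ → 0 < p.σ →
        ∃ M : ℕ → Store,
          M 0 = startStore v p Xp Xm ∧
          ∀ t : ℕ,
            (M t).Represents (run v p Xp Xm t fun r => ι r) ∧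
            ∃ k : ℕ, (k : ℝ) ≤ K * (n₁ + n₂) * (1 + 1 / v.cap) ∧
              Exec P ((M t).withIndex (ι t)) k (M (t + 1)) := by
  refine ⟨iterationProgram, 94, fun d n₁ n₂ v p Xp Xm ι h₁ h₂ hγ hτ _ => ?_⟩
  have step := fun (s : Store) (t : ℕ)
      (hs : Between v p Xp Xm s (run v p Xp Xm t fun r => ι r)) =>
    iterationProgram_spec h₁ h₂ hγ hτ hs (ι t)
  choose! K hK next hexec hnext using step
  let M : ℕ → Store := fun t => Nat.rec (startStore v p Xp Xm) (fun t s => next s t) t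
  have hM : ∀ t, Between v p Xp Xm (M t) (run v p Xp Xm t fun r => ι r) := by
    intro t
    induction t with
    | zero => exact between_startStore v p Xp Xm
    | succ t ih => exact hnext (M t) t ih
  refine ⟨M, rfl, fun t => ⟨(hM t).rep, K (M t) t, ?_, hexec (M t) t (hM t)⟩⟩
  exact (Nat.cast_le.mpr (hK (M t) t (hM t))).trans
    (iteration_cost_le (Variant.cap_pos h₁) (Variant.size_pos h₁) (Variant.size_pos h₂))

end SaddleSVC

theorem mainTheorem2 :
    -- Convergence.
    (∀ a : ℕ, ∃ c₀ > (0 : ℝ), ∀ c ≥ c₀, ∃ C > (0 : ℝ),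
      ∀ (d n₁ n₂ : ℕ) (v : SaddleSVC.Variant)
        (A : Matrix (Fin d) (Fin n₁) ℝ) (B : Matrix (Fin d) (Fin n₂) ℝ) (ε β : ℝ),
        (∃ k : ℕ, d = 2 ^ k) →
        (v.domain n₁).Nonempty → (v.domain n₂).Nonempty →
        (∀ j, ∑ i, A i j ^ 2 ≤ 1) → (∀ j, ∑ i, B i j ^ 2 ≤ 1) →
        (∀ η ∈ v.domain n₁, ∀ ξ ∈ v.domain n₂, A *ᵥ η ≠ B *ᵥ ξ) →
        0 < ε → ε < 1 → 0 < β → β ≤ 1 →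
        ∃ w₀ : Fin d → ℝ,
          (∀ w, SaddleSVC.IsOptimal v A B (SaddleSVC.gammaOf (n₁ + n₂) ε β) w ↔ w = w₀) ∧
          1 - (d : ℝ) / ((n₁ + n₂ : ℕ) : ℝ) ^ a ≤
            SaddleSVC.uniformProb fun s : Fin d → ℤˣ =>
              ∀ T : ℕ,
                C * (d + √(d / (ε * β)) * Real.log (n₁ + n₂ : ℕ)) *
                    Real.log (C / (ε * SaddleSVC.OPT v A B)) ≤ T →
                ∀ γ ∈ ({0, SaddleSVC.gammaOf (n₁ + n₂) ε β} : Set ℝ),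
                  (SaddleSVC.uniformExp fun ι : Fin T → Fin d =>
                    SaddleSVC.lowerValue v A B γ w₀ -
                      SaddleSVC.lowerValue v A B γ
                        (SaddleSVC.output v (SaddleSVC.paramsOf d (n₁ + n₂) ε β c) A B s T ι)) ≤
                    ε * SaddleSVC.OPT v A B) ∧
    -- Cost of an iteration.
    (∃ (P : SaddleSVC.Program) (K : ℝ),
      ∀ (d n₁ n₂ : ℕ) (v : SaddleSVC.Variant) (p : SaddleSVC.Params)
        (Xp : Matrix (Fin d) (Fin n₁) ℝ) (Xm : Matrix (Fin d) (Fin n₂) ℝ) (ι : ℕ → Fin d),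
        (v.domain n₁).Nonempty → (v.domain n₂).Nonempty →
        0 < p.γ → 0 < p.τ → 0 < p.σ →
        ∃ M : ℕ → SaddleSVC.Store,
          M 0 = SaddleSVC.startStore v p Xp Xm ∧
          ∀ t : ℕ,
            (M t).Represents (SaddleSVC.run v p Xp Xm t fun r => ι r) ∧
            ∃ k : ℕ, (k : ℝ) ≤ K * (n₁ + n₂) * (1 + 1 / v.cap) ∧
              SaddleSVC.Exec P ((M t).withIndex (ι t)) k (M (t + 1))) :=
  ⟨SaddleSVC.convergence, SaddleSVC.iteration_cost⟩
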